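/- Let $(M,g)$ be a compact connected smooth Riemannian manifold without boundary, of dimension $n\ge 2$, strictly negatively curved and scaled so that its universal cover $X$, with the lifted Riemannian metric and the associated distance $d$, is a CAT$(-1)$ space. Let $R$ be the diameter of $M$, let $\Gamma=\pi_1(M)$ act on $X$ by deck transformations, and let $\delta\ge 0$ be such that $(x|y)_r\ge\min\{(x|w)_r,(y|w)_r\}-\delta$ for all $x,y,r,w\in X$, where $(x|y)_r=\frac12[d(x,r)+d(y,r)-d(x,y)]$ is the Gromov product. Fix $p\in X$. Let $\bar X$ be the horofunction compactification of $X$, i.e. the closure of the image of $X$ in $C(X)/\mathbb C$ (continuous functions modulo constants, with the topology induced by uniform convergence on compact sets) under $x\mapsto[d(x,\cdot)]$, and let $B=\bar X\setminus X$. The Gromov product $(\cdot|\cdot)_p$ extends continuously to $\bar X\times\bar X$, with values in $[0,\infty]$. For $b,c\in B$ and $q\in X$ put $\sigma_p(b,c)=e^{-(b|c)_p}$, which is a metric on $B$, and $\beta_b(p,q)=d(p,q)-2(q|b)_p$. Let $$\eta=\lim_{t\to\infty}\frac{\log\operatorname{vol}\{x\in X: d(p,x)\le t\}}{t},$$ and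 let $\nu$ be the $\eta$-dimensional Hausdorff measure of $(B,\sigma_p)$, normalized so that $\nu(B)=1$. For $q\in X$ let $$\lambda^q(b)=e^{-\frac12\eta\beta_b(p,q)},\qquad \|\lambda^q\|_1=\int_B\lambda^q\,d\nu ,$$ so that $\lambda^{\gamma p}$ is the square root of the Radon–Nikodym derivative $d\gamma_*\nu/d\nu$. For $t>0$ let $S_t=\{\gamma\in\Gamma: t-R<d(\gamma p,p)<t+R\}$. Then the functions $$\frac1{|S_t|}\sum_{\gamma\in S_t}\frac{\lambda^{\gamma p}}{\|\lambda^{\gamma p}\|_1},\qquad t>R+2\delta,$$ are uniformly bounded in $L^\infty(B,\nu)$: there is a constant $C<\infty$, independent of $t$, such that for every $t>R+2\delta$ the function above belongs to $L^\infty(B,\nu)$ and has $L^\infty$-norm at most $C$. -/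

import Mathlib

open scoped Manifold ContDiff Topology ENNReal NNReal
open MeasureTheory Filter Bundle

namespace BoundaryRep

noncomputable section

/-! ### Metric geometry: CAT(-1) spaces and Gromov hyperbolicity -/

/-- `z` lies on a geodesic segment from `x` to `y` (in a geodesic space). -/
def Between {X : Type*} [MetricSpace X] (x z y : X) : Prop :=
  dist x z + dist z y = dist x y

/-- Any two points are joined by an isometrically embedded interval. -/
def IsGeodesic (X : Type*) [MetricSpace X] : Prop :=
  ∀ x y : X, ∃ c : ℝ → X, c 0 = x ∧ c (dist x y) = y ∧
    ∀ s ∈ Set.Icc 0 (dist x y), ∀ t ∈ Set.Icc 0 (dist x y), dist (c s) (c t) = |s - t|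

/-- CAT(-1) space: a geodesic space in which geodesic triangles are not thicker than their
comparison triangles in the hyperbolic plane of curvature `-1` (the upper half plane).
Here `u` is a point of a side `[x, y]`, `v` a point of a side `[x, z]`, and
`x' y' z' u' v'` are the comparison points. -/
structure IsCATNegOne (X : Type*) [MetricSpace X] : Prop where
  geodesic : IsGeodesic X
  comparison : ∀ x y z u v : X, Between x u y → Between x v z →
    ∀ x' y' z' u' v' : UpperHalfPlane,
      dist x' y' = dist x y → dist x' z' = dist x z → dist y' z' = dist y z →
      dist x' u' = dist x u → dist u' y' = dist u y →
      dist x' v' = dist x v → dist v' z' = dist v z →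
      dist u v ≤ dist u' v'

/-- The Gromov product `(x|y)_r`. -/
def gromov {X : Type*} [MetricSpace X] (r x y : X) : ℝ :=
  (dist x r + dist y r - dist x y) / 2

/-- `δ`-hyperbolicity (four point condition). -/
def IsHyperbolic (X : Type*) [MetricSpace X] (δ : ℝ) : Prop :=
  ∀ p q r w : X, min (gromov r p w) (gromov r q w) - δ ≤ gromov r p q

/-! ### The universal cover and its deck transformation group -/

/-- A smooth covering map of Riemannian manifolds which is a local isometry, from a simply
connected space: `X` is the universal cover of `M`, with the lifted Riemannian metric. -/
structure IsRiemannianUniversalCover (n : ℕ) {M X : Type*}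
    [MetricSpace M] [ChartedSpace (EuclideanSpace ℝ (Fin n)) M]
    [RiemannianBundle (fun x : M => TangentSpace (𝓡 n) x)]
    [MetricSpace X] [ChartedSpace (EuclideanSpace ℝ (Fin n)) X]
    [RiemannianBundle (fun x : X => TangentSpace (𝓡 n) x)]
    (pr : X → M) : Prop where
  simplyConnected : SimplyConnectedSpace X
  isCoveringMap : IsCoveringMap pr
  isLocalDiffeomorph : IsLocalDiffeomorph (𝓡 n) (𝓡 n) ∞ pr
  norm_mfderiv : ∀ (x : X) (v : TangentSpace (𝓡 n) x),
    ‖mfderiv (𝓡 n) (𝓡 n) pr x v‖ = ‖v‖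

/-- The group of deck transformations of `pr`. For the universal cover this is the fundamental
group of the base in its action on the cover. -/
def deckGroup {M X : Type*} [TopologicalSpace X] (pr : X → M) : Subgroup (X ≃ₜ X) where
  carrier := {g | ∀ x, pr (g x) = pr x}
  mul_mem' := by
    intro a b ha hb x
    exact (ha (b x)).trans (hb x)
  one_mem' := fun _ => rfl
  inv_mem' := by
    intro a ha x
    have h := ha (a⁻¹ x)
    have e : a (a⁻¹ x) = x := a.apply_symm_apply x
    rw [e] at h
    exact h.symm

/-- `S_t = {γ | d(γ p, p) ∈ (t - R, t + R)}`, where `R` is the diameter of `M`. -/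
def annulus {M X : Type*} [MetricSpace M] [MetricSpace X] (pr : X → M) (p : X) (t : ℝ) :
    Set (deckGroup pr) :=
  {γ | dist (γ.1 p) p ∈ Set.Ioo (t - Metric.diam (Set.univ : Set M))
    (t + Metric.diam (Set.univ : Set M))}

/-! ### The horofunction boundary -/

/-- `C(X)/ℂ`: continuous functions modulo constants, with the quotient of the topology of
uniform convergence on compact sets. -/
abbrev FunModConst (X : Type*) [TopologicalSpace X] : Type _ :=
  C(X, ℂ) ⧸ LinearMap.range (Algebra.linearMap ℂ C(X, ℂ))

/-- The map `x ↦ [d(x, ·)]`. -/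
def horoMap {X : Type*} [MetricSpace X] (x : X) : FunModConst X :=
  Submodule.Quotient.mk (⟨fun y => (dist x y : ℂ), by fun_prop⟩ : C(X, ℂ))

/-- The boundary `B = ∂X`: the closure of the image of `X` in `C(X)/ℂ`, minus that image. -/
abbrev Boundary (X : Type*) [MetricSpace X] : Type _ :=
  ↥(closure (Set.range (horoMap (X := X))) \ Set.range (horoMap (X := X)))

/-- The continuous extension of the Gromov product `(·|·)_p` to the horofunction
compactification; it takes values in the extended reals, as `(b|b)_p = +∞` for `b` in the
boundary. -/
def gromovExt {X : Type*} [MetricSpace X] (p : X) (ξ ζ : FunModConst X) : EReal :=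
  limUnder (comap (fun z : X × X => (horoMap z.1, horoMap z.2)) (𝓝 (ξ, ζ)))
    (fun z : X × X => ((gromov p z.1 z.2 : ℝ) : EReal))

/-- The Busemann metric `σ_p(b, c) = exp (-(b|c)_p)` on the boundary. -/
def busemannDist {X : Type*} [MetricSpace X] (p : X) (b c : Boundary X) : ℝ≥0∞ :=
  EReal.exp (-(gromovExt p b.1 c.1))

/-- The Busemann cocycle `β_b(p, q) = d(p, q) - 2 (q|b)_p`. -/
def busemann {X : Type*} [MetricSpace X] (b : Boundary X) (p q : X) : ℝ :=
  dist p q - 2 * (gromovExt p (horoMap q) b.1).toReal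

/-! ### The critical exponent and the measure on the boundary -/

/-- The volume on an `n`-dimensional Riemannian manifold, as the `n`-dimensional Hausdorff
measure of the Riemannian distance. It is the Riemannian volume up to a positive factor that
depends on `n` only; such a factor does not affect the critical exponent below. -/
def vol (n : ℕ) {X : Type*} [MetricSpace X] (A : Set X) : ℝ≥0∞ :=
  letI : MeasurableSpace X := borel X
  haveI : BorelSpace X := ⟨rfl⟩
  Measure.hausdorffMeasure (n : ℝ) A

/-- The critical exponent `η = lim_{t → ∞} log vol(X(p, t)) / t`. -/
def critExp (n : ℕ) {X : Type*} [MetricSpace X] (p : X) : ℝ :=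
  limUnder atTop (fun t : ℝ => Real.log (vol n (Metric.closedBall p t)).toReal / t)

/-- The diameter of a set with respect to a distance function `σ`. -/
def diamOf {B : Type*} (σ : B → B → ℝ≥0∞) (A : Set B) : ℝ≥0∞ :=
  ⨆ b ∈ A, ⨆ c ∈ A, σ b c

/-- The `s`-dimensional Hausdorff outer measure of a distance function `σ`: the limit as
`r → 0` of the infimum of `∑ (diam A_i) ^ s` over countable covers by sets `A_i` of diameter
at most `r`. -/
def hausdorffOuter {B : Type*} (σ : B → B → ℝ≥0∞) (s : ℝ) : OuterMeasure B :=
  ⨆ (r : ℝ≥0∞) (_ : 0 < r),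
    OuterMeasure.boundedBy (fun A => ⨅ _ : diamOf σ A ≤ r, diamOf σ A ^ s)

/-- The `s`-dimensional Hausdorff measure, on the σ-algebra of all sets that are measurable
(in the sense of Carathéodory) for the Hausdorff outer measure. -/
def hausdorff {B : Type*} (σ : B → B → ℝ≥0∞) (s : ℝ) :
    @Measure B (hausdorffOuter σ s).caratheodory :=
  @OuterMeasure.toMeasure B (hausdorffOuter σ s).caratheodory (hausdorffOuter σ s) le_rfl

/-- `ν = ν_p`: the `η`-dimensional Hausdorff measure of `(B, σ_p)`, normalized to total
mass one. -/
def nu (n : ℕ) {X : Type*} [MetricSpace X] (p : X) :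
    @Measure (Boundary X) (hausdorffOuter (busemannDist p) (critExp n p)).caratheodory :=
  (hausdorff (busemannDist p) (critExp n p) Set.univ)⁻¹ •
    hausdorff (busemannDist p) (critExp n p)

/-! ### The functions -/

/-- `λ^q(b) = exp (-(1/2) η β_b(p, q))`. For `q = γ p` this is `ρ(γ) 1`. -/
def lam (n : ℕ) {X : Type*} [MetricSpace X] (p q : X) (b : Boundary X) : ℝ :=
  Real.exp (-(1 / 2) * critExp n p * busemann b p q)

/-- `‖λ^q‖₁ = ⟨λ^q, 1⟩`. -/
def lamNorm (n : ℕ) {X : Type*} [MetricSpace X] (p q : X) : ℝ :=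
  ∫ b, lam n p q b ∂(nu n p)

/-- `(1/|S_t|) ∑_{γ ∈ S_t} λ^{γp} / ‖λ^{γp}‖₁`. -/
def avg (n : ℕ) {M X : Type*} [MetricSpace M] [MetricSpace X] (pr : X → M) (p : X) (t : ℝ)
    (b : Boundary X) : ℝ :=
  ((annulus pr p t).ncard : ℝ)⁻¹ *
    ∑ᶠ γ ∈ annulus pr p t, lam n p (γ.1 p) b / lamNorm n p (γ.1 p)

end

end BoundaryRep

namespace BoundaryRep

/-! ### Stewart's inequality and unique geodesics in CAT(-1) spaces -/

section CAT

variable {X : Type*} [MetricSpace X]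

/-! Since `λ^q(b) = e^{-ηd(p,q)/2} e^{η(q|b)_p}`, the first factor cancels in `λ^q / ‖λ^q‖₁`, and
only the functions `e^{η(γp|b)_p}` matter. When `η > 0` and the Hausdorff measure is positive and
finite, three estimates, uniform in `t` and `b`, give the bound. (1) `|S_t| ≥ c e^{ηt}`
(`exists_le_card_annulus`), because the shadows of the points `γp`, `γ ∈ S_t`, cover the boundary
and each has measure at most a constant times `e^{-ηt}`. (2) The sum over `S_t` of `e^{η(γp|b)_p}`
is at most `C (1+t) e^{ηt}` (`exists_sum_annulus_le`): at most `C e^{η(t-k)}` elements have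
`(γp|b)_p ≥ k`, so each of about `t` levels contributes at most a constant times `e^{ηt}`. (3) `∫
e^{η(q|b)_p} dν(b) ≥ c (1 + d(p,q))` (`exists_le_integral`): the level set at height `k ≤ d(p,q)`
has measure at least `c e^{-ηk}`, so every level contributes a constant. The linear factors in (2)
and (3) cancel (`exists_average_le`).

The measure estimates are Sullivan's shadow lemma. It follows from the conformality of `σ_p` under
isometries (`busemannDist_map`) and the scaling of Hausdorff measure under Lipschitz maps. The
CAT(-1) condition enters through Stewart's inequality (`sinh_mul_cosh_dist_le`): points with a large
Gromov product have nearly equal horofunctions, whence the Gromov product extends to the boundary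
and `b ↦ (q|b)_p` is uniformly continuous, hence measurable. If the total Hausdorff measure is `0`
or `∞`, then `nu` is the zero measure and the claim is trivial.

The delicate point is that `S_t` is an open annulus whose half-width is exactly the diameter `R`,
whereas the orbit is only `R`-dense in the closed sense. That such annuli still contain enough orbit
points (`exists_mem_abs_dist_sub_lt`) uses the extension of geodesics and the fact that spheres have
no isolated points. Both come from the local Euclidean structure, the second in dimension at least
two. -/

lemma eq_of_cosh_eq {a b : ℝ} (ha : 0 ≤ a) (hb : 0 ≤ b) (h : Real.cosh a = Real.cosh b) :
    a = b := by
  rw [← Real.arcosh_cosh ha, ← Real.arcosh_cosh hb, h]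

/-- Comparison of a vertex with a point of the opposite side in a CAT(-1) space. -/
theorem IsCATNegOne.sinh_mul_cosh_dist_le (hX : IsCATNegOne X) {p v x : X} (q : X)
    (hv : Between p v x) :
    Real.sinh (dist p x) * Real.cosh (dist q v) ≤
      Real.sinh (dist v x) * Real.cosh (dist q p) + Real.sinh (dist p v) * Real.cosh (dist q x) := by
  rcases eq_or_lt_of_le (dist_nonneg (x := p) (y := x)) with h0 | ha
  · unfold Between at hv
    have h1 : dist p v = 0 := by
      have := dist_nonneg (x := p) (y := v); have := dist_nonneg (x := v) (y := x); linarith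
    have h2 : dist v x = 0 := by linarith
    simp [h1, h2, ← h0]
  set a := dist p x with ha_def
  set s := dist p v with hs_def
  set D := dist q p with hD_def
  set E := dist q x with hE_def
  have hs0 : 0 ≤ s := dist_nonneg
  have hvx : dist v x = a - s := by unfold Between at hv; linarith
  have hsa : s ≤ a := by have := dist_nonneg (x := v) (y := x); linarith
  have hD0 : 0 ≤ D := dist_nonneg
  have hE0 : 0 ≤ E := dist_nonneg
  have tri1 : E ≤ D + a := dist_triangle q p x
  have tri2 : a ≤ D + E := by
    have := dist_triangle p q x; rwa [dist_comm p q] at this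
  have tri3 : D ≤ E + a := by
    have := dist_triangle q x p; rwa [dist_comm x p] at this
  have hsh : 0 < Real.sinh a := Real.sinh_pos_iff.2 ha
  -- coordinates of the comparison point of `q`
  set β : ℝ := (Real.cosh E - Real.exp (-a) * Real.cosh D) / Real.sinh a with hβ
  set α : ℝ := 2 * Real.cosh D - β with hα
  have e1 : Real.sinh a * β = Real.cosh E - Real.exp (-a) * Real.cosh D := by
    rw [hβ]; field_simp
  have hcosh_low : Real.cosh (a - D) ≤ Real.cosh E := by
    rw [Real.cosh_le_cosh, abs_of_nonneg hE0, abs_le]; constructor <;> linarith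
  have hcosh_up : Real.cosh E ≤ Real.cosh (a + D) := by
    rw [Real.cosh_le_cosh, abs_of_nonneg hE0, abs_of_nonneg (by positivity)]; linarith
  -- The triangle inequalities place `β` between `e^{-D}` and `e^D`, the roots of `z² - 2z cosh D +
  -- 1`. This is `αβ ≥ 1`, which makes `u` below a real coordinate.
  have hb1 : Real.exp (-D) ≤ β := by
    have : Real.sinh a * Real.exp (-D) ≤ Real.sinh a * β := by
      rw [e1]
      have : Real.sinh a * Real.exp (-D) = Real.cosh (a - D) - Real.exp (-a) * Real.cosh D := by
        rw [Real.cosh_sub, ← Real.cosh_sub_sinh, ← Real.cosh_sub_sinh]; ring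
      linarith
    exact le_of_mul_le_mul_left this hsh
  have hb2 : β ≤ Real.exp D := by
    have : Real.sinh a * β ≤ Real.sinh a * Real.exp D := by
      rw [e1]
      have : Real.sinh a * Real.exp D = Real.cosh (a + D) - Real.exp (-a) * Real.cosh D := by
        rw [Real.cosh_add, ← Real.cosh_sub_sinh, ← Real.cosh_add_sinh]; ring
      linarith
    exact le_of_mul_le_mul_left this hsh
  have hβ0 : 0 < β := (Real.exp_pos _).trans_le hb1
  have hαβ : 1 ≤ α * β := by
    have h1 : 0 ≤ (β - Real.exp (-D)) * (Real.exp D - β) :=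
      mul_nonneg (by linarith) (by linarith)
    have h2 : Real.exp (-D) * Real.exp D = 1 := by rw [← Real.exp_add]; simp
    rw [hα, Real.cosh_eq]
    nlinarith
  -- The side from `p` to `x` is placed on the imaginary axis at heights `e^r`. The distance from `u
  -- + iw` to such a point has hyperbolic cosine `(α e^{-r} + β e^r)/2`, where `β = 1/w` and `α =
  -- (u² + w²)/w`; these are fitted at `r = 0` and `r = a`.
  set w : ℝ := β⁻¹ with hw
  have hw0 : 0 < w := inv_pos.2 hβ0
  have hwβ : w * β = 1 := inv_mul_cancel₀ hβ0.ne'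
  set u : ℝ := Real.sqrt (α * w - w ^ 2) with hu
  have hu2 : u ^ 2 = α * w - w ^ 2 := by
    rw [hu, Real.sq_sqrt]
    have : w ^ 2 * (α * β - 1) = α * w - w ^ 2 := by
      have : w ^ 2 * (α * β - 1) = α * w * (w * β) - w ^ 2 := by ring
      rw [this, hwβ, mul_one]
    rw [← this]
    exact mul_nonneg (sq_nonneg _) (by linarith)
  let pt : ℝ → UpperHalfPlane := fun r => ⟨⟨0, Real.exp r⟩, Real.exp_pos r⟩
  let q' : UpperHalfPlane := ⟨⟨u, w⟩, hw0⟩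
  have hpt : ∀ r r', dist (pt r) (pt r') = |r - r'| := by
    intro r r'
    rw [UpperHalfPlane.dist_of_re_eq (by rfl)]
    change dist (Real.log (Real.exp r)) (Real.log (Real.exp r')) = _
    rw [Real.log_exp, Real.log_exp, Real.dist_eq]
  have hq : ∀ r, Real.cosh (dist q' (pt r)) = (α * Real.exp (-r) + β * Real.exp r) / 2 := by
    intro r
    rw [UpperHalfPlane.cosh_dist]
    have h1 : dist (q' : ℂ) (pt r : ℂ) ^ 2 = u ^ 2 + (w - Real.exp r) ^ 2 := by
      rw [Complex.dist_eq, Complex.sq_norm, Complex.normSq_apply]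
      change (u - 0) * (u - 0) + (w - Real.exp r) * (w - Real.exp r) = _
      ring
    rw [h1, hu2]
    change 1 + (α * w - w ^ 2 + (w - Real.exp r) ^ 2) / (2 * w * Real.exp r) = _
    have he : Real.exp r ≠ 0 := (Real.exp_pos r).ne'
    rw [Real.exp_neg]
    have : β = w⁻¹ := by rw [hw, inv_inv]
    rw [this]
    field_simp
    ring
  have hqp : dist q' (pt 0) = D := by
    apply eq_of_cosh_eq dist_nonneg hD0
    rw [hq, hα]; simp
  have hqx : dist q' (pt a) = E := by
    apply eq_of_cosh_eq dist_nonneg hE0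
    rw [hq, hα]
    have h2 : Real.exp a = Real.exp (-a) + 2 * Real.sinh a := by rw [Real.sinh_eq]; ring
    rw [h2]
    linear_combination e1
  -- The vertex `q` is used as a point of the side from `p` to `q`.
  have key := hX.comparison p q x q v (by unfold Between; simp) hv (pt 0) q' (pt a) q' (pt s)
    (by rw [dist_comm, hqp, dist_comm]) (by rw [hpt, zero_sub, abs_neg, abs_of_pos ha])
    hqx (by rw [dist_comm, hqp, dist_comm]) (by simp)
    (by rw [hpt, zero_sub, abs_neg, abs_of_nonneg hs0])
    (by rw [hpt, abs_sub_comm, abs_of_nonneg (by linarith), hvx])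
  have h3 : Real.cosh (dist q v) ≤ (α * Real.exp (-s) + β * Real.exp s) / 2 := by
    rw [← hq, Real.cosh_le_cosh, abs_of_nonneg dist_nonneg, abs_of_nonneg dist_nonneg]
    exact key
  calc Real.sinh a * Real.cosh (dist q v)
      ≤ Real.sinh a * ((α * Real.exp (-s) + β * Real.exp s) / 2) := by gcongr
    _ = Real.sinh (dist v x) * Real.cosh D + Real.sinh s * Real.cosh E := by
      have h4 : (α * Real.exp (-s) + β * Real.exp s) / 2
          = Real.exp (-s) * Real.cosh D + β * Real.sinh s := by
        rw [hα, Real.sinh_eq]; ring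
      have h5 : Real.cosh E = Real.sinh a * β + Real.exp (-a) * Real.cosh D := by
        rw [e1]; ring
      rw [h4, h5, hvx, Real.sinh_sub, ← Real.cosh_sub_sinh, ← Real.cosh_sub_sinh]
      ring

/-- Points of a geodesic segment are determined by their distance to an end point. -/
theorem IsCATNegOne.eq_of_between (hX : IsCATNegOne X) {p x v w : X} (hv : Between p v x)
    (hw : Between p w x) (h : dist p v = dist p w) : v = w := by
  unfold Between at hv hw
  rcases eq_or_lt_of_le (dist_nonneg (x := p) (y := x)) with h0 | ha
  · have hv0 : dist p v = 0 := by
      have := dist_nonneg (x := p) (y := v); have := dist_nonneg (x := v) (y := x); linarith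
    have hw0 : dist p w = 0 := by linarith
    rw [← dist_eq_zero.1 hv0, ← dist_eq_zero.1 hw0]
  -- With third vertex `w` the comparison triangle is degenerate: the right side is exactly `sinh
  -- (dist p x)`, so `cosh (dist w v) ≤ 1`.
  have key := hX.sinh_mul_cosh_dist_le w hv
  have h1 : dist v x = dist w x := by linarith
  rw [h1, dist_comm w p, ← h] at key
  have h2 : Real.sinh (dist w x) * Real.cosh (dist p v) + Real.sinh (dist p v) *
      Real.cosh (dist w x) = Real.sinh (dist p x) := by
    rw [← hw, Real.sinh_add, ← h]; ring
  rw [h2] at key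
  have h3 : Real.cosh (dist w v) ≤ 1 := by
    have := Real.sinh_pos_iff.2 ha
    nlinarith
  have h4 : dist w v = 0 := by
    by_contra hne
    have := Real.one_lt_cosh.2 hne
    linarith
  exact (dist_eq_zero.1 h4).symm

lemma IsGeodesic.exists_between (hX : IsGeodesic X) (x y : X) {s : ℝ} (h0 : 0 ≤ s)
    (h1 : s ≤ dist x y) : ∃ z, Between x z y ∧ dist x z = s := by
  obtain ⟨c, c0, c1, hc⟩ := hX x y
  have hd : (0 : ℝ) ≤ dist x y := dist_nonneg
  have e1 : dist x (c s) = s := by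
    have := hc 0 ⟨le_rfl, hd⟩ s ⟨h0, h1⟩
    rw [c0] at this
    rw [this, zero_sub, abs_neg, abs_of_nonneg h0]
  have e2 : dist (c s) y = dist x y - s := by
    have := hc s ⟨h0, h1⟩ _ ⟨hd, le_rfl⟩
    rw [c1] at this
    rw [this, abs_sub_comm, abs_of_nonneg (by linarith)]
  exact ⟨c s, by unfold Between; rw [e1, e2]; ring, e1⟩

end CAT

end BoundaryRep

namespace BoundaryRep

/-! ### Exponential closeness of horofunctions of points with a large Gromov product -/

section Asymptotic

variable {X : Type*} [MetricSpace X]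

lemma Between.trans_left {p v m x : X} (h : Between p v m) (h' : Between p m x) :
    Between p v x := by
  unfold Between at *
  have := dist_triangle v m x
  have := dist_triangle p v x
  linarith

lemma sinh_le_exp_mul_sinh {s a : ℝ} (h : s ≤ a) :
    Real.sinh s ≤ Real.exp (s - a) * Real.sinh a := by
  have h1 : Real.exp (s - a) * Real.exp a = Real.exp s := by rw [← Real.exp_add]; ring_nf
  have h2 : Real.exp (s - a) * Real.exp (-a) ≤ Real.exp (-s) := by
    rw [← Real.exp_add, Real.exp_le_exp]; linarith
  rw [Real.sinh_eq, Real.sinh_eq]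
  nlinarith

/-- If `v` lies on `[p, m]`, the distance from `y` to `v` is controlled by the distances to the
end points. -/
lemma IsCATNegOne.exp_dist_le (hX : IsCATNegOne X) {p v m : X} (y : X) (hv : Between p v m)
    (hpm : 0 < dist p m) :
    Real.exp (dist y v) ≤ Real.exp (-dist p v) * (2 * Real.cosh (dist y p)) +
      Real.exp (dist p v - dist p m) * (2 * Real.cosh (dist y m)) := by
  have key := hX.sinh_mul_cosh_dist_le y hv
  have hvm : dist v m = dist p m - dist p v := by unfold Between at hv; linarith
  have h1 := sinh_le_exp_mul_sinh (s := dist v m) (a := dist p m)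
    (by have := dist_nonneg (x := p) (y := v); linarith)
  have h2 := sinh_le_exp_mul_sinh (s := dist p v) (a := dist p m)
    (by have := dist_nonneg (x := v) (y := m); linarith)
  have h3 : dist v m - dist p m = -dist p v := by linarith
  rw [h3] at h1
  have hs := Real.sinh_pos_iff.2 hpm
  have c1 := Real.cosh_pos (dist y p)
  have c2 := Real.cosh_pos (dist y m)
  have h4 : Real.sinh (dist p m) * Real.cosh (dist y v) ≤ Real.sinh (dist p m) *
      (Real.exp (-dist p v) * Real.cosh (dist y p) +
        Real.exp (dist p v - dist p m) * Real.cosh (dist y m)) := by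
    calc _ ≤ _ := key
      _ ≤ Real.exp (-dist p v) * Real.sinh (dist p m) * Real.cosh (dist y p) +
        Real.exp (dist p v - dist p m) * Real.sinh (dist p m) * Real.cosh (dist y m) := by gcongr
      _ = _ := by ring
  have h5 := le_of_mul_le_mul_left h4 hs
  have h6 : Real.exp (dist y v) ≤ 2 * Real.cosh (dist y v) := by
    rw [Real.cosh_eq]; have := Real.exp_pos (-dist y v); linarith
  linarith

/-- A geodesic from a far point `v` of `[p, x]` to `q` almost extends `[x, v]`. -/
lemma IsCATNegOne.dist_add_dist_le (hX : IsCATNegOne X) {p v x : X} (q : X)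
    (hv : Between p v x) :
    dist q v + dist v x ≤ dist q x + 3 * Real.exp (2 * dist p q - 2 * dist p v) := by
  rcases eq_or_lt_of_le (dist_nonneg (x := p) (y := x)) with h0 | ha
  · have hvx : dist v x = 0 := by
      unfold Between at hv
      have := dist_nonneg (x := p) (y := v); have := dist_nonneg (x := v) (y := x); linarith
    rw [dist_eq_zero.1 hvx, dist_self]
    have := Real.exp_pos (2 * dist p q - 2 * dist p x)
    linarith
  have key := hX.exp_dist_le q hv ha
  set a := dist p x
  set s := dist p v
  set D := dist p q
  set E := dist q x
  have hvx : dist v x = a - s := by unfold Between at hv; linarith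
  have hsa : s ≤ a := by have := dist_nonneg (x := v) (y := x); linarith
  rw [dist_comm q p] at key
  have haD : a ≤ D + E := dist_triangle p q x
  have hD : (0 : ℝ) ≤ D := dist_nonneg
  -- Both terms of `key` are compared with `e^{s-a+E}`, the value `e^{dist q v}` would have if `v`
  -- lay on a segment from `q` to `x`; the relative error is of order `e^{2D-2s}`.
  have h1 : Real.exp (-s) * (2 * Real.cosh D) ≤
      Real.exp (s - a + E) * (2 * Real.exp (2 * D - 2 * s)) := by
    have : Real.cosh D ≤ Real.exp D := by
      rw [Real.cosh_eq]
      have : Real.exp (-D) ≤ Real.exp D := Real.exp_le_exp.2 (by linarith)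
      linarith
    calc _ ≤ Real.exp (-s) * (2 * Real.exp D) := by gcongr
      _ = 2 * Real.exp (-s + D) := by rw [Real.exp_add]; ring
      _ ≤ 2 * Real.exp (s - a + E + (2 * D - 2 * s)) := by
        have := Real.exp_le_exp.2 (show -s + D ≤ s - a + E + (2 * D - 2 * s) by linarith)
        linarith
      _ = _ := by rw [Real.exp_add]; ring
  have h2 : Real.exp (s - a) * (2 * Real.cosh E) ≤
      Real.exp (s - a + E) * (1 + Real.exp (2 * D - 2 * s)) := by
    rw [Real.cosh_eq, mul_add, mul_one, ← Real.exp_add]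
    have e1 : Real.exp (s - a) * (2 * ((Real.exp E + Real.exp (-E)) / 2)) =
      Real.exp (s - a + E) + Real.exp (s - a + -E) := by rw [Real.exp_add, Real.exp_add]; ring
    rw [e1]
    have := Real.exp_le_exp.2 (show s - a + -E ≤ s - a + E + (2 * D - 2 * s) by
      have := dist_triangle p v q
      have := dist_nonneg (x := q) (y := x)
      linarith)
    linarith
  have h3 : Real.exp (dist q v) ≤
      Real.exp (s - a + E + 3 * Real.exp (2 * D - 2 * s)) := by
    calc _ ≤ Real.exp (s - a + E) * (3 * Real.exp (2 * D - 2 * s) + 1) := by linarith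
      _ ≤ Real.exp (s - a + E) * Real.exp (3 * Real.exp (2 * D - 2 * s)) := by
        gcongr; exact Real.add_one_le_exp _
      _ = _ := by rw [← Real.exp_add]
  have := Real.exp_le_exp.1 h3
  linarith

lemma gromov_comm (r x y : X) : gromov r x y = gromov r y x := by
  unfold gromov; rw [dist_comm x y]; ring

lemma gromov_nonneg (r x y : X) : 0 ≤ gromov r x y := by
  unfold gromov; have := dist_triangle_right x y r; linarith

lemma gromov_le_dist (r x y : X) : gromov r x y ≤ dist r x := by
  unfold gromov
  have := dist_triangle y x r
  rw [dist_comm x y, dist_comm r x]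
  linarith

lemma gromov_of_between {r x y : X} (h : Between r x y) : gromov r x y = dist r x := by
  unfold Between at h; unfold gromov
  rw [dist_comm y r, dist_comm x r]
  linarith

lemma abs_gromov_sub_le (r x y z : X) : |gromov r x y - gromov r x z| ≤ dist y z := by
  unfold gromov
  rw [abs_le]
  have := dist_triangle y z r; have := dist_triangle_left z r y
  have := dist_triangle x y z; have := dist_triangle_right x y z
  rw [dist_comm z r, dist_comm y r] at *
  constructor <;> linarith

/-- Points with a large Gromov product have almost equal horofunctions. -/
theorem IsCATNegOne.horofunction_sub_le (hX : IsCATNegOne X) {δ : ℝ} (hδ : 0 ≤ δ)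
    (hyp : IsHyperbolic X δ) {p q x y : X} {T : ℝ} (hT : 0 < T) (hxy : T ≤ gromov p x y) :
    (dist y q - dist y p) - (dist x q - dist x p) ≤
      3 * Real.exp (4 * δ - T) + 3 * Real.exp (2 * dist p q - T) := by
  have hTx : T ≤ dist p x := hxy.trans (gromov_le_dist p x y)
  -- The segments from `p` to `x` and to `y` stay close up to `m`. Taking `v` halfway to `m` makes
  -- two errors of order `e^{-T}`: the one by which the route from `q` to `x` misses `v`, and the
  -- one by which the route from `y` to `p` does.
  obtain ⟨m, hm, hpm⟩ := hX.geodesic.exists_between p x hT.le hTx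
  obtain ⟨v, hv, hpv⟩ := hX.geodesic.exists_between p m (s := T / 2) (by linarith) (by linarith)
  have hvx := hv.trans_left hm
  have h1 := hX.dist_add_dist_le q hvx
  -- the point `m` almost lies on `[p, y]`
  have hmy : dist y m ≤ dist y p - T + 2 * δ := by
    have h2 := hyp m y p x
    rw [gromov_of_between hm, hpm, gromov_comm p y x, min_eq_left hxy] at h2
    unfold gromov at h2
    rw [dist_comm m p, hpm, dist_comm m y] at h2
    linarith
  have key := hX.exp_dist_le y hv (by rw [hpm]; exact hT)
  rw [hpm, hpv] at key
  have htri : T ≤ dist y p + dist y m := by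
    rw [← hpm]; exact dist_triangle_left p m y
  have hb : T - 2 * δ ≤ dist y p := by have := dist_nonneg (x := y) (y := m); linarith
  set b := dist y p
  have h3 : Real.exp (-(T / 2)) * (2 * Real.cosh b) ≤
      Real.exp (b - T / 2) * (1 + Real.exp (4 * δ - T)) := by
    have e1 : Real.exp (-(T / 2)) * (2 * Real.cosh b) =
        Real.exp (b - T / 2) + Real.exp (-b - T / 2) := by
      rw [Real.cosh_eq, sub_eq_add_neg, sub_eq_add_neg, Real.exp_add, Real.exp_add]; ring
    rw [e1, mul_add, mul_one, ← Real.exp_add]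
    gcongr
    linarith
  have h4 : Real.exp (T / 2 - T) * (2 * Real.cosh (dist y m)) ≤
      Real.exp (b - T / 2) * (2 * Real.exp (4 * δ - T)) := by
    have e1 : Real.exp (T / 2 - T) * (2 * Real.cosh (dist y m)) =
        Real.exp (-(T / 2) + dist y m) + Real.exp (-(T / 2) - dist y m) := by
      rw [Real.cosh_eq, sub_eq_add_neg (-(T / 2)), Real.exp_add, Real.exp_add]; ring_nf
    have e2 : Real.exp (b - T / 2) * (2 * Real.exp (4 * δ - T)) =
        Real.exp (b - T / 2 + (4 * δ - T)) + Real.exp (b - T / 2 + (4 * δ - T)) := by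
      rw [Real.exp_add]; ring
    rw [e1, e2]
    exact add_le_add (Real.exp_le_exp.2 (by linarith)) (Real.exp_le_exp.2 (by linarith))
  have h5 : Real.exp (dist y v) ≤ Real.exp (b - T / 2 + 3 * Real.exp (4 * δ - T)) := by
    calc _ ≤ Real.exp (b - T / 2) * (3 * Real.exp (4 * δ - T) + 1) := by linarith
      _ ≤ Real.exp (b - T / 2) * Real.exp (3 * Real.exp (4 * δ - T)) := by
        gcongr; exact Real.add_one_le_exp _
      _ = _ := by rw [← Real.exp_add]
  have h6 := Real.exp_le_exp.1 h5
  have h7 := dist_triangle y v q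
  rw [dist_comm q v, hpv] at h1
  have h8 : dist v x = dist p x - T / 2 := by unfold Between at hvx; linarith
  rw [h8, dist_comm q x, dist_comm p x] at h1
  have h9 : 2 * dist p q - 2 * (T / 2) = 2 * dist p q - T := by ring
  rw [h9] at h1
  linarith

theorem IsCATNegOne.abs_horofunction_sub_le (hX : IsCATNegOne X) {δ : ℝ} (hδ : 0 ≤ δ)
    (hyp : IsHyperbolic X δ) {p q x y : X} {T : ℝ} (hT : 0 < T) (hxy : T ≤ gromov p x y) :
    |(dist x q - dist x p) - (dist y q - dist y p)| ≤
      3 * Real.exp (4 * δ - T) + 3 * Real.exp (2 * dist p q - T) := by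
  rw [abs_le]
  constructor
  · have := hX.horofunction_sub_le hδ hyp (q := q) hT hxy
    linarith
  · exact hX.horofunction_sub_le hδ hyp hT (by rwa [gromov_comm])

end Asymptotic

/-! ### Extension of geodesics and orbit points in open annuli -/

section Extension

variable {X : Type*} [MetricSpace X]

/-- Small geodesic segments ending at a point can almost be continued beyond it. -/
def HasOppositePoints (X : Type*) [MetricSpace X] : Prop :=
  ∀ (w : X) (ε : ℝ), 0 < ε → ∀ᶠ r in 𝓝[>] (0 : ℝ), ∀ m : X, dist m w = r →
    ∃ v : X, r / 2 ≤ dist v w ∧ dist v w ≤ 2 * r ∧ r + dist v w - ε * r ≤ dist v m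

/-- Points have arbitrarily small connected punctured neighbourhoods. -/
def HasConnectedPuncturedNhds (X : Type*) [TopologicalSpace X] : Prop :=
  ∀ (y : X), ∀ U ∈ 𝓝 y, ∃ P ⊆ U, IsPreconnected P ∧ P ∈ 𝓝[≠] y ∧ y ∉ P

/-- Stewart's inequality for the segment from `p` to `w`, divided by `sinh (dist p w)`. The right
side reaches `cosh (dist m w + dist v w)` only when the route from `p` through `w` to `v` is
geodesic, so a `v` almost opposite to `m` makes that route almost geodesic. -/
lemma IsCATNegOne.cosh_dist_le_of_between (hX : IsCATNegOne X) {p m w : X} (v : X)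
    (hm : Between p m w) (hpw : 0 < dist p w) :
    Real.cosh (dist v m) ≤ Real.sinh (dist m w) * Real.sinh (dist v p - dist p w) +
      Real.cosh (dist m w) * Real.cosh (dist v w) := by
  have key := hX.sinh_mul_cosh_dist_le v hm
  set t := dist p w
  set r := dist m w
  obtain ⟨u, hu⟩ : ∃ u, u = dist v p - t := ⟨_, rfl⟩
  rw [← hu]
  have hpm : dist p m = t - r := by unfold Between at hm; linarith
  have hvp : dist v p = t + u := by rw [hu]; ring
  have hcu : Real.cosh u ≤ Real.cosh (dist v w) := by
    rw [Real.cosh_le_cosh, abs_of_nonneg dist_nonneg, abs_le]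
    have h1 := dist_triangle v w p
    have h2 := dist_triangle_left p w v
    rw [dist_comm w p] at h1
    constructor <;> linarith
  rw [hvp, hpm, Real.cosh_add, Real.sinh_sub] at key
  have hr : 0 ≤ Real.sinh r := Real.sinh_nonneg_iff.2 dist_nonneg
  have hs := Real.sinh_pos_iff.2 hpw
  have h3 : Real.sinh r * Real.cosh t * Real.cosh u ≤
      Real.sinh r * Real.cosh t * Real.cosh (dist v w) :=
    mul_le_mul_of_nonneg_left hcu (mul_nonneg hr (Real.cosh_pos _).le)
  refine le_of_mul_le_mul_left ?_ hs
  nlinarith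

lemma cosh_add_le_cosh_add (b e : ℝ) : Real.cosh b + (e - b) * Real.sinh b ≤ Real.cosh e := by
  have h1 : Real.exp b * ((e - b) + 1) ≤ Real.exp e := by
    calc _ ≤ Real.exp b * Real.exp (e - b) := by gcongr; exact Real.add_one_le_exp _
      _ = _ := by rw [← Real.exp_add]; ring_nf
  have h2 : Real.exp (-b) * (-(e - b) + 1) ≤ Real.exp (-e) := by
    calc _ ≤ Real.exp (-b) * Real.exp (-(e - b)) := by gcongr; exact Real.add_one_le_exp _
      _ = _ := by rw [← Real.exp_add]; ring_nf
  rw [Real.cosh_eq, Real.cosh_eq, Real.sinh_eq]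
  nlinarith

lemma sinh_le_two_mul {x : ℝ} (h0 : 0 ≤ x) (h1 : x ≤ 1) : Real.sinh x ≤ 2 * x := by
  have h2 := Real.abs_exp_sub_one_sub_id_le (x := x) (by rw [abs_of_nonneg h0]; exact h1)
  have h3 := Real.add_one_le_exp (-x)
  rw [abs_le] at h2
  rw [Real.sinh_eq]
  nlinarith

lemma sub_le_sinh_sub {u ρ : ℝ} (h : u ≤ ρ) : ρ - u ≤ Real.sinh ρ - Real.sinh u := by
  have h1 := Real.sinh_sub_id_strictMono.monotone h
  linarith

/-- The distance to `p` grows with slope almost one in some direction. -/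
theorem IsCATNegOne.exists_dist_ge (hX : IsCATNegOne X) (hopp : HasOppositePoints X) {p w : X}
    (hpw : p ≠ w) {ε ρ : ℝ} (hε : 0 < ε) (hρ : 0 < ρ) :
    ∃ v, 0 < dist v w ∧ dist v w < ρ ∧ dist w p + (1 - ε) * dist v w ≤ dist v p := by
  have ht : 0 < dist p w := dist_pos.2 hpw
  have hsm : ∀ c : ℝ, 0 < c → ∀ᶠ r in 𝓝[>] (0 : ℝ), r < c := fun c hc =>
    eventually_nhdsWithin_of_eventually_nhds (eventually_lt_nhds hc)
  -- The bound `r < 1/3` gives `r + d ≤ 3r ≤ 1`, where `sinh` is at most twice its argument. As `r ≤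
  -- 2d`, the defect `(ε/12) r` can be absorbed into `ε d`.
  obtain ⟨r, hr, hr1, hr2, hr3, hr0⟩ := ((hopp w (ε / 12) (by positivity)).and
    ((hsm (ρ / 2) (by positivity)).and ((hsm (1 / 3) (by norm_num)).and
      ((hsm _ ht).and self_mem_nhdsWithin)))).exists
  have hr0 : 0 < r := hr0
  obtain ⟨m, hm, hpm⟩ := hX.geodesic.exists_between p w (s := dist p w - r)
    (by linarith) (by linarith)
  have hmw : dist m w = r := by unfold Between at hm; linarith
  obtain ⟨v, hv1, hv2, hv3⟩ := hr m hmw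
  refine ⟨v, by linarith, by linarith, ?_⟩
  have key := hX.cosh_dist_le_of_between v hm ht
  rw [hmw] at key
  set d := dist v w
  set u := dist v p - dist p w with hu
  have h1 := cosh_add_le_cosh_add (r + d) (dist v m)
  have hud : u ≤ d := by
    have := dist_triangle v w p; rw [dist_comm w p] at this; linarith
  have h2 := sub_le_sinh_sub hud
  have h3 := sinh_le_two_mul (x := r + d) (by linarith) (by linarith)
  have h4 : r ≤ Real.sinh r := Real.self_le_sinh_iff.2 hr0.le
  have h5 : 0 ≤ Real.sinh (r + d) := Real.sinh_nonneg_iff.2 (by linarith)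
  have h6 : (r + d - dist v m) * Real.sinh (r + d) ≤ (ε / 12 * r) * (2 * (r + d)) := by
    apply mul_le_mul (by linarith) h3 h5 (by positivity)
  have h7 : Real.sinh r * (Real.sinh d - Real.sinh u) ≤ (ε / 12 * r) * (2 * (r + d)) := by
    rw [Real.cosh_add] at h1
    nlinarith
  have h8 : r * (d - u) ≤ r * (ε * d) := by
    calc r * (d - u) ≤ Real.sinh r * (Real.sinh d - Real.sinh u) :=
          mul_le_mul h4 h2 (by linarith) (by linarith)
      _ ≤ _ := h7
      _ ≤ (ε / 12 * r) * (2 * (2 * d + d)) := by gcongr; linarith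
      _ ≤ _ := by nlinarith [mul_pos hε hr0, mul_nonneg (mul_pos hε hr0).le (by linarith : 0 ≤ d)]
  have h9 := le_of_mul_le_mul_left h8 hr0
  rw [dist_comm w p]
  linarith

/-- Geodesics can be extended. -/
theorem IsCATNegOne.exists_extension [ProperSpace X] (hX : IsCATNegOne X)
    (hopp : HasOppositePoints X) {p w : X} (hpw : p ≠ w) {s : ℝ} (hs : 0 < s) :
    ∃ v, dist v w = s ∧ dist v p = dist w p + s := by
  have step : ∀ ε : ℝ, 0 < ε → ε < 1 → ∃ v, dist v w = s ∧ dist w p + (1 - ε) * s ≤ dist v p := by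
    intro ε hε hε1
    -- `K` collects the points of the ball at which the distance to `p` has grown with mean slope at
    -- least `1 - ε`. One farthest from `p` lies on the sphere, since otherwise `exists_dist_ge`
    -- would lead farther inside `K`.
    set K : Set X := Metric.closedBall w s ∩ {v | dist w p + (1 - ε) * dist v w ≤ dist v p}
    have hK : IsCompact K := (isCompact_closedBall w s).inter_right
      (isClosed_le (by fun_prop) (by fun_prop))
    have hne : K.Nonempty := ⟨w, by simp [hs.le], by simp⟩
    obtain ⟨v, hvK, hmax⟩ := hK.exists_isMaxOn hne
      (f := fun v => dist v p) (by fun_prop : Continuous fun v => dist v p).continuousOn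
    have hvs : dist v w ≤ s := hvK.1
    have hv2 : dist w p + (1 - ε) * dist v w ≤ dist v p := hvK.2
    rcases eq_or_lt_of_le hvs with h | h
    · exact ⟨v, h, h ▸ hv2⟩
    exfalso
    have hpv : p ≠ v := by
      rintro rfl
      rw [dist_self] at hv2
      have h1 : 0 < dist w p := dist_pos.2 hpw.symm
      have h2 : 0 ≤ (1 - ε) * dist p w := mul_nonneg (by linarith) dist_nonneg
      linarith
    obtain ⟨v', h1, h2, h3⟩ := hX.exists_dist_ge hopp hpv hε (ρ := s - dist v w) (by linarith)
    have htri := dist_triangle v' v w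
    have hmem : v' ∈ K := by
      refine ⟨by rw [Metric.mem_closedBall]; linarith, ?_⟩
      change dist w p + (1 - ε) * dist v' w ≤ dist v' p
      have : (1 - ε) * dist v' w ≤ (1 - ε) * (dist v' v + dist v w) :=
        mul_le_mul_of_nonneg_left htri (by linarith)
      linarith
    have h4 : dist v' p ≤ dist v p := hmax hmem
    have h5 : 0 < (1 - ε) * dist v' v := mul_pos (by linarith) h1
    linarith
  -- A point of the sphere farthest from `p` does at least as well as every approximate solution, so
  -- `ε` may tend to `0`.
  have hS : IsCompact (Metric.sphere w s) := isCompact_sphere w s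
  obtain ⟨v0, hv0, -⟩ := step (1 / 2) (by norm_num) (by norm_num)
  obtain ⟨v, hv, hmax⟩ := hS.exists_isMaxOn ⟨v0, hv0⟩
      (f := fun v => dist v p) (by fun_prop : Continuous fun v => dist v p).continuousOn
  have hv : dist v w = s := hv
  refine ⟨v, hv, le_antisymm ?_ ?_⟩
  · have := dist_triangle v w p; linarith
  · refine le_of_forall_pos_lt_add fun η hη => ?_
    obtain ⟨v', h1, h2⟩ := step (min (1 / 2) (η / (2 * s))) (by positivity)
      ((min_le_left _ _).trans_lt (by norm_num))
    have h3 : dist v' p ≤ dist v p := hmax h1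
    have h4 : min (1 / 2) (η / (2 * s)) * s ≤ η / (2 * s) * s := by gcongr; exact min_le_right _ _
    have h5 : η / (2 * s) * s = η / 2 := by field_simp
    linarith

/-- Metric spheres have no isolated points. -/
theorem IsCATNegOne.exists_ne_dist_eq [ProperSpace X] (hX : IsCATNegOne X)
    (hopp : HasOppositePoints X) (hcon : HasConnectedPuncturedNhds X) {p y : X} (hpy : p ≠ y)
    {ρ : ℝ} (hρ : 0 < ρ) : ∃ y', y' ≠ y ∧ dist y' y < ρ ∧ dist y' p = dist y p := by
  obtain ⟨P, hPU, hP, hPn, hyP⟩ := hcon y _ (Metric.ball_mem_nhds y hρ)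
  obtain ⟨κ, hκ, hball⟩ := Metric.mem_nhdsWithin_iff.1 hPn
  have hpos : 0 < dist p y := dist_pos.2 hpy
  set s := min (κ / 2) (dist p y / 2)
  have hs : 0 < s := by positivity
  have hsκ : s < κ := (min_le_left _ _).trans_lt (by linarith)
  have hsy : s < dist p y := (min_le_right _ _).trans_lt (by linarith)
  obtain ⟨v, hv1, hv2⟩ := hX.exists_extension hopp hpy hs
  obtain ⟨m, hm, hpm⟩ := hX.geodesic.exists_between p y (s := dist p y - s) (by linarith)
    (by linarith)
  have hmy : dist m y = s := by unfold Between at hm; linarith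
  have hvP : v ∈ P := hball ⟨by rw [Metric.mem_ball, hv1]; exact hsκ, by
    rw [Set.mem_compl_singleton_iff, ← dist_pos, hv1]; exact hs⟩
  have hmP : m ∈ P := hball ⟨by rw [Metric.mem_ball, hmy]; exact hsκ, by
    rw [Set.mem_compl_singleton_iff, ← dist_pos, hmy]; exact hs⟩
  -- `P` avoids `y` but contains `m`, nearer to `p`, and `v`, farther from `p`; by connectedness it
  -- contains a point at the distance of `y`.
  obtain ⟨y', hy', he⟩ := hP.intermediate_value hmP hvP (f := fun z => dist z p)
    (by fun_prop : Continuous fun z => dist z p).continuousOn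
    (show dist y p ∈ _ from ⟨by rw [dist_comm m p, hpm, dist_comm y p]; linarith,
      by rw [hv2]; linarith⟩)
  exact ⟨y', fun h => hyP (h ▸ hy'), hPU hy', he⟩

/-- If a locally finite set `Z` is `R`-dense, then near each point `x ≠ p` there is a point of `Z`
whose distance to `p` differs by strictly less than `R` from that of `x`. -/
theorem IsCATNegOne.exists_mem_abs_dist_sub_lt [ProperSpace X] (hX : IsCATNegOne X)
    (hopp : HasOppositePoints X) (hcon : HasConnectedPuncturedNhds X) {Z : Set X} {R : ℝ}
    (hdense : ∀ x, ∃ z ∈ Z, dist x z ≤ R) (hfin : ∀ x r, (Z ∩ Metric.closedBall x r).Finite)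
    {p x : X} (hpx : p ≠ x) :
    ∃ z ∈ Z, |dist z p - dist x p| < R ∧ dist x z ≤ R + 1 := by
  -- Otherwise every `w` near `x` on the sphere through `x` lies on a geodesic from `p` to one of
  -- finitely many points of `Z`. Such a point determines `w` by uniqueness of geodesics, so the
  -- sphere would be finite near `x`, contradicting `exists_ne_dist_eq`.
  by_contra! hbad
  set t := dist x p with ht
  set F := Z ∩ Metric.closedBall x (R + 1)
  have hF : F.Finite := hfin _ _
  set U := {w | dist w p = t ∧ dist w x < 1 / 2}
  have hUfin : U.Finite := by
    have hsub : U ⊆ ⋃ z ∈ F, {w | Between p w z ∧ dist p w = t} := by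
      rintro w ⟨hw1, hw2⟩
      have hpw : p ≠ w := by
        rintro rfl
        rw [dist_self] at hw1
        exact (dist_pos.2 hpx.symm).ne hw1
      -- By finiteness of `F`, a small `s` lets `dist w z ≤ R + s` imply `dist w z ≤ R`.
      have hev : ∀ᶠ s in 𝓝[>] (0 : ℝ), ∀ z ∈ F, R < dist w z → R + s < dist w z := by
        rw [eventually_all_finite hF]
        intro z _
        by_cases h : R < dist w z
        · filter_upwards [eventually_nhdsWithin_of_eventually_nhds
            (eventually_lt_nhds (sub_pos.2 h))] with s hs _
          linarith
        · exact Eventually.of_forall fun s h' => absurd h' h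
      obtain ⟨s, hs1, hs2, hs0⟩ := (hev.and ((eventually_nhdsWithin_of_eventually_nhds
        (eventually_lt_nhds (by norm_num : (0 : ℝ) < 1 / 2))).and self_mem_nhdsWithin)).exists
      have hs0 : 0 < s := hs0
      obtain ⟨v, hv1, hv2⟩ := hX.exists_extension hopp hpw hs0
      obtain ⟨z, hz, hvz⟩ := hdense v
      have hwz : dist w z ≤ R + s := by
        have := dist_triangle w v z; rw [dist_comm w v] at this; linarith
      have hxz : dist x z ≤ R + 1 := by
        have := dist_triangle x w z; rw [dist_comm x w] at this; linarith
      have hzF : z ∈ F := ⟨hz, by rw [Metric.mem_closedBall, dist_comm]; exact hxz⟩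
      have hwzR : dist w z ≤ R := by
        by_contra! h
        exact (hs1 z hzF h).not_ge hwz
      have hge : R ≤ |dist z p - t| := by
        by_contra! h
        exact (hbad z hz h).not_ge hxz
      have h1 : dist v p ≤ dist v z + dist z p := dist_triangle v z p
      have h2 : dist p z ≤ dist p w + dist w z := dist_triangle p w z
      rw [dist_comm p z, dist_comm p w] at h2
      -- The point `v` lies at distance `t + s` from `p` and within `R` of `z`, which excludes `dist
      -- z p ≤ t - R`. So `z` is at least `R` farther from `p` than `w`, while `dist w z ≤ R`: this
      -- puts `w` between `p` and `z`.
      have h3 : R ≤ dist z p - t := by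
        rcases le_abs.1 hge with h | h
        · exact h
        · linarith
      simp only [Set.mem_iUnion]
      refine ⟨z, hzF, ?_, by rw [dist_comm, hw1]⟩
      unfold Between
      rw [dist_comm p w, dist_comm p z]
      linarith
    refine (hF.biUnion fun z _ => Set.Subsingleton.finite ?_).subset hsub
    rintro w ⟨hw, hw'⟩ w2 ⟨hw2, hw2'⟩
    exact hX.eq_of_between hw hw2 (hw'.trans hw2'.symm)
  have hev : ∀ᶠ s in 𝓝[>] (0 : ℝ), ∀ w ∈ U, w ≠ x → s < dist w x := by
    rw [eventually_all_finite hUfin]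
    intro w _
    by_cases h : w = x
    · exact Eventually.of_forall fun s h' => absurd h h'
    · filter_upwards [eventually_nhdsWithin_of_eventually_nhds
        (eventually_lt_nhds (dist_pos.2 h))] with s hs _ using hs
  obtain ⟨s, hs1, hs2, hs0⟩ := (hev.and ((eventually_nhdsWithin_of_eventually_nhds
    (eventually_lt_nhds (by norm_num : (0 : ℝ) < 1 / 2))).and self_mem_nhdsWithin)).exists
  obtain ⟨y, hy1, hy2, hy3⟩ := hX.exists_ne_dist_eq hopp hcon hpx (ρ := s) hs0
  exact (hs1 y ⟨hy3, hy2.trans hs2⟩ hy1).not_gt hy2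

end Extension

end BoundaryRep

namespace BoundaryRep

noncomputable section

/-! ### Functions modulo constants -/

section FunModConst

variable {X : Type*} [TopologicalSpace X]

/-- The representative of a function modulo constants that vanishes at `p`. -/
def normalize (p : X) : FunModConst X →L[ℂ] C(X, ℂ) :=
  Submodule.liftQL _
    { toFun := fun f => f - algebraMap ℂ C(X, ℂ) (f p)
      map_add' := fun f g => by ext; simp; ring
      map_smul' := fun c f => by ext; simp; ring
      cont := by
        have h : Continuous (algebraMap ℂ C(X, ℂ)) := continuous_algebraMap ℂ C(X, ℂ)
        exact continuous_id.sub (h.comp (continuous_eval_const p)) }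
    (by rintro _ ⟨c, rfl⟩; rw [LinearMap.mem_ker]; ext; simp)

lemma normalize_mk (p : X) (f : C(X, ℂ)) (q : X) :
    normalize p (Submodule.Quotient.mk f) q = f q - f p := rfl

lemma normalize_injective (p : X) : Function.Injective (normalize p) := by
  refine (injective_iff_map_eq_zero (normalize p)).2 fun ξ h => ?_
  obtain ⟨f, rfl⟩ := Submodule.Quotient.mk_surjective _ ξ
  rw [Submodule.Quotient.mk_eq_zero]
  refine ⟨f p, ?_⟩
  ext q
  have h1 := DFunLike.congr_fun h q
  rw [normalize_mk, ContinuousMap.zero_apply] at h1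
  simp [sub_eq_zero.1 h1]

instance [Nonempty X] : T2Space (FunModConst X) :=
  T2Space.of_injective_continuous (normalize_injective (Classical.arbitrary X))
    (normalize _).continuous

/-- The action of homeomorphisms on functions modulo constants. -/
def pushFun (γ : X ≃ₜ X) : FunModConst X →L[ℂ] FunModConst X :=
  Submodule.liftQL _
    (Submodule.mkQL _ ∘L
      { toFun := fun f => f.comp (γ.symm : C(X, X))
        map_add' := fun f g => rfl
        map_smul' := fun c f => rfl
        cont := ContinuousMap.continuous_precomp _ })
    (by
      rintro _ ⟨c, rfl⟩
      rw [LinearMap.mem_ker]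
      refine (Submodule.Quotient.mk_eq_zero _).2 ⟨c, ?_⟩
      ext; simp)

lemma pushFun_mk (γ : X ≃ₜ X) (f : C(X, ℂ)) :
    pushFun γ (Submodule.Quotient.mk f) =
      Submodule.Quotient.mk (f.comp (γ.symm : C(X, X))) := rfl

lemma pushFun_symm_apply (γ : X ≃ₜ X) (ξ : FunModConst X) : pushFun γ.symm (pushFun γ ξ) = ξ := by
  obtain ⟨f, rfl⟩ := Submodule.Quotient.mk_surjective _ ξ
  rw [pushFun_mk, pushFun_mk]
  congr 1
  ext x
  simp

end FunModConst

/-! ### Horofunctions and convergence to the boundary -/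

section Horofunctions

variable {X : Type*} [MetricSpace X]

lemma normalize_horoMap (p x q : X) :
    normalize p (horoMap x) q = ((dist x q - dist x p : ℝ) : ℂ) := by
  rw [horoMap, normalize_mk]; simp

lemma continuous_horoMap : Continuous (horoMap (X := X)) := by
  let F : C(X, C(X, ℂ)) :=
    ContinuousMap.curry ⟨fun z : X × X => (dist z.1 z.2 : ℂ), by fun_prop⟩
  have : Continuous fun x : X =>
      (Submodule.mkQL (LinearMap.range (Algebra.linearMap ℂ C(X, ℂ)))) (F x) :=
    (ContinuousLinearMap.continuous _).comp F.continuous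
  exact this

lemma pushFun_horoMap {γ : X ≃ₜ X} (hγ : Isometry γ) (x : X) :
    pushFun γ (horoMap x) = horoMap (γ x) := by
  rw [horoMap, horoMap, pushFun_mk]
  congr 1
  ext y
  simp only [ContinuousMap.comp_apply, ContinuousMap.coe_mk]
  congr 1
  rw [← hγ.dist_eq, γ.apply_symm_apply]

/-- The filter of points of `X` converging to `ξ`. -/
def nhdsHoro (ξ : FunModConst X) : Filter X := comap horoMap (𝓝 ξ)

lemma nhdsHoro_neBot_of_mem_closure {ξ : FunModConst X}
    (h : ξ ∈ closure (Set.range (horoMap (X := X)))) : (nhdsHoro ξ).NeBot := by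
  rw [nhdsHoro, comap_neBot_iff_frequently]
  exact mem_closure_iff_frequently.1 h

instance nhdsHoro_neBot (b : Boundary X) : (nhdsHoro b.1).NeBot :=
  nhdsHoro_neBot_of_mem_closure b.2.1

/-- The horofunction of `ξ` normalized to vanish at `p`. -/
def horo (p : X) (ξ : FunModConst X) (q : X) : ℝ := (normalize p ξ q).re

lemma horo_horoMap (p x q : X) : horo p (horoMap x) q = dist x q - dist x p := by
  rw [horo, normalize_horoMap, Complex.ofReal_re]

lemma continuous_horo (p q : X) : Continuous fun ξ : FunModConst X => horo p ξ q :=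
  Complex.continuous_re.comp
    ((continuous_eval_const q).comp (normalize p).continuous)

lemma tendsto_nhdsHoro (p q : X) (ξ : FunModConst X) :
    Tendsto (fun x => dist x q - dist x p) (nhdsHoro ξ) (𝓝 (horo p ξ q)) := by
  have h := ((continuous_horo p q).tendsto ξ).comp (tendsto_comap (f := horoMap))
  simp only [Function.comp_def, horo_horoMap] at h
  exact h

lemma eventually_nhdsHoro (p : X) (ξ : FunModConst X) {K : Set X} (hK : IsCompact K) {ε : ℝ}
    (hε : 0 < ε) : ∀ᶠ x in nhdsHoro ξ, ∀ q ∈ K, |horo p ξ q - (dist x q - dist x p)| < ε := by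
  have h := (ContinuousMap.tendsto_iff_forall_isCompact_tendstoUniformlyOn.1
    (((normalize p).continuous.tendsto ξ).comp (tendsto_comap (f := horoMap)))) K hK
  rw [Metric.tendstoUniformlyOn_iff] at h
  filter_upwards [h ε hε] with x hx q hq
  refine lt_of_le_of_lt ?_ (hx q hq)
  rw [Function.comp_apply, normalize_horoMap, Complex.dist_eq]
  refine le_trans ?_ (Complex.abs_re_le_norm _)
  rw [Complex.sub_re, Complex.ofReal_re, horo]

/-- The representatives are complex-valued, but as limits of real functions they have zero imaginary
part, so `horo` loses nothing. -/
lemma Boundary.ext_horo (p : X) {b c : Boundary X} (h : ∀ q, horo p b.1 q = horo p c.1 q) :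
    b = c := by
  have him : ∀ (d : Boundary X) (q : X), (normalize p d.1 q).im = 0 := by
    intro d q
    have h1 : Tendsto (fun x => (normalize p (horoMap x) q).im) (nhdsHoro d.1)
        (𝓝 (normalize p d.1 q).im) :=
      ((Complex.continuous_im.comp ((continuous_eval_const q).comp
        (normalize p).continuous)).tendsto d.1).comp (tendsto_comap (f := horoMap))
    have h2 : (fun x => (normalize p (horoMap x) q).im) = fun _ => 0 := by
      funext x; rw [normalize_horoMap, Complex.ofReal_im]
    rw [h2] at h1
    exact tendsto_nhds_unique h1 tendsto_const_nhds
  apply Subtype.ext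
  apply normalize_injective p
  ext q
  exact Complex.ext (h q) ((him b q).trans (him c q).symm)

/-- Points converging to the boundary leave every ball. -/
lemma Boundary.eventually_lt_dist [ProperSpace X] (p : X) (b : Boundary X) (r : ℝ) :
    ∀ᶠ x in nhdsHoro b.1, r < dist x p := by
  have : Nonempty X := ⟨p⟩
  have hc : IsClosed (horoMap '' Metric.closedBall p r) :=
    ((isCompact_closedBall p r).image continuous_horoMap).isClosed
  have hb : b.1 ∉ horoMap '' Metric.closedBall p r := by
    rintro ⟨x, -, hx⟩
    exact b.2.2 ⟨x, hx⟩
  filter_upwards [preimage_mem_comap (hc.isOpen_compl.mem_nhds hb)] with x hx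
  by_contra! h
  exact hx ⟨x, h, rfl⟩

/-- Points of `X` are recovered from their horofunctions. If `x` is at least `ε` from `q`, the point
at distance `ε` on the way from `q` to `x` has horofunction value `-ε` for `x` but `ε` for `q`. -/
lemma nhdsHoro_horoMap_le [ProperSpace X] (hX : IsGeodesic X) (q : X) :
    nhdsHoro (horoMap q) ≤ 𝓝 q := by
  rw [Metric.nhds_basis_ball.ge_iff]
  intro ε hε
  filter_upwards [eventually_nhdsHoro q (horoMap q) (isCompact_closedBall q ε) hε] with x hx
  by_contra! h
  rw [Metric.mem_ball, not_lt] at h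
  obtain ⟨y, hy, hqy⟩ := hX.exists_between q x hε.le (by rwa [dist_comm])
  have h1 := hx y (by rw [Metric.mem_closedBall, dist_comm, hqy])
  rw [horo_horoMap, dist_self, hqy] at h1
  unfold Between at hy
  rw [dist_comm x y, dist_comm x q] at h1
  have h2 := (abs_lt.1 h1).2
  linarith

end Horofunctions

/-! ### The Gromov product with a boundary point and the action of isometries -/

section GromovBoundary

variable {X : Type*} [MetricSpace X]

/-- The Gromov product `(q|b)_p` of a point of `X` and a point of the boundary. -/
def gromovBdry (p q : X) (b : Boundary X) : ℝ := (dist p q - horo p b.1 q) / 2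

lemma tendsto_gromov_nhdsHoro (p q : X) (b : Boundary X) :
    Tendsto (fun x => gromov p q x) (nhdsHoro b.1) (𝓝 (gromovBdry p q b)) := by
  have h := ((tendsto_nhdsHoro p q b.1).const_sub (dist p q)).div_const 2
  refine h.congr fun x => ?_
  unfold gromov
  rw [dist_comm q p, dist_comm q x]; ring

lemma comap_prod_horoMap (ξ ζ : FunModConst X) :
    comap (fun z : X × X => (horoMap z.1, horoMap z.2)) (𝓝 (ξ, ζ)) =
      nhdsHoro ξ ×ˢ nhdsHoro ζ := by
  rw [nhdsHoro, nhdsHoro, prod_comap_comap_eq, nhds_prod_eq]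

lemma nhdsHoro_horoMap_neBot (q : X) : (nhdsHoro (horoMap q)).NeBot :=
  nhdsHoro_neBot_of_mem_closure (subset_closure ⟨q, rfl⟩)

/-- Evaluates the `limUnder` when one argument is a point of `X`, so that the Busemann cocycle
becomes a genuine horofunction. The first variable converges to `q` in `X`, and the product is
1-Lipschitz in it. -/
lemma gromovExt_horoMap [ProperSpace X] (hX : IsGeodesic X) (p q : X) (b : Boundary X) :
    gromovExt p (horoMap q) b.1 = (gromovBdry p q b : EReal) := by
  have := nhdsHoro_horoMap_neBot q
  unfold gromovExt
  rw [comap_prod_horoMap]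
  refine Tendsto.limUnder_eq ?_
  refine (continuous_coe_real_ereal.tendsto _).comp ?_
  have h1 : Tendsto (fun z : X × X => gromov p q z.2)
      (nhdsHoro (horoMap q) ×ˢ nhdsHoro b.1) (𝓝 (gromovBdry p q b)) :=
    (tendsto_gromov_nhdsHoro p q b).comp tendsto_snd
  have h2 : Tendsto (fun z : X × X => dist q z.1)
      (nhdsHoro (horoMap q) ×ˢ nhdsHoro b.1) (𝓝 0) := by
    have : Tendsto (fun x : X => dist q x) (𝓝 q) (𝓝 (dist q q)) :=
      (by fun_prop : Continuous fun x : X => dist q x).tendsto q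
    rw [dist_self] at this
    exact (this.mono_left (nhdsHoro_horoMap_le hX q)).comp tendsto_fst
  rw [← tendsto_sub_nhds_zero_iff] at h1 ⊢
  have h3 : Tendsto (fun z : X × X => dist q z.1 + |gromov p q z.2 - gromovBdry p q b|)
      (nhdsHoro (horoMap q) ×ˢ nhdsHoro b.1) (𝓝 0) := by
    simpa using h2.add h1.abs
  refine squeeze_zero_norm (fun z => ?_) h3
  rw [Real.norm_eq_abs]
  have h4 := abs_gromov_sub_le p z.2 z.1 q
  rw [gromov_comm p z.2 z.1, gromov_comm p z.2 q, dist_comm] at h4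
  calc |gromov p z.1 z.2 - gromovBdry p q b|
      = |(gromov p z.1 z.2 - gromov p q z.2) + (gromov p q z.2 - gromovBdry p q b)| := by ring_nf
    _ ≤ _ := (abs_add_le _ _).trans (by linarith)

lemma busemann_eq [ProperSpace X] (hX : IsGeodesic X) (p q : X) (b : Boundary X) :
    busemann b p q = dist p q - 2 * gromovBdry p q b := by
  rw [busemann, gromovExt_horoMap hX, EReal.toReal_coe]

lemma gromovBdry_nonneg (p q : X) (b : Boundary X) : 0 ≤ gromovBdry p q b :=
  ge_of_tendsto' (tendsto_gromov_nhdsHoro p q b) fun _ => gromov_nonneg _ _ _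

lemma gromovBdry_le_dist (p q : X) (b : Boundary X) : gromovBdry p q b ≤ dist p q :=
  le_of_tendsto' (tendsto_gromov_nhdsHoro p q b) fun _ => gromov_le_dist _ _ _

lemma gromovBdry_le_add_dist (p q q' : X) (b : Boundary X) :
    gromovBdry p q b ≤ gromovBdry p q' b + dist q q' :=
  le_of_tendsto_of_tendsto' (tendsto_gromov_nhdsHoro p q b)
    ((tendsto_gromov_nhdsHoro p q' b).add_const _) fun x => by
      have := (abs_le.1 (abs_gromov_sub_le p x q q')).2
      rw [gromov_comm p q x, gromov_comm p q' x]
      linarith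

lemma IsHyperbolic.min_gromovBdry_le {δ : ℝ} (hyp : IsHyperbolic X δ) (p x q : X)
    (b : Boundary X) : min (gromov p x q) (gromovBdry p q b) - δ ≤ gromovBdry p x b :=
  le_of_tendsto_of_tendsto' ((tendsto_const_nhds.min (tendsto_gromov_nhdsHoro p q b)).sub_const δ)
    (tendsto_gromov_nhdsHoro p x b) fun y => by
      have := hyp x y p q
      rwa [gromov_comm p y q] at this

lemma IsHyperbolic.min_gromovBdry_le_gromov {δ : ℝ} (hyp : IsHyperbolic X δ) (p x q : X)
    (b : Boundary X) : min (gromovBdry p x b) (gromovBdry p q b) - δ ≤ gromov p x q :=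
  le_of_tendsto' (((tendsto_gromov_nhdsHoro p x b).min (tendsto_gromov_nhdsHoro p q b)).sub_const δ)
    fun y => hyp x q p y

/-- The action of isometries on the boundary. -/
def Boundary.map (γ : X ≃ₜ X) (hγ : Isometry γ) (b : Boundary X) : Boundary X :=
  ⟨pushFun γ b.1, by
    refine ⟨?_, ?_⟩
    · refine map_mem_closure (pushFun γ).continuous b.2.1 ?_
      rintro _ ⟨x, rfl⟩
      exact ⟨γ x, (pushFun_horoMap hγ x).symm⟩
    · rintro ⟨x, hx⟩
      apply b.2.2
      refine ⟨γ.symm x, ?_⟩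
      have hs : Isometry γ.symm := (IsometryEquiv.mk γ.toEquiv hγ).symm.isometry
      rw [← pushFun_horoMap hs, hx, pushFun_symm_apply]⟩

lemma tendsto_nhdsHoro_map (γ : X ≃ₜ X) (hγ : Isometry γ) (b : Boundary X) :
    Tendsto γ (nhdsHoro b.1) (nhdsHoro (b.map γ hγ).1) := by
  rw [nhdsHoro, nhdsHoro, tendsto_comap_iff]
  have h : horoMap ∘ γ = pushFun γ ∘ horoMap := by
    funext x; exact (pushFun_horoMap hγ x).symm
  rw [h]
  exact ((pushFun γ).continuous.tendsto b.1).comp tendsto_comap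

lemma Boundary.map_map_symm (γ : X ≃ₜ X) (hγ : Isometry γ) (hγ' : Isometry γ.symm)
    (b : Boundary X) : (b.map γ.symm hγ').map γ hγ = b := by
  apply Subtype.ext
  have := pushFun_symm_apply γ.symm b.1
  exact this

/-- Translates the shadow of `γ p` into a sublevel set: `γ b` lies in it exactly when `(γ⁻¹p|b)_p ≤
K`. -/
lemma gromovBdry_map (p : X) (γ : X ≃ₜ X) (hγ : Isometry γ) (b : Boundary X) :
    gromovBdry p (γ p) (b.map γ hγ) = dist (γ p) p - gromovBdry p (γ.symm p) b := by
  have h1 := (tendsto_gromov_nhdsHoro p (γ p) (b.map γ hγ)).comp (tendsto_nhdsHoro_map γ hγ b)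
  have h2 := (tendsto_gromov_nhdsHoro p (γ.symm p) b).const_sub (dist (γ p) p)
  refine tendsto_nhds_unique h1 (h2.congr fun x => ?_)
  have e1 : dist (γ x) p = dist x (γ.symm p) := by
    rw [← hγ.dist_eq x, γ.apply_symm_apply]
  have e2 : dist (γ p) p = dist p (γ.symm p) := by
    rw [← hγ.dist_eq p, γ.apply_symm_apply]
  simp only [Function.comp_apply, gromov]
  rw [hγ.dist_eq, e1, dist_comm p x, dist_comm (γ.symm p) p, dist_comm (γ.symm p) x, e2]
  ring

end GromovBoundary

end

end BoundaryRep

namespace BoundaryRep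

noncomputable section

/-! ### Extension of the Gromov product and conformality of the Busemann metric -/

section GromovExt

variable {X : Type*} [MetricSpace X]

/-- A geodesic segment `[x, y]` passes near `p` if the Gromov product `(x|y)_p` is small. -/
lemma IsHyperbolic.exists_between_dist_le (hX : IsGeodesic X) {δ : ℝ}
    (hyp : IsHyperbolic X δ) (p x y : X) :
    ∃ m, Between x m y ∧ dist x m = dist x p - gromov p x y ∧
      dist p m ≤ gromov p x y + 2 * δ := by
  have h1 := gromov_le_dist p x y
  have h0 := gromov_nonneg y p x
  obtain ⟨m, hm, hxm⟩ := hX.exists_between x y (s := dist x p - gromov p x y)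
    (by rw [dist_comm x p]; linarith)
    (by unfold gromov at h0 ⊢; rw [dist_comm p y, dist_comm p x] at h0; linarith)
  refine ⟨m, hm, hxm, ?_⟩
  -- The choice of `m` gives `(x|y)_m = 0` and `(x|p)_m = (y|p)_m`, so the four point condition at
  -- `m` bounds `dist p m`.
  have h2 := hyp x y m p
  have hmy : dist m y = dist y p - gromov p x y := by
    unfold Between at hm
    unfold gromov at hxm ⊢
    linarith
  have e0 : gromov m x y = 0 := by
    unfold Between at hm; unfold gromov
    rw [dist_comm y m]; linarith
  have e1 : gromov m x p = (dist p m - gromov p x y) / 2 := by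
    unfold gromov at hxm ⊢; linarith
  have e2 : gromov m y p = (dist p m - gromov p x y) / 2 := by
    rw [dist_comm m y] at hmy
    unfold gromov at hmy ⊢; linarith
  rw [e0, e1, e2, min_self] at h2
  linarith

/-- If `(x|y)_p` does not tend to infinity, then it is determined by the horofunctions of `x` and
`y` on a ball around `p`. -/
lemma IsHyperbolic.gromov_sub_le (hX : IsGeodesic X) {δ : ℝ} (hyp : IsHyperbolic X δ)
    {p x y x' y' : X} {T ε : ℝ} (hT : gromov p x y ≤ T)
    (hx : ∀ m ∈ Metric.closedBall p (T + 2 * δ),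
      |(dist x m - dist x p) - (dist x' m - dist x' p)| ≤ ε)
    (hy : ∀ m ∈ Metric.closedBall p (T + 2 * δ),
      |(dist y m - dist y p) - (dist y' m - dist y' p)| ≤ ε) :
    gromov p x y - ε ≤ gromov p x' y' := by
  -- The sum at `m` of the horofunctions of `x` and `y` equals `-2(x|y)_p` because `m` is on the
  -- segment; for `x'` and `y'` the triangle inequality makes the corresponding sum at least
  -- `-2(x'|y')_p`.
  obtain ⟨m, hm, hxm, hpm⟩ := hyp.exists_between_dist_le hX p x y
  have hmem : m ∈ Metric.closedBall p (T + 2 * δ) := by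
    rw [Metric.mem_closedBall, dist_comm]; linarith
  have h1 := (abs_le.1 (hx m hmem)).1
  have h2 := (abs_le.1 (hy m hmem)).1
  have h3 := dist_triangle_right x' y' m
  unfold Between at hm
  rw [dist_comm m y] at hm
  unfold gromov at *
  linarith

/-- The Gromov product of points converging to distinct boundary points stays bounded. -/
lemma Boundary.eventually_gromov_le (hX : IsCATNegOne X) {δ : ℝ} (hδ : 0 ≤ δ)
    (hyp : IsHyperbolic X δ) (p : X) {b c : Boundary X} (hbc : b ≠ c) :
    ∃ T : ℝ, ∀ᶠ z in nhdsHoro b.1 ×ˢ nhdsHoro c.1, gromov p z.1 z.2 ≤ T := by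
  -- Products that are frequently arbitrarily large force the two horofunctions to agree everywhere.
  by_contra! hcon
  apply hbc
  refine Boundary.ext_horo p fun q => ?_
  have hbound : ∀ T : ℝ, 0 < T → |horo p b.1 q - horo p c.1 q| ≤
      3 * Real.exp (4 * δ - T) + 3 * Real.exp (2 * dist p q - T) := by
    intro T hT
    have ht : Tendsto (fun z : X × X => |(dist z.1 q - dist z.1 p) - (dist z.2 q - dist z.2 p)|)
        (nhdsHoro b.1 ×ˢ nhdsHoro c.1) (𝓝 |horo p b.1 q - horo p c.1 q|) :=
      (((tendsto_nhdsHoro p q b.1).comp tendsto_fst).sub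
        ((tendsto_nhdsHoro p q c.1).comp tendsto_snd)).abs
    refine le_of_tendsto_of_frequently ht ?_
    exact (hcon T).mono fun z hz => hX.abs_horofunction_sub_le hδ hyp hT hz.le
  have hlim : Tendsto (fun T : ℝ => 3 * Real.exp (4 * δ - T) + 3 * Real.exp (2 * dist p q - T))
      atTop (𝓝 0) := by
    have h1 : ∀ c : ℝ, Tendsto (fun T : ℝ => 3 * Real.exp (c - T)) atTop (𝓝 0) := by
      intro c
      have h2 : Tendsto (fun T : ℝ => c - T) atTop atBot :=
        tendsto_atBot_add_const_left _ c tendsto_neg_atTop_atBot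
      simpa using (Real.tendsto_exp_atBot.comp h2).const_mul 3
    simpa using (h1 (4 * δ)).add (h1 (2 * dist p q))
  have h0 : |horo p b.1 q - horo p c.1 q| ≤ 0 :=
    ge_of_tendsto hlim ((eventually_gt_atTop 0).mono hbound)
  exact sub_eq_zero.1 (abs_eq_zero.1 (le_antisymm h0 (abs_nonneg _)))

variable [ProperSpace X]

/-- The Gromov product of two points converging to the same boundary point tends to infinity. -/
lemma Boundary.tendsto_gromov_self (hX : IsGeodesic X) {δ : ℝ} (hyp : IsHyperbolic X δ) (p : X)
    (b : Boundary X) (T : ℝ) :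
    ∀ᶠ z in nhdsHoro b.1 ×ˢ nhdsHoro b.1, T < gromov p z.1 z.2 := by
  have h1 := eventually_nhdsHoro p b.1 (isCompact_closedBall p (T + 2 * δ + 1))
    (show (0 : ℝ) < 1 / 4 by norm_num)
  have h2 := b.eventually_lt_dist p (T + 1)
  filter_upwards [(h1.and h2).prod_mk h1] with z hz
  obtain ⟨⟨hx, hxd⟩, hy⟩ := hz
  by_contra! hle
  obtain ⟨m, hm, hxm, hpm⟩ := hyp.exists_between_dist_le hX p z.1 z.2
  -- Moving from `m` one unit towards `z.1` lowers the distance to `z.1` by `1`. The two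
  -- horofunctions are close on the ball, so the distance to `z.2` decreases too, and the segment
  -- through `m` could be shortened.
  obtain ⟨m', hm', hmm'⟩ := hX.exists_between m z.1 (s := 1) (by norm_num)
    (by rw [dist_comm, hxm]; linarith)
  have b1 : m ∈ Metric.closedBall p (T + 2 * δ + 1) := by
    rw [Metric.mem_closedBall, dist_comm]; linarith
  have b2 : m' ∈ Metric.closedBall p (T + 2 * δ + 1) := by
    rw [Metric.mem_closedBall, dist_comm]
    have := dist_triangle p m m'; linarith
  have i1 := abs_lt.1 (hx m b1)
  have i2 := abs_lt.1 (hx m' b2)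
  have i3 := abs_lt.1 (hy m b1)
  have i4 := abs_lt.1 (hy m' b2)
  unfold Between at hm hm'
  have t1 := dist_triangle z.1 m' z.2
  rw [dist_comm m z.1, dist_comm m' z.1] at hm'
  rw [dist_comm z.2 m, dist_comm z.2 m'] at *
  linarith [i1.1, i1.2, i2.1, i2.2, i3.1, i3.2, i4.1, i4.2]

/-- The Gromov product extends continuously to the boundary. -/
theorem Boundary.exists_tendsto_gromov (hX : IsCATNegOne X) {δ : ℝ} (hδ : 0 ≤ δ)
    (hyp : IsHyperbolic X δ) (p : X) (b c : Boundary X) :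
    ∃ L : EReal, Tendsto (fun z : X × X => ((gromov p z.1 z.2 : ℝ) : EReal))
      (nhdsHoro b.1 ×ˢ nhdsHoro c.1) (𝓝 L) := by
  rcases eq_or_ne b c with rfl | hbc
  · refine ⟨⊤, EReal.tendsto_nhds_top_iff_real.2 fun T => ?_⟩
    filter_upwards [Boundary.tendsto_gromov_self hX.geodesic hyp p b T] with z hz
    exact_mod_cast hz
  obtain ⟨T, hT⟩ := Boundary.eventually_gromov_le hX hδ hyp p hbc
  -- For distinct boundary points the product is bounded near `(b, c)`, hence determined up to `ε/3`
  -- by the horofunctions on one compact ball.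
  have hcauchy : Cauchy (Filter.map (fun z : X × X => gromov p z.1 z.2)
      (nhdsHoro b.1 ×ˢ nhdsHoro c.1)) := by
    rw [Metric.cauchy_iff]
    refine ⟨inferInstance, fun ε hε => ?_⟩
    have hK := isCompact_closedBall p (T + 2 * δ)
    have h1 := eventually_nhdsHoro p b.1 hK (show 0 < ε / 6 by positivity)
    have h2 := eventually_nhdsHoro p c.1 hK (show 0 < ε / 6 by positivity)
    refine ⟨_, image_mem_map (hT.and (h1.prod_mk h2)), ?_⟩
    have key : ∀ z z' : X × X, gromov p z.1 z.2 ≤ T →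
        (∀ q ∈ Metric.closedBall p (T + 2 * δ),
          |horo p b.1 q - (dist z.1 q - dist z.1 p)| < ε / 6) →
        (∀ q ∈ Metric.closedBall p (T + 2 * δ),
          |horo p c.1 q - (dist z.2 q - dist z.2 p)| < ε / 6) →
        (∀ q ∈ Metric.closedBall p (T + 2 * δ),
          |horo p b.1 q - (dist z'.1 q - dist z'.1 p)| < ε / 6) →
        (∀ q ∈ Metric.closedBall p (T + 2 * δ),
          |horo p c.1 q - (dist z'.2 q - dist z'.2 p)| < ε / 6) →
        gromov p z.1 z.2 - ε / 3 ≤ gromov p z'.1 z'.2 := by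
      intro z z' hz a1 a2 a3 a4
      refine hyp.gromov_sub_le hX.geodesic hz (fun m hm => ?_) (fun m hm => ?_)
      · have := abs_lt.1 (a1 m hm); have := abs_lt.1 (a3 m hm)
        rw [abs_le]; constructor <;> linarith
      · have := abs_lt.1 (a2 m hm); have := abs_lt.1 (a4 m hm)
        rw [abs_le]; constructor <;> linarith
    rintro _ ⟨z, ⟨hz, hz1, hz2⟩, rfl⟩ _ ⟨z', ⟨hz', hz1', hz2'⟩, rfl⟩
    have i1 := key z z' hz hz1 hz2 hz1' hz2'
    have i2 := key z' z hz' hz1' hz2' hz1 hz2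
    rw [Real.dist_eq, abs_lt]
    constructor <;> linarith
  obtain ⟨L, hL⟩ := cauchy_iff_exists_le_nhds.1 hcauchy
  exact ⟨L, (continuous_coe_real_ereal.tendsto L).comp hL⟩

theorem Boundary.tendsto_gromovExt (hX : IsCATNegOne X) {δ : ℝ} (hδ : 0 ≤ δ)
    (hyp : IsHyperbolic X δ) (p : X) (b c : Boundary X) :
    Tendsto (fun z : X × X => ((gromov p z.1 z.2 : ℝ) : EReal))
      (nhdsHoro b.1 ×ˢ nhdsHoro c.1) (𝓝 (gromovExt p b.1 c.1)) := by
  unfold gromovExt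
  rw [comap_prod_horoMap]
  exact tendsto_nhds_limUnder (Boundary.exists_tendsto_gromov hX hδ hyp p b c)

/-- Conformality of the Busemann metric under isometries. -/
theorem busemannDist_map (hX : IsCATNegOne X) {δ : ℝ} (hδ : 0 ≤ δ) (hyp : IsHyperbolic X δ)
    (p : X) (γ : X ≃ₜ X) (hγ : Isometry γ) (b c : Boundary X) :
    busemannDist p (b.map γ hγ) (c.map γ hγ) = busemannDist p b c *
      ENNReal.ofReal (Real.exp (-dist (γ p) p + gromovBdry p (γ.symm p) b +
        gromovBdry p (γ.symm p) c)) := by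
  set q := γ.symm p
  have e0 : dist (γ p) p = dist p q := by
    rw [← hγ.dist_eq p q, γ.apply_symm_apply]
  have h1 := (Boundary.tendsto_gromovExt hX hδ hyp p (b.map γ hγ) (c.map γ hγ)).comp
    ((tendsto_nhdsHoro_map γ hγ b).prodMap (tendsto_nhdsHoro_map γ hγ c))
  have h2 := Boundary.tendsto_gromovExt hX hδ hyp p b c
  have h3 : Tendsto (fun z : X × X =>
      ((dist p q - gromov p q z.1 - gromov p q z.2 : ℝ) : EReal))
      (nhdsHoro b.1 ×ˢ nhdsHoro c.1)
      (𝓝 ((dist p q - gromovBdry p q b - gromovBdry p q c : ℝ) : EReal)) := by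
    refine (continuous_coe_real_ereal.tendsto _).comp ?_
    exact (((tendsto_gromov_nhdsHoro p q b).comp tendsto_fst).const_sub _).sub
      ((tendsto_gromov_nhdsHoro p q c).comp tendsto_snd)
  -- The extended product may be infinite, but the second summand is real, so `EReal` addition is
  -- continuous there.
  have h4 := (EReal.continuousAt_add (p := (gromovExt p b.1 c.1,
    ((dist p q - gromovBdry p q b - gromovBdry p q c : ℝ) : EReal)))
    (Or.inr (EReal.coe_ne_bot _)) (Or.inr (EReal.coe_ne_top _))).tendsto.comp (h2.prodMk_nhds h3)
  have h5 : gromovExt p (b.map γ hγ).1 (c.map γ hγ).1 = gromovExt p b.1 c.1 +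
      ((dist p q - gromovBdry p q b - gromovBdry p q c : ℝ) : EReal) := by
    refine tendsto_nhds_unique h1 (h4.congr fun z => ?_)
    simp only [Function.comp_apply, Prod.map_fst, Prod.map_snd]
    rw [← EReal.coe_add, EReal.coe_eq_coe_iff]
    have e1 : ∀ x, dist (γ x) p = dist x q := fun x => by
      rw [← hγ.dist_eq x q, γ.apply_symm_apply]
    unfold gromov
    rw [hγ.dist_eq, e1, e1, dist_comm q p, dist_comm q z.1, dist_comm q z.2]
    ring
  rw [busemannDist, busemannDist, h5, EReal.neg_add (Or.inr (EReal.coe_ne_top _)) (Or.inr (EReal.coe_ne_bot _)),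
    sub_eq_add_neg, EReal.exp_add, ← EReal.coe_neg, EReal.exp_coe, e0]
  congr 3
  ring

/-- The Gromov product with a fixed point is uniformly continuous for the Busemann metric. -/
theorem exists_abs_gromovBdry_sub_le (hX : IsCATNegOne X) {δ : ℝ} (hδ : 0 ≤ δ)
    (hyp : IsHyperbolic X δ) (p q : X) {ε : ℝ} (hε : 0 < ε) :
    ∃ ρ : ℝ≥0∞, 0 < ρ ∧ ∀ b c : Boundary X, busemannDist p b c ≤ ρ →
      |gromovBdry p q b - gromovBdry p q c| ≤ ε := by
  have hlim : Tendsto (fun T : ℝ => 3 * Real.exp (4 * δ - T) + 3 * Real.exp (2 * dist p q - T))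
      atTop (𝓝 0) := by
    have h1 : ∀ c : ℝ, Tendsto (fun T : ℝ => 3 * Real.exp (c - T)) atTop (𝓝 0) := by
      intro c
      have h2 : Tendsto (fun T : ℝ => c - T) atTop atBot :=
        tendsto_atBot_add_const_left _ c tendsto_neg_atTop_atBot
      simpa using (Real.tendsto_exp_atBot.comp h2).const_mul 3
    simpa using (h1 (4 * δ)).add (h1 (2 * dist p q))
  obtain ⟨T, hT1, hT0⟩ := ((hlim.eventually_lt_const hε).and (eventually_gt_atTop 0)).exists
  -- Using `T + 1` yields the strict inequality `T < gromovExt`, which passes to nearby pairs of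
  -- points of `X`.
  refine ⟨ENNReal.ofReal (Real.exp (-(T + 1))), ENNReal.ofReal_pos.2 (Real.exp_pos _), ?_⟩
  intro b c hbc
  rw [busemannDist, ← EReal.exp_coe, EReal.exp_le_exp_iff, EReal.coe_neg, EReal.neg_le_neg_iff]
    at hbc
  have hlt : (T : EReal) < gromovExt p b.1 c.1 :=
    lt_of_lt_of_le (by exact_mod_cast lt_add_one T) hbc
  have hev := (Boundary.tendsto_gromovExt hX hδ hyp p b c).eventually_const_lt hlt
  have ht : Tendsto (fun z : X × X => |gromov p q z.1 - gromov p q z.2|)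
      (nhdsHoro b.1 ×ˢ nhdsHoro c.1) (𝓝 |gromovBdry p q b - gromovBdry p q c|) :=
    (((tendsto_gromov_nhdsHoro p q b).comp tendsto_fst).sub
      ((tendsto_gromov_nhdsHoro p q c).comp tendsto_snd)).abs
  refine le_of_tendsto ht ?_
  filter_upwards [hev] with z hz
  have hz' : T ≤ gromov p z.1 z.2 := by exact_mod_cast hz.le
  have h6 := abs_le.1 (hX.abs_horofunction_sub_le hδ hyp (q := q) hT0 hz')
  unfold gromov
  rw [dist_comm q z.1, dist_comm q z.2, abs_le]
  constructor <;> linarith [h6.1, h6.2]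

/-- Points of `X` at a given height in the direction of a boundary point. -/
theorem Boundary.exists_gromovBdry_ge (hX : IsGeodesic X) {δ : ℝ} (hyp : IsHyperbolic X δ) (p : X)
    (b : Boundary X) {T : ℝ} (hT : 0 ≤ T) : ∃ x, dist p x = T ∧ T - δ ≤ gromovBdry p x b := by
  -- Currying fixes one point `y` near `b` while the other still tends to `b`.
  have h1 := (Boundary.tendsto_gromov_self hX hyp p b T).curry
  obtain ⟨y, hy, hyT⟩ := (h1.and (b.eventually_lt_dist p T)).exists
  obtain ⟨x, hx, hpx⟩ := hX.exists_between p y hT (by rw [dist_comm]; exact hyT.le)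
  refine ⟨x, hpx, ge_of_tendsto (tendsto_gromov_nhdsHoro p x b) ?_⟩
  filter_upwards [hy] with z hz
  have h2 := hyp x z p y
  rw [gromov_of_between hx, hpx, gromov_comm p z y, min_eq_left hz.le] at h2
  exact h2

end GromovExt

end

end BoundaryRep

namespace BoundaryRep

/-! ### Hausdorff outer measures: Lipschitz images and measurability -/

section HausdorffOuter

variable {B : Type*} {σ : B → B → ℝ≥0∞} {s : ℝ}

lemma le_diamOf {A : Set B} {b c : B} (hb : b ∈ A) (hc : c ∈ A) : σ b c ≤ diamOf σ A :=
  le_iSup₂_of_le b hb (le_iSup₂_of_le c hc le_rfl)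

lemma diamOf_le {A : Set B} {d : ℝ≥0∞} (h : ∀ b ∈ A, ∀ c ∈ A, σ b c ≤ d) : diamOf σ A ≤ d :=
  iSup₂_le fun b hb => iSup₂_le fun c hc => h b hb c hc

/-- The outer measures whose supremum is the Hausdorff outer measure. -/
noncomputable def hausdorffPre (σ : B → B → ℝ≥0∞) (s : ℝ) (r : ℝ≥0∞) : OuterMeasure B :=
  OuterMeasure.boundedBy (fun A => ⨅ _ : diamOf σ A ≤ r, diamOf σ A ^ s)

lemma hausdorffOuter_apply (A : Set B) :
    hausdorffOuter σ s A = ⨆ (r : ℝ≥0∞) (_ : 0 < r), hausdorffPre σ s r A := by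
  rw [hausdorffOuter]
  simp only [OuterMeasure.iSup_apply]
  rfl

lemma hausdorffPre_le {r : ℝ≥0∞} (hr : 0 < r) (A : Set B) :
    hausdorffPre σ s r A ≤ hausdorffOuter σ s A := by
  rw [hausdorffOuter_apply]
  exact le_iSup₂_of_le r hr le_rfl

lemma hausdorffPre_anti {r r' : ℝ≥0∞} (h : r ≤ r') (A : Set B) :
    hausdorffPre σ s r' A ≤ hausdorffPre σ s r A := by
  refine (?_ : hausdorffPre σ s r' ≤ hausdorffPre σ s r) A
  refine OuterMeasure.le_boundedBy.2 fun t => ?_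
  refine le_iInf fun ht => ?_
  exact (OuterMeasure.boundedBy_le t).trans (iInf_le _ (ht.trans h))

/-- The Hausdorff outer measure of the image of a set under a Lipschitz map. -/
theorem hausdorffOuter_image_le (hs : 0 ≤ s) {L : ℝ≥0∞} (hL0 : L ≠ 0) (hL : L ≠ ⊤) {f : B → B}
    {A : Set B} (hf : ∀ b ∈ A, ∀ c ∈ A, σ (f b) (f c) ≤ L * σ b c) :
    hausdorffOuter σ s (f '' A) ≤ L ^ s * hausdorffOuter σ s A := by
  have hLs0 : L ^ s ≠ 0 := by
    rw [ne_eq, ENNReal.rpow_eq_zero_iff]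
    rintro (h | h)
    · exact hL0 h.1
    · exact hL h.1
  rw [hausdorffOuter_apply]
  refine iSup₂_le fun r hr => ?_
  -- Covers at scale `r / L` are carried by `f` to covers at scale `r`.
  have hr' : 0 < r / L := ENNReal.div_pos hr.ne' hL
  refine le_trans ?_ (mul_le_mul_right (hausdorffPre_le hr' A) _)
  rw [hausdorffPre, hausdorffPre, OuterMeasure.boundedBy_apply, OuterMeasure.boundedBy_apply,
    ENNReal.mul_iInf_of_ne hLs0 (ENNReal.rpow_ne_top_of_nonneg hs hL)]
  refine le_iInf fun t => ?_
  rw [ENNReal.mul_iInf_of_ne hLs0 (ENNReal.rpow_ne_top_of_nonneg hs hL)]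
  refine le_iInf fun ht => ?_
  refine iInf₂_le_of_le (fun n => f '' (A ∩ t n)) ?_ ?_
  · rintro _ ⟨b, hb, rfl⟩
    obtain ⟨n, hn⟩ := Set.mem_iUnion.1 (ht hb)
    exact Set.mem_iUnion.2 ⟨n, b, ⟨hb, hn⟩, rfl⟩
  · rw [← ENNReal.tsum_mul_left]
    refine ENNReal.tsum_le_tsum fun n => iSup_le fun hne => ?_
    have hne' : (t n).Nonempty := by
      obtain ⟨_, b, hb, rfl⟩ := hne
      exact ⟨b, hb.2⟩
    have hd : diamOf σ (f '' (A ∩ t n)) ≤ L * diamOf σ (t n) := by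
      refine diamOf_le ?_
      rintro _ ⟨b, hb, rfl⟩ _ ⟨c, hc, rfl⟩
      exact (hf b hb.1 c hc.1).trans (mul_le_mul_right (le_diamOf hb.2 hc.2) _)
    rw [iSup_pos hne', ENNReal.mul_iInf_of_ne hLs0 (ENNReal.rpow_ne_top_of_nonneg hs hL)]
    refine le_iInf fun hr2 => ?_
    refine iInf_le_of_le ?_ ?_
    · refine hd.trans ?_
      rw [mul_comm]
      exact (ENNReal.le_div_iff_mul_le (Or.inl hL0) (Or.inl hL)).1 hr2
    · rw [← ENNReal.mul_rpow_of_nonneg _ _ hs]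
      exact ENNReal.rpow_le_rpow hd hs

/-- The Hausdorff outer measure is additive on separated sets. -/
lemma hausdorffOuter_union {u v : Set B} {ρ : ℝ≥0∞} (hρ : 0 < ρ)
    (h : ∀ b ∈ u, ∀ c ∈ v, ρ < σ b c) :
    hausdorffOuter σ s (u ∪ v) = hausdorffOuter σ s u + hausdorffOuter σ s v := by
  refine le_antisymm (measure_union_le _ _) ?_
  have key : ∀ r, 0 < r → r ≤ ρ →
      hausdorffPre σ s r (u ∪ v) = hausdorffPre σ s r u + hausdorffPre σ s r v := by
    intro r _ hrρ
    -- A set meeting both `u` and `v` has diameter above `r`, so its cost is `⊤`.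
    refine OuterMeasure.boundedBy_union_of_top_of_nonempty_inter ?_
    rintro w ⟨b, hbu, hbw⟩ ⟨c, hcv, hcw⟩
    have h1 : r < diamOf σ w := hrρ.trans_lt ((h b hbu c hcv).trans_le (le_diamOf hbw hcw))
    exact iInf_eq_top.2 fun h2 => absurd h2 h1.not_ge
  rw [hausdorffOuter_apply u, hausdorffOuter_apply v]
  refine ENNReal.biSup_add_biSup_le' ⟨1, one_pos⟩ ⟨1, one_pos⟩ fun r hr r' hr' => ?_
  have hm : 0 < min (min r r') ρ := lt_min (lt_min hr hr') hρ
  calc hausdorffPre σ s r u + hausdorffPre σ s r' v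
      ≤ hausdorffPre σ s (min (min r r') ρ) u + hausdorffPre σ s (min (min r r') ρ) v :=
        add_le_add (hausdorffPre_anti ((min_le_left _ _).trans (min_le_left _ _)) u)
          (hausdorffPre_anti ((min_le_left _ _).trans (min_le_right _ _)) v)
    _ = hausdorffPre σ s (min (min r r') ρ) (u ∪ v) := (key _ hm (min_le_right _ _)).symm
    _ ≤ _ := hausdorffPre_le hm _

/-- Uniformly continuous functions are Carathéodory measurable. -/
theorem measurable_of_uniformContinuous {g : B → ℝ}
    (hg : ∀ ε : ℝ, 0 < ε → ∃ ρ : ℝ≥0∞, 0 < ρ ∧ ∀ b c, σ b c ≤ ρ → |g b - g c| ≤ ε) :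
    @Measurable B ℝ (hausdorffOuter σ s).caratheodory _ g := by
  intro A hA
  refine (OuterMeasure.isCaratheodory_iff _).2 fun t => ?_
  -- No metric axioms are available for `σ`. The outer measure restricted to `t` is therefore pushed
  -- to `ℝ` along `g`, where it is a metric outer measure and Borel sets are Carathéodory
  -- measurable.
  have hmet : (OuterMeasure.map g (OuterMeasure.restrict t (hausdorffOuter σ s))).IsMetric := by
    rintro u v ⟨r, hr0, hr⟩
    rw [OuterMeasure.map_apply, OuterMeasure.map_apply, OuterMeasure.map_apply,
      OuterMeasure.restrict_apply, OuterMeasure.restrict_apply, OuterMeasure.restrict_apply,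
      Set.preimage_union, Set.union_inter_distrib_right]
    obtain ⟨ε, hε0, hε⟩ := ENNReal.lt_iff_exists_real_btwn.1 (pos_iff_ne_zero.2 hr0)
    have hεpos : 0 < ε := ENNReal.ofReal_pos.1 hε.1
    obtain ⟨ρ, hρ, h⟩ := hg ε hεpos
    refine hausdorffOuter_union hρ fun b hb c hc => ?_
    by_contra! hle
    have h1 := h b c hle
    have h2 := hr _ hb.1 _ hc.1
    rw [edist_dist, Real.dist_eq] at h2
    exact absurd (h2.trans (ENNReal.ofReal_le_ofReal h1)) hε.2.not_ge
  have hbor : borel ℝ ≤ _ := hmet.borel_le_caratheodory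
  have hA' : MeasurableSet[borel ℝ] A := by rwa [← BorelSpace.measurable_eq (α := ℝ)]
  have h1 := (OuterMeasure.isCaratheodory_iff _).1 (hbor A hA') Set.univ
  simp only [OuterMeasure.map_apply, OuterMeasure.restrict_apply] at h1
  simp only [Set.preimage_univ, Set.univ_inter, Set.preimage_sdiff] at h1
  rw [h1, Set.inter_comm, Set.sdiff_eq, Set.sdiff_eq, Set.inter_right_comm, Set.univ_inter,
    Set.inter_comm t]

end HausdorffOuter

end BoundaryRep

namespace BoundaryRep

/-! ### The shadow lemma, orbit counting and the uniform bound -/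

section Counting

/-- A group of isometries of a hyperbolic CAT(-1) space whose orbit of `p` is locally finite and
`R`-dense, also among the points at prescribed distance from `p`. -/
structure IsCocompactAction {X : Type*} [MetricSpace X] (Γ : Subgroup (X ≃ₜ X)) (p : X)
    (R δ : ℝ) : Prop where
  cat : IsCATNegOne X
  nonneg : 0 ≤ δ
  hyp : IsHyperbolic X δ
  isometry : ∀ γ ∈ Γ, Isometry γ
  radius_nonneg : 0 ≤ R
  dense : ∀ x, ∃ γ : Γ, dist x (γ.1 p) ≤ R
  finite : ∀ r, {γ : Γ | dist (γ.1 p) p ≤ r}.Finite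
  annulus : ∀ x, x ≠ p → ∃ γ : Γ, |dist (γ.1 p) p - dist x p| < R ∧ dist x (γ.1 p) ≤ R + 1

/-- The shadow of `γ p` on the boundary. -/
def shadow {X : Type*} [MetricSpace X] {Γ : Subgroup (X ≃ₜ X)} (p : X) (K : ℝ) (γ : Γ) :
    Set (Boundary X) := {b | dist (γ.1 p) p - K ≤ gromovBdry p (γ.1 p) b}

/-- Conformal measures of dimension `η`, in terms of the measures of shadows. -/
structure IsConformalMeasure {X : Type*} [MetricSpace X] (Γ : Subgroup (X ≃ₜ X)) (p : X) (η : ℝ)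
    {m : MeasurableSpace (Boundary X)} (ν : Measure (Boundary X)) : Prop where
  pos : 0 < η
  prob : IsProbabilityMeasure ν
  measurable : ∀ q, Measurable (gromovBdry p q)
  shadow_le : ∀ (γ : Γ) (K : ℝ),
    ν.real (shadow p K γ) ≤ Real.exp (η * (2 * K - dist (γ.1 p) p))
  le_shadow : ∀ (γ : Γ) (K : ℝ),
    Real.exp (-(η * dist (γ.1 p) p)) * ν.real {b | gromovBdry p (γ.1.symm p) b ≤ K} ≤
      ν.real (shadow p K γ)

lemma sum_exp_mul_le {η : ℝ} (hη : 0 < η) (n : ℕ) :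
    ∑ k ∈ Finset.range (n + 1), Real.exp (η * k) ≤ Real.exp (η * n) * (1 - Real.exp (-η))⁻¹ := by
  have h1 : 0 < 1 - Real.exp (-η) := by
    have : Real.exp (-η) < 1 := Real.exp_lt_one_iff.2 (by linarith)
    linarith
  rw [le_mul_inv_iff₀ h1]
  induction n with
  | zero =>
    have := Real.exp_pos (-η)
    simp; linarith
  | succ n ih =>
    rw [Finset.sum_range_succ, add_mul]
    have h2 : Real.exp (η * ((n + 1 : ℕ) : ℝ)) * Real.exp (-η) = Real.exp (η * n) := by
      rw [← Real.exp_add]; congr 1; push_cast; ring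
    nlinarith

/-- A family of sets of bounded multiplicity has bounded total measure. -/
lemma sum_measureReal_le {α ι : Type*} {m : MeasurableSpace α} (ν : Measure α)
    [IsProbabilityMeasure ν] (A : Finset ι) (S : ι → Set α) (hS : ∀ i ∈ A, MeasurableSet (S i))
    (N : ℕ) (hN : ∀ b, ∀ T ⊆ A, (∀ i ∈ T, b ∈ S i) → T.card ≤ N) :
    ∑ i ∈ A, ν.real (S i) ≤ N := by
  classical
  calc ∑ i ∈ A, ν.real (S i) = ∑ i ∈ A, ∫ b, (S i).indicator 1 b ∂ν :=
        Finset.sum_congr rfl fun i hi => (integral_indicator_one (hS i hi)).symm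
    _ = ∫ b, ∑ i ∈ A, (S i).indicator (1 : α → ℝ) b ∂ν :=
        (integral_finsetSum A fun i hi =>
          (integrable_const (1 : ℝ)).indicator (hS i hi)).symm
    _ ≤ ∫ _, (N : ℝ) ∂ν := by
        refine integral_mono_of_nonneg (Eventually.of_forall fun b =>
          Finset.sum_nonneg fun i _ => Set.indicator_nonneg (fun _ _ => zero_le_one) _)
          (integrable_const _) (Eventually.of_forall fun b => ?_)
        have h1 : ∑ i ∈ A, (S i).indicator (1 : α → ℝ) b = ((A.filter fun i => b ∈ S i).card : ℝ) := by
          rw [Finset.card_filter]; push_cast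
          exact Finset.sum_congr rfl fun i _ => by simp [Set.indicator_apply]
        change ∑ i ∈ A, (S i).indicator (1 : α → ℝ) b ≤ N
        rw [h1]
        exact_mod_cast hN b _ (Finset.filter_subset _ _) fun i hi => (Finset.mem_filter.1 hi).2
    _ = N := by simp

variable {X : Type*} [MetricSpace X] {Γ : Subgroup (X ≃ₜ X)} {p : X} {R δ η : ℝ}

/-- The number of group elements moving `p` by at most `r`. -/
noncomputable def orbitCount (Γ : Subgroup (X ≃ₜ X)) (p : X) (r : ℝ) : ℕ :=
  {γ : Γ | dist (γ.1 p) p ≤ r}.ncard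

namespace IsCocompactAction

variable (hA : IsCocompactAction Γ p R δ)
include hA

/-- Translation by `γ₀⁻¹` moves the elements of `T` injectively into the ball of radius `r` about
`p`. -/
lemma card_le_of_dist_le (T : Finset Γ) (γ₀ : Γ) {r : ℝ}
    (hT : ∀ γ ∈ T, dist (γ.1 p) (γ₀.1 p) ≤ r) : T.card ≤ orbitCount Γ p r := by
  classical
  rw [← Finset.card_image_of_injective T (mul_right_injective γ₀⁻¹), ← Set.ncard_coe_finset]
  refine Set.ncard_le_ncard ?_ (hA.finite r)
  intro γ' hγ'
  obtain ⟨γ, hγ, rfl⟩ := Finset.mem_image.1 (Finset.mem_coe.1 hγ')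
  change dist ((γ₀⁻¹ * γ : Γ).1 p) p ≤ r
  have h1 : γ₀.1 ((γ₀⁻¹ * γ : Γ).1 p) = γ.1 p := γ₀.1.apply_symm_apply (γ.1 p)
  rw [← (hA.isometry γ₀.1 γ₀.2).dist_eq, h1]
  exact hT γ hγ

end IsCocompactAction

namespace IsConformalMeasure

variable {m : MeasurableSpace (Boundary X)} {ν : Measure (Boundary X)}

lemma measurableSet_shadow (hν : IsConformalMeasure Γ p η ν) (K : ℝ) (γ : Γ) :
    MeasurableSet (shadow p K γ) :=
  measurableSet_le measurable_const (hν.measurable _)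

variable (hA : IsCocompactAction Γ p R δ) (hν : IsConformalMeasure Γ p η ν)
include hA hν

/-- The set in question lies in the shadow of an orbit point near the point of the segment from `p`
to `q` at distance `K`; a large `K` makes this shadow small. -/
lemma exists_measureReal_lt_le :
    ∃ K : ℝ, 0 ≤ K ∧ ∀ q, ν.real {b | K < gromovBdry p q b} ≤ 1 / 2 := by
  have hη := hν.pos
  have := hν.prob
  have hR := hA.radius_nonneg
  have hδ := hA.nonneg
  have hlog : 0 ≤ Real.log 2 / η := by positivity
  -- In the shadow bound, `2(2R + δ)` comes from the shadow parameter, a further `R` from replacing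
  -- `x` by an orbit point, and `log 2 / η` produces the factor `1/2`.
  refine ⟨5 * R + 2 * δ + Real.log 2 / η, by positivity, fun q => ?_⟩
  set K := 5 * R + 2 * δ + Real.log 2 / η with hK
  have hK0 : 0 ≤ K := by positivity
  rcases lt_or_ge (dist p q) K with hq | hq
  · have : {b | K < gromovBdry p q b} = ∅ := by
      ext b
      simp only [Set.mem_ofPred_eq, Set.mem_empty_iff_false, iff_false, not_lt]
      exact (gromovBdry_le_dist p q b).trans hq.le
    rw [this]; simp
  obtain ⟨x, hx, hpx⟩ := hA.cat.geodesic.exists_between p q hK0 hq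
  obtain ⟨γ, hγ⟩ := hA.dense x
  have hsub : {b | K < gromovBdry p q b} ⊆ shadow p (2 * R + δ) γ := by
    intro b hb
    have hb : K < gromovBdry p q b := hb
    have h1 := hA.hyp.min_gromovBdry_le p x q b
    rw [gromov_of_between hx, hpx, min_eq_left hb.le] at h1
    have h2 := gromovBdry_le_add_dist p x (γ.1 p) b
    have h3 := dist_triangle p x (γ.1 p)
    change dist (γ.1 p) p - (2 * R + δ) ≤ gromovBdry p (γ.1 p) b
    rw [dist_comm (γ.1 p) p]
    linarith
  refine (measureReal_mono hsub).trans ((hν.shadow_le γ _).trans ?_)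
  have h4 := dist_triangle_right p x (γ.1 p)
  have h5 : η * (2 * (2 * R + δ) - dist (γ.1 p) p) ≤ -Real.log 2 := by
    have h6 : 2 * (2 * R + δ) - dist (γ.1 p) p ≤ -(Real.log 2 / η) := by
      rw [dist_comm (γ.1 p) p]; linarith
    calc _ ≤ η * (-(Real.log 2 / η)) := by gcongr
      _ = _ := by field_simp
  calc _ ≤ Real.exp (-Real.log 2) := Real.exp_le_exp.2 h5
    _ = 1 / 2 := by rw [Real.exp_neg, Real.exp_log (by norm_num)]; norm_num

/-- The lower half of Sullivan's shadow lemma: by `exists_measureReal_lt_le`, the sublevel set in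
`le_shadow` has at least half of the mass. -/
lemma exists_le_measureReal_shadow :
    ∃ K : ℝ, 0 ≤ K ∧ ∀ γ : Γ, 1 / 2 * Real.exp (-(η * dist (γ.1 p) p)) ≤
      ν.real (shadow p K γ) := by
  obtain ⟨K, hK, h⟩ := exists_measureReal_lt_le hA hν
  have := hν.prob
  refine ⟨K, hK, fun γ => ?_⟩
  refine le_trans ?_ (hν.le_shadow γ K)
  have h1 : ν.real {b | gromovBdry p (γ.1.symm p) b ≤ K} =
      1 - ν.real {b | K < gromovBdry p (γ.1.symm p) b} := by
    rw [← probReal_compl_eq_one_sub (measurableSet_lt measurable_const (hν.measurable _))]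
    congr 1
    ext b
    simp
  have h2 := h (γ.1.symm p)
  rw [h1, mul_comm]
  gcongr
  linarith

/-- Two points of a unit annulus whose shadows share a boundary point are at distance at most `2 +
2K + 2δ`. Thus the shadows have bounded multiplicity, and as each has a definite measure and the
total mass is `1`, they are not too many. -/
lemma exists_card_annulus_le :
    ∃ C : ℝ, 0 ≤ C ∧ ∀ (s : ℝ) (T : Finset Γ),
      (∀ γ ∈ T, s ≤ dist (γ.1 p) p ∧ dist (γ.1 p) p ≤ s + 1) →
      (T.card : ℝ) ≤ C * Real.exp (η * (s + 1)) := by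
  obtain ⟨K, hK, h⟩ := exists_le_measureReal_shadow hA hν
  have := hν.prob
  have hη := hν.pos
  refine ⟨2 * orbitCount Γ p (2 + 2 * K + 2 * δ), by positivity, fun s T hT => ?_⟩
  have h1 : ∑ γ ∈ T, ν.real (shadow p K γ) ≤ orbitCount Γ p (2 + 2 * K + 2 * δ) := by
    refine sum_measureReal_le ν T _ (fun γ _ => hν.measurableSet_shadow K γ) _ ?_
    intro b T' hT' hb
    rcases T'.eq_empty_or_nonempty with rfl | ⟨γ₀, hγ₀⟩
    · simp
    refine hA.card_le_of_dist_le T' γ₀ fun γ hγ => ?_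
    have i1 : dist (γ.1 p) p - K ≤ gromovBdry p (γ.1 p) b := hb γ hγ
    have i2 : dist (γ₀.1 p) p - K ≤ gromovBdry p (γ₀.1 p) b := hb γ₀ hγ₀
    have i3 := hA.hyp.min_gromovBdry_le_gromov p (γ.1 p) (γ₀.1 p) b
    have i4 := hT γ (hT' hγ)
    have i5 := hT γ₀ (hT' hγ₀)
    have i6 : s - K ≤ min (gromovBdry p (γ.1 p) b) (gromovBdry p (γ₀.1 p) b) :=
      le_min (by linarith) (by linarith)
    unfold gromov at i3
    linarith
  have h2 : T.card • (1 / 2 * Real.exp (-(η * (s + 1)))) ≤ ∑ γ ∈ T, ν.real (shadow p K γ) := by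
    refine Finset.card_nsmul_le_sum _ _ _ fun γ hγ => le_trans ?_ (h γ)
    gcongr
    exact (hT γ hγ).2
  rw [nsmul_eq_mul] at h2
  have h3 : Real.exp (-(η * (s + 1))) * Real.exp (η * (s + 1)) = 1 := by
    rw [← Real.exp_add]; simp
  calc (T.card : ℝ) = 2 * (T.card * (1 / 2 * Real.exp (-(η * (s + 1))))) *
        Real.exp (η * (s + 1)) := by linear_combination (-(T.card : ℝ)) * h3
    _ ≤ 2 * orbitCount Γ p (2 + 2 * K + 2 * δ) * Real.exp (η * (s + 1)) := by
      gcongr; exact h2.trans h1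

/-- Upper bound for the orbital counting function. -/
lemma exists_orbitCount_le :
    ∃ C : ℝ, 0 ≤ C ∧ ∀ T : ℝ, 0 ≤ T → (orbitCount Γ p T : ℝ) ≤ C * Real.exp (η * T) := by
  classical
  obtain ⟨C, hC, h⟩ := exists_card_annulus_le hA hν
  have hη := hν.pos
  have hG : 0 < (1 - Real.exp (-η))⁻¹ := by
    have : Real.exp (-η) < 1 := Real.exp_lt_one_iff.2 (by linarith)
    exact inv_pos.2 (by linarith)
  refine ⟨C * Real.exp η * (1 - Real.exp (-η))⁻¹, by positivity, fun T hT => ?_⟩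
  set F := (hA.finite T).toFinset with hF
  have hcard : orbitCount Γ p T = F.card := Set.ncard_eq_toFinset_card _ (hA.finite T)
  have hmap : ∀ γ ∈ F, ⌊dist (γ.1 p) p⌋₊ ∈ Finset.range (⌊T⌋₊ + 1) := by
    intro γ hγ
    rw [Finset.mem_range, Nat.lt_succ_iff]
    exact Nat.floor_le_floor ((hA.finite T).mem_toFinset.1 hγ)
  rw [hcard, Finset.card_eq_sum_card_fiberwise hmap]
  push_cast
  calc ∑ k ∈ Finset.range (⌊T⌋₊ + 1), ((F.filter fun γ => ⌊dist (γ.1 p) p⌋₊ = k).card : ℝ)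
      ≤ ∑ k ∈ Finset.range (⌊T⌋₊ + 1), C * Real.exp η * Real.exp (η * k) := by
        refine Finset.sum_le_sum fun k _ => ?_
        refine (h k _ fun γ hγ => ?_).trans_eq ?_
        · have h1 := (Finset.mem_filter.1 hγ).2
          have h2 := Nat.floor_le (dist_nonneg (x := γ.1 p) (y := p))
          have h3 := Nat.lt_floor_add_one (dist (γ.1 p) p)
          rw [h1] at h2 h3
          exact ⟨h2, h3.le⟩
        · rw [mul_add, mul_one, Real.exp_add]; ring
    _ = C * Real.exp η * ∑ k ∈ Finset.range (⌊T⌋₊ + 1), Real.exp (η * k) := by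
        rw [Finset.mul_sum]
    _ ≤ C * Real.exp η * (Real.exp (η * ⌊T⌋₊) * (1 - Real.exp (-η))⁻¹) := by
        gcongr; exact sum_exp_mul_le hη _
    _ ≤ C * Real.exp η * (Real.exp (η * T) * (1 - Real.exp (-η))⁻¹) := by
        gcongr; exact Nat.floor_le hT
    _ = _ := by ring

variable [ProperSpace X]

/-- Lower bound for the number of group elements in an annulus. -/
lemma exists_le_card_annulus :
    ∃ c : ℝ, 0 < c ∧ ∀ t : ℝ, 0 < t → ∀ S : Finset Γ,
      (∀ γ : Γ, |dist (γ.1 p) p - t| < R → γ ∈ S) →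
      (∀ γ ∈ S, |dist (γ.1 p) p - t| < R) → c * Real.exp (η * t) ≤ S.card := by
  have hη := hν.pos
  have := hν.prob
  -- The losses are `δ` for the height of `x`, `R + 1` for the distance from `x` to `γ p`, and `R`
  -- for the excess of `dist (γ p) p` over `t`.
  set K := 2 * R + δ + 1
  refine ⟨Real.exp (-(η * (2 * K + R))), Real.exp_pos _, fun t ht S hS hS' => ?_⟩
  have hcov : Set.univ ⊆ ⋃ γ ∈ S, shadow p K γ := by
    intro b _
    obtain ⟨x, hx, hxb⟩ := Boundary.exists_gromovBdry_ge hA.cat.geodesic hA.hyp p b ht.le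
    have hxp : x ≠ p := by
      rintro rfl; rw [dist_self] at hx; linarith
    obtain ⟨γ, hγ1, hγ2⟩ := hA.annulus x hxp
    rw [dist_comm x p, hx] at hγ1
    simp only [Set.mem_iUnion]
    refine ⟨γ, hS γ hγ1, ?_⟩
    have h1 := gromovBdry_le_add_dist p x (γ.1 p) b
    have h2 := (abs_lt.1 hγ1).2
    change dist (γ.1 p) p - (2 * R + δ + 1) ≤ gromovBdry p (γ.1 p) b
    linarith
  have h1 : (1 : ℝ) ≤ ∑ γ ∈ S, ν.real (shadow p K γ) := by
    calc (1 : ℝ) = ν.real Set.univ := probReal_univ.symm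
      _ ≤ ν.real (⋃ γ ∈ S, shadow p K γ) := measureReal_mono hcov (measure_ne_top _ _)
      _ ≤ _ := measureReal_biUnion_finset_le _ _
  have h2 : ∑ γ ∈ S, ν.real (shadow p K γ) ≤ S.card • Real.exp (η * (2 * K + R - t)) := by
    refine Finset.sum_le_card_nsmul _ _ _ fun γ hγ => (hν.shadow_le γ K).trans ?_
    have h3 := (abs_lt.1 (hS' γ hγ)).1
    exact Real.exp_le_exp.2 (mul_le_mul_of_nonneg_left (by linarith) hη.le)
  rw [nsmul_eq_mul] at h2
  have h4 : Real.exp (η * (2 * K + R - t)) * (Real.exp (-(η * (2 * K + R))) * Real.exp (η * t)) =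
      1 := by
    rw [← Real.exp_add, ← Real.exp_add, Real.exp_eq_one_iff]; ring
  calc _ = 1 * (Real.exp (-(η * (2 * K + R))) * Real.exp (η * t)) := by rw [one_mul]
    _ ≤ (S.card * Real.exp (η * (2 * K + R - t))) *
        (Real.exp (-(η * (2 * K + R))) * Real.exp (η * t)) := by gcongr; exact h1.trans h2
    _ = _ := by rw [mul_assoc, h4, mul_one]

/-- Upper bound for the sum of the unnormalized functions over an annulus. -/
lemma exists_sum_annulus_le :
    ∃ C : ℝ, 0 ≤ C ∧ ∀ t : ℝ, 0 < t → ∀ S : Finset Γ, (∀ γ ∈ S, |dist (γ.1 p) p - t| < R) →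
      ∀ b, ∑ γ ∈ S, Real.exp (η * gromovBdry p (γ.1 p) b) ≤ C * ((1 + t) * Real.exp (η * t)) := by
  classical
  obtain ⟨C, hC, hN⟩ := exists_orbitCount_le hA hν
  have hη := hν.pos
  have hR := hA.radius_nonneg
  have hδ := hA.nonneg
  set C1 := C * Real.exp (η * (3 * R + 4 * δ))
  refine ⟨Real.exp η * C1 * (1 + R), by positivity, fun t ht S hS b => ?_⟩
  have hcount : ∀ k ∈ Finset.range (⌊t + R⌋₊ + 1),
      ((S.filter fun γ => (k : ℝ) ≤ gromovBdry p (γ.1 p) b).card : ℝ) ≤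
        C1 * Real.exp (η * (t - k)) := by
    intro k hk
    have hk' : (k : ℝ) ≤ t + R :=
      (Nat.le_floor_iff (by linarith)).1 (Nat.lt_succ_iff.1 (Finset.mem_range.1 hk))
    -- The level `k` can exceed `t` by up to `R`. Capping the height of `x` at `t` keeps the radius
    -- of the ball counted below nonnegative and costs at most `R`.
    set s := min (k : ℝ) t
    have hs0 : 0 ≤ s := le_min (Nat.cast_nonneg k) ht.le
    have hst : s ≤ t := min_le_right _ _
    have hsk : (k : ℝ) - R ≤ s := le_min (by linarith) (by linarith)
    obtain ⟨x, hx, hxb⟩ := Boundary.exists_gromovBdry_ge hA.cat.geodesic hA.hyp p b hs0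
    obtain ⟨γ₀, hγ₀⟩ := hA.dense x
    have h1 : (S.filter fun γ => (k : ℝ) ≤ gromovBdry p (γ.1 p) b).card ≤
        orbitCount Γ p (t - s + 2 * R + 4 * δ) := by
      refine hA.card_le_of_dist_le _ γ₀ fun γ hγ => ?_
      obtain ⟨hγS, hγk⟩ := Finset.mem_filter.1 hγ
      have i1 := (abs_lt.1 (hS γ hγS)).2
      have i2 := hA.hyp.min_gromovBdry_le_gromov p (γ.1 p) x b
      have i3 : s - δ ≤ min (gromovBdry p (γ.1 p) b) (gromovBdry p x b) :=
        le_min (by have := min_le_left (k : ℝ) t; linarith) hxb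
      have i4 := dist_triangle (γ.1 p) x (γ₀.1 p)
      unfold gromov at i2
      rw [dist_comm x p, hx] at i2
      linarith
    calc _ ≤ (orbitCount Γ p (t - s + 2 * R + 4 * δ) : ℝ) := by exact_mod_cast h1
      _ ≤ C * Real.exp (η * (t - s + 2 * R + 4 * δ)) := hN _ (by linarith)
      _ ≤ C * Real.exp (η * (3 * R + 4 * δ + (t - k))) :=
        mul_le_mul_of_nonneg_left
          (Real.exp_le_exp.2 (mul_le_mul_of_nonneg_left (by linarith) hη.le)) hC
      _ = _ := by rw [mul_add η, Real.exp_add]; ring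
  -- The term `k = ⌊g⌋` alone suffices, because `e^{ηg} ≤ e^η e^{η⌊g⌋}`.
  have hpt : ∀ γ ∈ S, Real.exp (η * gromovBdry p (γ.1 p) b) ≤
      ∑ k ∈ Finset.range (⌊t + R⌋₊ + 1), if (k : ℝ) ≤ gromovBdry p (γ.1 p) b then
        Real.exp η * Real.exp (η * k) else 0 := by
    intro γ hγ
    have i0 := gromovBdry_nonneg p (γ.1 p) b
    have i1 := (abs_lt.1 (hS γ hγ)).2
    have i2 := gromovBdry_le_dist p (γ.1 p) b
    rw [dist_comm p] at i2
    set g := gromovBdry p (γ.1 p) b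
    have hmem : ⌊g⌋₊ ∈ Finset.range (⌊t + R⌋₊ + 1) := by
      rw [Finset.mem_range, Nat.lt_succ_iff]
      exact Nat.floor_le_floor (by linarith)
    refine le_trans ?_ (Finset.single_le_sum (fun k _ => ?_) hmem)
    · rw [if_pos (Nat.floor_le i0), ← Real.exp_add, Real.exp_le_exp]
      have := Nat.lt_floor_add_one g
      nlinarith
    · split_ifs <;> positivity
  calc ∑ γ ∈ S, Real.exp (η * gromovBdry p (γ.1 p) b)
      ≤ ∑ γ ∈ S, ∑ k ∈ Finset.range (⌊t + R⌋₊ + 1),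
        if (k : ℝ) ≤ gromovBdry p (γ.1 p) b then Real.exp η * Real.exp (η * k) else 0 :=
        Finset.sum_le_sum hpt
    _ = ∑ k ∈ Finset.range (⌊t + R⌋₊ + 1), Real.exp η * Real.exp (η * k) *
        ((S.filter fun γ => (k : ℝ) ≤ gromovBdry p (γ.1 p) b).card : ℝ) := by
        rw [Finset.sum_comm]
        refine Finset.sum_congr rfl fun k _ => ?_
        rw [← Finset.sum_filter, Finset.sum_const, nsmul_eq_mul, mul_comm]
    _ ≤ ∑ k ∈ Finset.range (⌊t + R⌋₊ + 1), Real.exp η * Real.exp (η * k) *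
        (C1 * Real.exp (η * (t - k))) := by
        refine Finset.sum_le_sum fun k hk => ?_
        gcongr
        exact hcount k hk
    _ = ∑ k ∈ Finset.range (⌊t + R⌋₊ + 1), Real.exp η * C1 * Real.exp (η * t) := by
        refine Finset.sum_congr rfl fun k _ => ?_
        have : Real.exp (η * t) = Real.exp (η * k) * Real.exp (η * (t - k)) := by
          rw [← Real.exp_add]; ring_nf
        rw [this]; ring
    _ = Real.exp η * C1 * Real.exp (η * t) * ((⌊t + R⌋₊ : ℝ) + 1) := by
        rw [Finset.sum_const, Finset.card_range, nsmul_eq_mul]; push_cast; ring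
    _ ≤ Real.exp η * C1 * Real.exp (η * t) * ((1 + R) * (1 + t)) := by
        gcongr
        have := Nat.floor_le (show 0 ≤ t + R by linarith)
        nlinarith
    _ = _ := by ring

omit [ProperSpace X] hA in
lemma integrable_exp_gromovBdry (q : X) :
    Integrable (fun b => Real.exp (η * gromovBdry p q b)) ν := by
  have hη := hν.pos
  have := hν.prob
  have hm : Measurable fun b => Real.exp (η * gromovBdry p q b) :=
    Real.measurable_exp.comp ((hν.measurable q).const_mul η)
  refine Integrable.of_bound hm.aestronglyMeasurable (Real.exp (η * dist p q))
    (Eventually.of_forall fun b => ?_)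
  rw [Real.norm_eq_abs, abs_of_pos (Real.exp_pos _), Real.exp_le_exp]
  gcongr
  exact gromovBdry_le_dist p q b

omit [ProperSpace X] in
/-- Lower bound for the integral of the unnormalized functions. -/
lemma exists_le_integral :
    ∃ c : ℝ, 0 < c ∧ ∀ q, c * (1 + dist p q) ≤ ∫ b, Real.exp (η * gromovBdry p q b) ∂ν := by
  classical
  obtain ⟨K, hK, h⟩ := exists_le_measureReal_shadow hA hν
  have hη := hν.pos
  have := hν.prob
  have hR := hA.radius_nonneg
  have hδ := hA.nonneg
  set K1 := 2 * R + K + δ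
  have hK1 : 0 ≤ K1 := by positivity
  set c1 := 1 / 2 * Real.exp (-(η * R)) with hc1
  have hc1pos : 0 < c1 := by positivity
  set G := (1 - Real.exp (-η))⁻¹ with hGdef
  have hG : 0 < G := by
    have : Real.exp (-η) < 1 := Real.exp_lt_one_iff.2 (by linarith)
    exact inv_pos.2 (by linarith)
  refine ⟨c1 / (2 * (Real.exp (η * K1) * G)), by positivity, fun q => ?_⟩
  set n := ⌊dist p q⌋₊ with hn
  have hmeas : ∀ k : ℕ, MeasurableSet {b | (k : ℝ) - K1 ≤ gromovBdry p q b} := fun k =>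
    measurableSet_le measurable_const (hν.measurable q)
  -- Each level up to `dist p q` contains the shadow of an orbit point at distance about `k`, so it
  -- contributes at least `c1`; the number of levels gives the linear growth.
  have hlow : ∀ k ∈ Finset.range (n + 1),
      c1 ≤ Real.exp (η * k) * ν.real {b | (k : ℝ) - K1 ≤ gromovBdry p q b} := by
    intro k hk
    have hk' : (k : ℝ) ≤ dist p q :=
      (Nat.le_floor_iff dist_nonneg).1 (Nat.lt_succ_iff.1 (Finset.mem_range.1 hk))
    obtain ⟨x, hx, hpx⟩ := hA.cat.geodesic.exists_between p q (Nat.cast_nonneg k) hk'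
    obtain ⟨γ, hγ⟩ := hA.dense x
    have htri := dist_triangle p x (γ.1 p)
    have htri2 := dist_triangle_right p x (γ.1 p)
    have hsub : shadow p K γ ⊆ {b | (k : ℝ) - K1 ≤ gromovBdry p q b} := by
      intro b hb
      have i1 : dist (γ.1 p) p - K ≤ gromovBdry p (γ.1 p) b := hb
      have i2 := gromovBdry_le_add_dist p (γ.1 p) x b
      have i3 := hA.hyp.min_gromovBdry_le p q x b
      rw [gromov_comm p q x, gromov_of_between hx, hpx] at i3
      have i4 : (k : ℝ) - (2 * R + K) ≤ min (k : ℝ) (gromovBdry p x b) := by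
        refine le_min (by linarith) ?_
        rw [dist_comm (γ.1 p) p] at i1
        rw [dist_comm (γ.1 p) x] at i2
        linarith
      change (k : ℝ) - (2 * R + K + δ) ≤ gromovBdry p q b
      linarith
    calc c1 = Real.exp (η * k) * (1 / 2 * Real.exp (-(η * (k + R)))) := by
          have : Real.exp (-(η * R)) = Real.exp (η * k) * Real.exp (-(η * (k + R))) := by
            rw [← Real.exp_add]; ring_nf
          rw [hc1, this]; ring
      _ ≤ Real.exp (η * k) * (1 / 2 * Real.exp (-(η * dist (γ.1 p) p))) := by
          gcongr
          rw [dist_comm]; linarith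
      _ ≤ Real.exp (η * k) * ν.real {b | (k : ℝ) - K1 ≤ gromovBdry p q b} := by
          gcongr
          exact (h γ).trans (measureReal_mono hsub)
  -- At a fixed `b` the weighted levels form a geometric sum, dominated by its last term `e^{η(g +
  -- K1)}`.
  have hpt : ∀ b, ∑ k ∈ Finset.range (n + 1), Real.exp (η * k) *
      {b | (k : ℝ) - K1 ≤ gromovBdry p q b}.indicator (1 : Boundary X → ℝ) b ≤
      Real.exp (η * K1) * G * Real.exp (η * gromovBdry p q b) := by
    intro b
    have i0 := gromovBdry_nonneg p q b
    set g := gromovBdry p q b with hg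
    calc ∑ k ∈ Finset.range (n + 1), Real.exp (η * k) *
          {b | (k : ℝ) - K1 ≤ gromovBdry p q b}.indicator (1 : Boundary X → ℝ) b
        = ∑ k ∈ (Finset.range (n + 1)).filter (fun k : ℕ => (k : ℝ) ≤ g + K1),
          Real.exp (η * k) := by
          rw [Finset.sum_filter]
          refine Finset.sum_congr rfl fun k _ => ?_
          simp only [Set.indicator_apply, Set.mem_ofPred_eq, ← hg, Pi.one_apply, mul_ite, mul_one,
            mul_zero, sub_le_iff_le_add]
      _ ≤ ∑ k ∈ Finset.range (⌊g + K1⌋₊ + 1), Real.exp (η * k) := by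
          refine Finset.sum_le_sum_of_subset_of_nonneg (fun k hk => ?_)
            fun k _ _ => (Real.exp_pos _).le
          rw [Finset.mem_range, Nat.lt_succ_iff]
          exact Nat.le_floor (Finset.mem_filter.1 hk).2
      _ ≤ Real.exp (η * ⌊g + K1⌋₊) * G := sum_exp_mul_le hη _
      _ ≤ Real.exp (η * (g + K1)) * G := by
          gcongr; exact Nat.floor_le (by positivity)
      _ = _ := by rw [mul_add, Real.exp_add]; ring
  have hint : ∀ k ∈ Finset.range (n + 1), Integrable (fun b => Real.exp (η * k) *
      {b | (k : ℝ) - K1 ≤ gromovBdry p q b}.indicator (1 : Boundary X → ℝ) b) ν := fun k _ =>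
    ((integrable_const (1 : ℝ)).indicator (hmeas k)).const_mul _
  have hsum : ((n : ℝ) + 1) * c1 ≤ Real.exp (η * K1) * G *
      ∫ b, Real.exp (η * gromovBdry p q b) ∂ν := by
    calc ((n : ℝ) + 1) * c1 = (Finset.range (n + 1)).card • c1 := by
          rw [Finset.card_range, nsmul_eq_mul]; push_cast; ring
      _ ≤ ∑ k ∈ Finset.range (n + 1), Real.exp (η * k) *
          ν.real {b | (k : ℝ) - K1 ≤ gromovBdry p q b} := Finset.card_nsmul_le_sum _ _ _ hlow
      _ = ∫ b, ∑ k ∈ Finset.range (n + 1), Real.exp (η * k) *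
          {b | (k : ℝ) - K1 ≤ gromovBdry p q b}.indicator (1 : Boundary X → ℝ) b ∂ν := by
          rw [integral_finsetSum _ hint]
          refine Finset.sum_congr rfl fun k _ => ?_
          rw [integral_const_mul, integral_indicator_one (hmeas k)]
      _ ≤ ∫ b, Real.exp (η * K1) * G * Real.exp (η * gromovBdry p q b) ∂ν :=
          integral_mono (integrable_finsetSum _ hint)
            ((integrable_exp_gromovBdry hν q).const_mul _) hpt
      _ = _ := integral_const_mul _ _
  have hn1 : 1 + dist p q ≤ 2 * ((n : ℝ) + 1) := by
    have := Nat.lt_floor_add_one (dist p q)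
    have : (0 : ℝ) ≤ n := Nat.cast_nonneg n
    linarith
  rw [div_mul_eq_mul_div, div_le_iff₀ (by positivity)]
  nlinarith

/-- The averages over annuli are uniformly bounded. -/
theorem exists_average_le :
    ∃ C : ℝ, 0 ≤ C ∧ ∀ t : ℝ, 0 < t → ∀ S : Finset Γ, (∀ γ, γ ∈ S ↔ |dist (γ.1 p) p - t| < R) →
      ∀ b, (S.card : ℝ)⁻¹ * ∑ γ ∈ S, Real.exp (η * gromovBdry p (γ.1 p) b) /
        ∫ b, Real.exp (η * gromovBdry p (γ.1 p) b) ∂ν ≤ C := by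
  obtain ⟨c, hc, h1⟩ := exists_le_card_annulus hA hν
  obtain ⟨C, hC, h2⟩ := exists_sum_annulus_le hA hν
  obtain ⟨c', hc', h3⟩ := exists_le_integral hA hν
  have hR := hA.radius_nonneg
  refine ⟨c⁻¹ * (C * (1 + R) / c'), by positivity, fun t ht S hS b => ?_⟩
  have i1 := h1 t ht S (fun γ => (hS γ).2) (fun γ => (hS γ).1)
  have i2 := h2 t ht S (fun γ => (hS γ).1) b
  have hE := Real.exp_pos (η * t)
  have i3 : ∑ γ ∈ S, Real.exp (η * gromovBdry p (γ.1 p) b) /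
      ∫ b, Real.exp (η * gromovBdry p (γ.1 p) b) ∂ν ≤
      C * ((1 + t) * Real.exp (η * t)) / (c' * (1 + t) / (1 + R)) := by
    calc _ ≤ ∑ γ ∈ S, Real.exp (η * gromovBdry p (γ.1 p) b) / (c' * (1 + t) / (1 + R)) := by
          refine Finset.sum_le_sum fun γ hγ => ?_
          gcongr
          -- As `dist (γ p) p > t - R`, one has `(1 + R)(1 + dist (γ p) p) ≥ 1 + t`, including for
          -- `t < R`.
          refine le_trans ?_ (h3 (γ.1 p))
          rw [div_le_iff₀ (by positivity), mul_assoc]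
          gcongr
          have := (abs_lt.1 ((hS γ).1 hγ)).1
          have h0 := dist_nonneg (x := γ.1 p) (y := p)
          rw [dist_comm p]
          nlinarith
      _ = (∑ γ ∈ S, Real.exp (η * gromovBdry p (γ.1 p) b)) / (c' * (1 + t) / (1 + R)) := by
          rw [Finset.sum_div]
      _ ≤ _ := by gcongr
  have hcard : 0 < (S.card : ℝ) := lt_of_lt_of_le (by positivity) i1
  calc _ ≤ (c * Real.exp (η * t))⁻¹ *
        (C * ((1 + t) * Real.exp (η * t)) / (c' * (1 + t) / (1 + R))) := by
        gcongr
    _ = _ := by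
        have : 1 + t ≠ 0 := by positivity
        field_simp

end IsConformalMeasure

end Counting

end BoundaryRep

namespace BoundaryRep

/-! ### Conformality of the Hausdorff measure and reduction of the averages -/

section HausdorffConformal

variable {X : Type*} [MetricSpace X] {Γ : Subgroup (X ≃ₜ X)} {p : X} {R δ : ℝ}

lemma ofReal_exp_rpow (a s : ℝ) :
    ENNReal.ofReal (Real.exp a) ^ s = ENNReal.ofReal (Real.exp (s * a)) := by
  rw [ENNReal.ofReal_rpow_of_pos (Real.exp_pos _), ← Real.exp_mul, mul_comm]

lemma isometry_symm_of_isometry {γ : X ≃ₜ X} (hγ : Isometry γ) : Isometry γ.symm :=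
  (IsometryEquiv.mk γ.toEquiv hγ).symm.isometry

namespace IsCocompactAction

variable [ProperSpace X]

/-- The shadow is covered by the `γ`-image of the set where `(γ⁻¹p|a)_p ≤ K`, and there `γ` scales
`σ_p` by at most `e^{2K - d(γp,p)}`. -/
lemma hausdorffOuter_shadow_le (hA : IsCocompactAction Γ p R δ) {s : ℝ} (hs : 0 ≤ s) (K : ℝ)
    (γ : Γ) : hausdorffOuter (busemannDist p) s (shadow p K γ) ≤
      ENNReal.ofReal (Real.exp (s * (2 * K - dist (γ.1 p) p))) *
        hausdorffOuter (busemannDist p) s Set.univ := by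
  have hγ := hA.isometry γ.1 γ.2
  have hγ' := isometry_symm_of_isometry hγ
  have hsub : shadow p K γ ⊆
      Boundary.map γ.1 hγ '' {a | gromovBdry p (γ.1.symm p) a ≤ K} := by
    intro b hb
    have hb : dist (γ.1 p) p - K ≤ gromovBdry p (γ.1 p) b := hb
    refine ⟨b.map γ.1.symm hγ', ?_, Boundary.map_map_symm γ.1 hγ hγ' b⟩
    have h1 := gromovBdry_map p γ.1 hγ (b.map γ.1.symm hγ')
    rw [Boundary.map_map_symm] at h1
    change gromovBdry p (γ.1.symm p) _ ≤ K
    linarith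
  refine (measure_mono hsub).trans ?_
  refine (hausdorffOuter_image_le hs (L := ENNReal.ofReal (Real.exp (2 * K - dist (γ.1 p) p)))
    (ENNReal.ofReal_pos.2 (Real.exp_pos _)).ne' ENNReal.ofReal_ne_top ?_).trans ?_
  · intro b hb c hc
    rw [busemannDist_map hA.cat hA.nonneg hA.hyp, mul_comm]
    gcongr
    have hb : gromovBdry p (γ.1.symm p) b ≤ K := hb
    have hc : gromovBdry p (γ.1.symm p) c ≤ K := hc
    linarith
  · rw [ofReal_exp_rpow]
    gcongr
    exact Set.subset_univ _

/-- The shadow is pulled back by `γ⁻¹`, whose Lipschitz constant is at most `e^{d(γp,p)}` because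
each Gromov product in the conformal factor is at most `d(γp,p)`. -/
lemma hausdorffOuter_le_shadow (hA : IsCocompactAction Γ p R δ) {s : ℝ} (hs : 0 ≤ s) (K : ℝ)
    (γ : Γ) : hausdorffOuter (busemannDist p) s {a | gromovBdry p (γ.1.symm p) a ≤ K} ≤
      ENNReal.ofReal (Real.exp (s * dist (γ.1 p) p)) *
        hausdorffOuter (busemannDist p) s (shadow p K γ) := by
  have hγ := hA.isometry γ.1 γ.2
  have hγ' := isometry_symm_of_isometry hγ
  have hsub : {a | gromovBdry p (γ.1.symm p) a ≤ K} ⊆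
      Boundary.map γ.1.symm hγ' '' shadow p K γ := by
    intro a ha
    have ha : gromovBdry p (γ.1.symm p) a ≤ K := ha
    refine ⟨a.map γ.1 hγ, ?_, Boundary.map_map_symm γ.1.symm hγ' hγ a⟩
    have h1 := gromovBdry_map p γ.1 hγ a
    change dist (γ.1 p) p - K ≤ _
    linarith
  refine (measure_mono hsub).trans ?_
  refine (hausdorffOuter_image_le hs (L := ENNReal.ofReal (Real.exp (dist (γ.1 p) p)))
    (ENNReal.ofReal_pos.2 (Real.exp_pos _)).ne' ENNReal.ofReal_ne_top ?_).trans ?_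
  · intro b _ c _
    rw [busemannDist_map hA.cat hA.nonneg hA.hyp, mul_comm]
    gcongr
    have e1 : dist (γ.1.symm p) p = dist (γ.1 p) p := by
      rw [← hγ.dist_eq, γ.1.apply_symm_apply, dist_comm]
    have h1 := gromovBdry_le_dist p (γ.1 p) b
    have h2 := gromovBdry_le_dist p (γ.1 p) c
    rw [dist_comm] at h1 h2
    rw [e1]
    change -dist (γ.1 p) p + gromovBdry p (γ.1 p) b + gromovBdry p (γ.1 p) c ≤ _
    linarith
  · rw [ofReal_exp_rpow]

end IsCocompactAction

lemma hausdorff_apply {B : Type*} (σ : B → B → ℝ≥0∞) (s : ℝ) {A : Set B}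
    (hA : MeasurableSet[(hausdorffOuter σ s).caratheodory] A) :
    hausdorff σ s A = hausdorffOuter σ s A :=
  @toMeasure_apply B (hausdorffOuter σ s).caratheodory _ le_rfl A hA

/-- In negative dimensions, the Hausdorff measure of a nonempty space is infinite. -/
lemma hausdorffOuter_univ_of_neg {B : Type*} [Nonempty B] (σ : B → B → ℝ≥0∞) {s : ℝ} (hs : s < 0) :
    hausdorffOuter σ s Set.univ = ⊤ := by
  by_contra hne
  set K := hausdorffOuter σ s Set.univ + 1
  have hK : K ≠ ⊤ := ENNReal.add_ne_top.2 ⟨hne, ENNReal.one_ne_top⟩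
  have hK0 : K ≠ 0 := by simp [K]
  -- Here `r ^ s = K`. As `s < 0`, every nonempty set of diameter at most `r` costs at least `r ^
  -- s`, which exceeds the supposed total.
  set r := K ^ (1 / s)
  have hr : 0 < r := by
    rw [pos_iff_ne_zero, ne_eq, ENNReal.rpow_eq_zero_iff]
    rintro (h | h)
    · exact hK0 h.1
    · exact hK h.1
  have hrs : r ^ s = K := by
    rw [← ENNReal.rpow_mul, one_div, inv_mul_cancel₀ hs.ne, ENNReal.rpow_one]
  have h1 : r ^ s ≤ hausdorffPre σ s r Set.univ := by
    rw [hausdorffPre, OuterMeasure.boundedBy_apply]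
    refine le_iInf fun t => le_iInf fun ht => ?_
    obtain ⟨n, hn⟩ := Set.mem_iUnion.1 (ht (Set.mem_univ (Classical.arbitrary B)))
    refine le_trans ?_ (ENNReal.le_tsum n)
    rw [iSup_pos ⟨_, hn⟩]
    refine le_iInf fun hd => ?_
    rw [← neg_neg s, ENNReal.rpow_neg, ENNReal.rpow_neg (diamOf σ (t n))]
    exact ENNReal.inv_le_inv.2 (ENNReal.rpow_le_rpow hd (by linarith))
  have h2 := h1.trans (hausdorffPre_le hr Set.univ)
  rw [hrs] at h2
  exact absurd h2 (ENNReal.lt_add_right hne one_ne_zero).not_ge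

variable [ProperSpace X]

/-- If the total Hausdorff measure is positive and finite, then its normalization is conformal. -/
theorem IsCocompactAction.isConformalMeasure_nu (hA : IsCocompactAction Γ p R δ) {n : ℕ}
    (hη : 0 < critExp n p)
    (h0 : hausdorff (busemannDist p) (critExp n p) Set.univ ≠ 0)
    (htop : hausdorff (busemannDist p) (critExp n p) Set.univ ≠ ⊤) :
    IsConformalMeasure Γ p (critExp n p) (nu n p) := by
  set η := critExp n p
  set H := hausdorff (busemannDist p) η with hH
  have hmeas : ∀ q, @Measurable (Boundary X) ℝ
      (hausdorffOuter (busemannDist p) η).caratheodory _ (gromovBdry p q) := fun q =>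
    measurable_of_uniformContinuous fun ε hε =>
      exists_abs_gromovBdry_sub_le hA.cat hA.nonneg hA.hyp p q hε
  have hnu : nu n p = (H Set.univ)⁻¹ • H := rfl
  have huniv : H Set.univ = hausdorffOuter (busemannDist p) η Set.univ :=
    hausdorff_apply _ _ MeasurableSet.univ
  have hreal : ∀ A, MeasurableSet[(hausdorffOuter (busemannDist p) η).caratheodory] A →
      (nu n p).real A = ((H Set.univ)⁻¹ * hausdorffOuter (busemannDist p) η A).toReal := by
    intro A hAm
    rw [hnu, Measure.real, Measure.smul_apply, hH, hausdorff_apply _ _ hAm, smul_eq_mul]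
  have hfin : ∀ A, hausdorffOuter (busemannDist p) η A ≠ ⊤ := fun A =>
    ne_top_of_le_ne_top (huniv ▸ htop) (measure_mono (Set.subset_univ A))
  have hsh : ∀ K (γ : Γ), MeasurableSet[(hausdorffOuter (busemannDist p) η).caratheodory]
      (shadow p K γ) := fun K γ => measurableSet_le measurable_const (hmeas _)
  have hinv : (H Set.univ)⁻¹ ≠ ⊤ := ENNReal.inv_ne_top.2 h0
  refine ⟨hη, ⟨?_⟩, hmeas, fun γ K => ?_, fun γ K => ?_⟩
  · rw [hnu, Measure.smul_apply, smul_eq_mul, ENNReal.inv_mul_cancel h0 htop]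
  · rw [hreal _ (hsh K γ)]
    refine ENNReal.toReal_le_of_le_ofReal (Real.exp_pos _).le ?_
    calc _ ≤ (H Set.univ)⁻¹ * (ENNReal.ofReal (Real.exp (η * (2 * K - dist (γ.1 p) p))) *
          hausdorffOuter (busemannDist p) η Set.univ) := by
          gcongr; exact hA.hausdorffOuter_shadow_le hη.le K γ
      _ = ENNReal.ofReal (Real.exp (η * (2 * K - dist (γ.1 p) p))) *
          ((H Set.univ)⁻¹ * H Set.univ) := by rw [huniv]; ring
      _ = _ := by rw [ENNReal.inv_mul_cancel h0 htop, mul_one]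
  · rw [hreal _ (hsh K γ), hreal _ (measurableSet_le (hmeas _) measurable_const),
      ← ENNReal.toReal_ofReal (Real.exp_pos (-(η * dist (γ.1 p) p))).le, ← ENNReal.toReal_mul]
    refine ENNReal.toReal_mono (ENNReal.mul_ne_top hinv (hfin _)) ?_
    calc _ ≤ ENNReal.ofReal (Real.exp (-(η * dist (γ.1 p) p))) * ((H Set.univ)⁻¹ *
          (ENNReal.ofReal (Real.exp (η * dist (γ.1 p) p)) *
            hausdorffOuter (busemannDist p) η (shadow p K γ))) := by
          gcongr; exact hA.hausdorffOuter_le_shadow hη.le K γ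
      _ = (ENNReal.ofReal (Real.exp (-(η * dist (γ.1 p) p))) *
          ENNReal.ofReal (Real.exp (η * dist (γ.1 p) p))) *
          ((H Set.univ)⁻¹ * hausdorffOuter (busemannDist p) η (shadow p K γ)) := by ring
      _ = _ := by
          rw [← ENNReal.ofReal_mul (Real.exp_pos _).le, ← Real.exp_add, neg_add_cancel,
            Real.exp_zero, ENNReal.ofReal_one, one_mul]

lemma lam_eq (hX : IsGeodesic X) (n : ℕ) (p q : X) (b : Boundary X) :
    lam n p q b = Real.exp (-(1 / 2) * critExp n p * dist p q) *
      Real.exp (critExp n p * gromovBdry p q b) := by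
  rw [lam, busemann_eq hX, ← Real.exp_add]
  congr 1; ring

/-- The factor `e^{-ηd(p,q)/2}` is independent of `b` and cancels. -/
lemma lam_div_lamNorm (hX : IsGeodesic X) (n : ℕ) (p q : X) (b : Boundary X) :
    lam n p q b / lamNorm n p q = Real.exp (critExp n p * gromovBdry p q b) /
      ∫ b, Real.exp (critExp n p * gromovBdry p q b) ∂(nu n p) := by
  rw [lamNorm]
  simp_rw [lam_eq hX]
  rw [integral_const_mul, mul_div_mul_left _ _ (Real.exp_pos _).ne']

/-- The averages `avg` are uniformly bounded as soon as the action of the deck group is cocompact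
with constant the diameter of the base. -/
theorem exists_memLp_avg {M : Type*} [MetricSpace M] (n : ℕ) (pr : X → M)
    (hA : IsCocompactAction (deckGroup pr) p (Metric.diam (Set.univ : Set M)) δ) :
    ∃ C : ℝ≥0, ∀ t : ℝ, 0 < t → MemLp (avg n pr p t) ∞ (nu n p) ∧
      eLpNorm (avg n pr p t) ∞ (nu n p) ≤ C := by
  set η := critExp n p with hηdef
  have hnu : nu n p = (hausdorff (busemannDist p) η Set.univ)⁻¹ •
    hausdorff (busemannDist p) η := rfl
  -- This covers total Hausdorff measure `0`, and also `⊤`, since `⊤⁻¹ = 0` in the normalization.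
  have hzero : nu n p = 0 → ∃ C : ℝ≥0, ∀ t : ℝ, 0 < t → MemLp (avg n pr p t) ∞ (nu n p) ∧
      eLpNorm (avg n pr p t) ∞ (nu n p) ≤ C := by
    intro h
    rw [h]
    exact ⟨0, fun t _ => ⟨⟨aestronglyMeasurable_zero_measure _, by
      rw [eLpNorm_measure_zero]; exact ENNReal.zero_lt_top⟩, by
      rw [eLpNorm_measure_zero]; exact zero_le⟩⟩
  by_cases h0 : hausdorff (busemannDist p) η Set.univ = 0
  · refine hzero ?_
    rw [hnu, Measure.measure_univ_eq_zero.1 h0, smul_zero]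
  by_cases htop : hausdorff (busemannDist p) η Set.univ = ⊤
  · refine hzero ?_
    rw [hnu, htop, ENNReal.inv_top, zero_smul]
  have hfinite : ∀ t, (annulus pr p t).Finite := fun t =>
    (hA.finite (t + Metric.diam (Set.univ : Set M))).subset fun γ hγ => hγ.2.le
  have havg : ∀ t b, avg n pr p t b = (((hfinite t).toFinset).card : ℝ)⁻¹ *
      ∑ γ ∈ (hfinite t).toFinset, Real.exp (η * gromovBdry p (γ.1 p) b) /
        ∫ b, Real.exp (η * gromovBdry p (γ.1 p) b) ∂(nu n p) := by
    intro t b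
    rw [avg, Set.ncard_eq_toFinset_card _ (hfinite t), finsum_mem_eq_finite_toFinset_sum _ (hfinite t)]
    simp_rw [lam_div_lamNorm hA.cat.geodesic]
    rfl
  have hmeas : ∀ q, @Measurable (Boundary X) ℝ
      (hausdorffOuter (busemannDist p) η).caratheodory _ (gromovBdry p q) := fun q =>
    measurable_of_uniformContinuous fun ε hε =>
      exists_abs_gromovBdry_sub_le hA.cat hA.nonneg hA.hyp p q hε
  have hm : ∀ t, @Measurable (Boundary X) ℝ
      (hausdorffOuter (busemannDist p) η).caratheodory _ (avg n pr p t) := by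
    intro t
    have e : avg n pr p t = fun b => _ := funext (havg t)
    rw [e]
    refine Measurable.const_mul ?_ _
    refine Finset.measurable_fun_sum _ fun γ _ => ?_
    exact (Real.measurable_exp.comp ((hmeas _).const_mul η)).div_const _
  have hmem : ∀ t (γ : deckGroup pr), γ ∈ (hfinite t).toFinset ↔
      |dist (γ.1 p) p - t| < Metric.diam (Set.univ : Set M) := by
    intro t γ
    rw [Set.Finite.mem_toFinset, abs_lt]
    change _ ∧ _ ↔ _
    constructor <;> rintro ⟨h1, h2⟩ <;> constructor <;> linarith
  obtain ⟨C, hC, hbound⟩ : ∃ C : ℝ, 0 ≤ C ∧ ∀ t : ℝ, 0 < t → ∀ b, avg n pr p t b ≤ C := by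
    -- A negative dimension would give infinite mass, and in dimension `0` every normalized function
    -- is `1`; only `η > 0` needs the counting estimates.
    rcases lt_trichotomy η 0 with hη | hη | hη
    · exfalso
      have hne : Nonempty (Boundary X) := by
        by_contra hne
        rw [not_nonempty_iff] at hne
        exact h0 (by rw [Set.univ_eq_empty_iff.2 hne, measure_empty])
      exact htop ((hausdorff_apply _ _ MeasurableSet.univ).trans (hausdorffOuter_univ_of_neg _ hη))
    · refine ⟨1, zero_le_one, fun t _ b => ?_⟩
      have hprob : ∫ _ : Boundary X, (1 : ℝ) ∂(nu n p) = 1 := by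
        have : (nu n p).real Set.univ = 1 := by
          rw [hnu, Measure.real, Measure.smul_apply, smul_eq_mul, ENNReal.inv_mul_cancel h0 htop,
            ENNReal.toReal_one]
        rw [integral_const, this, one_smul]
      rw [havg]
      simp only [hη, zero_mul, Real.exp_zero, hprob, div_one, Finset.sum_const, nsmul_eq_mul,
        mul_one]
      exact inv_mul_le_one
    · obtain ⟨C, hC, h⟩ := (hA.isConformalMeasure_nu hη h0 htop).exists_average_le hA
      exact ⟨C, hC, fun t ht b => (havg t b).trans_le (h t ht _ (hmem t) b)⟩
  have hnonneg : ∀ t b, 0 ≤ avg n pr p t b := by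
    intro t b
    rw [havg]
    exact mul_nonneg (by positivity) (Finset.sum_nonneg fun γ _ =>
      div_nonneg (Real.exp_pos _).le (integral_nonneg fun _ => (Real.exp_pos _).le))
  refine ⟨⟨C, hC⟩, fun t ht => ?_⟩
  have hae : ∀ᵐ b ∂(nu n p), ‖avg n pr p t b‖ ≤ C := Eventually.of_forall fun b => by
    rw [Real.norm_eq_abs, abs_of_nonneg (hnonneg t b)]
    exact hbound t ht b
  refine ⟨memLp_top_of_bound (hm t).aestronglyMeasurable C hae, ?_⟩
  rw [eLpNorm_exponent_top]
  refine (eLpNormEssSup_le_of_ae_bound hae).trans_eq ?_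
  rw [ENNReal.ofReal, Real.toNNReal_of_nonneg hC]
  rfl

end HausdorffConformal

end BoundaryRep

namespace BoundaryRep

lemma isContinuousRiemannianBundle_of_isContMDiffRiemannianBundle {n : ℕ} {X : Type*}
    [MetricSpace X] [ChartedSpace (EuclideanSpace ℝ (Fin n)) X] [IsManifold (𝓡 n) ∞ X]
    [RiemannianBundle (fun x : X => TangentSpace (𝓡 n) x)]
    [h : IsContMDiffRiemannianBundle (𝓡 n) ∞ (EuclideanSpace ℝ (Fin n))
      (fun x : X => TangentSpace (𝓡 n) x)] :
    IsContinuousRiemannianBundle (EuclideanSpace ℝ (Fin n))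
      (fun x : X => TangentSpace (𝓡 n) x) := by
  obtain ⟨g, hg, h⟩ := h.exists_contMDiff
  exact ⟨⟨g, hg.continuous, h⟩⟩

/-! ### Distances and lengths of paths -/

section PathLength

variable {n : ℕ} {X : Type*} [MetricSpace X] [ChartedSpace (EuclideanSpace ℝ (Fin n)) X]
    [RiemannianBundle (fun x : X => TangentSpace (𝓡 n) x)] [IsRiemannianManifold (𝓡 n) X]

lemma edist_le_pathELength {γ : ℝ → X} {a b : ℝ} (hab : a ≤ b)
    (hγ : ContMDiffOn 𝓘(ℝ, ℝ) (𝓡 n) 1 γ (Set.Icc a b)) :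
    edist (γ a) (γ b) ≤ Manifold.pathELength (𝓡 n) γ a b := by
  rw [IsRiemannianManifold.out (I := 𝓡 n) (γ a) (γ b)]
  exact Manifold.riemannianEDist_le_pathELength hγ rfl rfl hab

lemma exists_pathELength_lt {x y : X} {l : ℝ≥0∞} (h : edist x y < l) :
    ∃ γ : ℝ → X, γ 0 = x ∧ γ 1 = y ∧ ContMDiff 𝓘(ℝ, ℝ) (𝓡 n) 1 γ ∧
      Manifold.pathELength (𝓡 n) γ 0 1 < l := by
  rw [IsRiemannianManifold.out (I := 𝓡 n) x y] at h
  obtain ⟨γ, h0, h1, hγ, hl, -⟩ :=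
    Manifold.exists_lt_locally_constant_of_riemannianEDist_lt h zero_lt_one
  exact ⟨γ, h0, h1, hγ, hl⟩

end PathLength

/-! ### Riemannian manifolds are almost Euclidean at small scale -/

section NearEuclidean

variable {n : ℕ} {X : Type*} [MetricSpace X] [ChartedSpace (EuclideanSpace ℝ (Fin n)) X]
    [IsManifold (𝓡 n) 1 X] [RiemannianBundle (fun x : X => TangentSpace (𝓡 n) x)]
    [IsContinuousRiemannianBundle (EuclideanSpace ℝ (Fin n)) (fun x : X => TangentSpace (𝓡 n) x)]

/-- The inverse at `w` of the preferred chart of the tangent bundle at `w`. -/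
noncomputable def frameAt (n : ℕ) {X : Type*} [MetricSpace X]
    [ChartedSpace (EuclideanSpace ℝ (Fin n)) X] [IsManifold (𝓡 n) 1 X] (w : X) :
    EuclideanSpace ℝ (Fin n) →L[ℝ] TangentSpace (𝓡 n) w :=
  (trivializationAt (EuclideanSpace ℝ (Fin n)) (TangentSpace (𝓡 n)) w).symmL ℝ w

/-- At `y = w` the composite is the identity of the tangent space, and continuity of the metric
keeps its norm below `r` nearby. -/
lemma eventually_norm_frameAt_mfderiv_le (w : X) {r : ℝ} (hr : 1 < r) :
    ∀ᶠ y in 𝓝 w, ∀ v : TangentSpace (𝓡 n) y,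
      ‖frameAt n w (mfderiv (𝓡 n) 𝓘(ℝ, EuclideanSpace ℝ (Fin n)) (extChartAt (𝓡 n) w) y v)‖
        ≤ r * ‖v‖ := by
  filter_upwards [eventually_norm_symmL_trivializationAt_self_comp_lt (EuclideanSpace ℝ (Fin n))
    (fun x : X => TangentSpace (𝓡 n) x) w hr,
    chart_source_mem_nhds (EuclideanSpace ℝ (Fin n)) w] with y hy hy' v
  have h := (ContinuousLinearMap.le_opNorm
    (((trivializationAt (EuclideanSpace ℝ (Fin n)) (fun x : X => TangentSpace (𝓡 n) x) w).symmL ℝ w)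
      ∘L ((trivializationAt (EuclideanSpace ℝ (Fin n)) (fun x : X => TangentSpace (𝓡 n) x)
        w).continuousLinearMapAt ℝ y)) v).trans
    (mul_le_mul_of_nonneg_right hy.le (norm_nonneg v))
  rw [ContinuousLinearMap.comp_apply,
    TangentBundle.continuousLinearMapAt_trivializationAt hy'] at h
  exact h

lemma eventually_norm_mfderiv_symm_le (w : X) {r : ℝ} (hr : 1 < r) :
    ∀ᶠ z in 𝓝 (extChartAt (𝓡 n) w w), ∀ v : EuclideanSpace ℝ (Fin n),
      ‖(mfderiv 𝓘(ℝ, EuclideanSpace ℝ (Fin n)) (𝓡 n) (extChartAt (𝓡 n) w).symm z v :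
        TangentSpace (𝓡 n) ((extChartAt (𝓡 n) w).symm z))‖ ≤ r * ‖frameAt n w v‖ := by
  have h0 := (eventually_norm_symmL_trivializationAt_comp_self_lt (EuclideanSpace ℝ (Fin n))
    (fun x : X => TangentSpace (𝓡 n) x) w hr).and
    (chart_source_mem_nhds (EuclideanSpace ℝ (Fin n)) w)
  rw [← extChartAt_to_inv (I := 𝓡 n) w] at h0
  filter_upwards [(continuousAt_extChartAt_symm w).eventually h0,
    extChartAt_target_mem_nhds w] with z hz htz v
  obtain ⟨hy, hy'⟩ := hz
  rw [extChartAt_to_inv] at hy hy'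
  have h := (ContinuousLinearMap.le_opNorm _ (frameAt n w v)).trans
    (mul_le_mul_of_nonneg_right hy.le (norm_nonneg (frameAt n w v)))
  have e : (trivializationAt (EuclideanSpace ℝ (Fin n)) (TangentSpace (𝓡 n)) w).continuousLinearMapAt
      ℝ w (frameAt n w v) = v :=
    Trivialization.continuousLinearMapAt_symmL _ (mem_chart_source _ w) v
  rw [ContinuousLinearMap.comp_apply, e, TangentBundle.symmL_trivializationAt hy',
    (extChartAt (𝓡 n) w).right_inv htz, modelWithCornersSelf_coe, Set.range_id,
    mfderivWithin_univ] at h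
  exact h

variable [IsRiemannianManifold (𝓡 n) X]

/-- The straight segment in the chart is a competing path, and the inverse chart stretches lengths
by at most `r`. -/
lemma eventually_dist_le_norm_frameAt (w : X) {r : ℝ} (hr : 1 < r) :
    ∀ᶠ x in 𝓝 w, dist w x ≤
      r * ‖frameAt n w (extChartAt (𝓡 n) w x - extChartAt (𝓡 n) w w)‖ := by
  have hr0 : 0 < r := zero_lt_one.trans hr
  obtain ⟨s, hs, hball⟩ := Metric.eventually_nhds_iff_ball.1
    ((eventually_norm_mfderiv_symm_le (n := n) w hr).and
      (eventually_mem_nhds_iff.2 (extChartAt_target_mem_nhds (I := 𝓡 n) w)))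
  filter_upwards [(continuousAt_extChartAt (I := 𝓡 n) w).eventually (Metric.ball_mem_nhds _ hs),
    extChartAt_source_mem_nhds (I := 𝓡 n) w] with x hx hxs
  set z := extChartAt (𝓡 n) w w with hz
  set a := extChartAt (𝓡 n) w x - z with ha
  let η : ℝ → EuclideanSpace ℝ (Fin n) := fun t => z + t • a
  have hη : ∀ t, HasFDerivAt η (ContinuousLinearMap.toSpanSingleton ℝ a) t := fun t =>
    ((ContinuousLinearMap.toSpanSingleton ℝ a).hasFDerivAt).const_add z
  have hηball : ∀ t ∈ Set.Icc (0 : ℝ) 1, η t ∈ Metric.ball z s := by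
    intro t ht
    rw [Metric.mem_ball, dist_eq_norm, ← ha] at *
    have : η t - z = t • a := by simp [η]
    rw [this, norm_smul, Real.norm_of_nonneg ht.1]
    exact (mul_le_of_le_one_left (norm_nonneg _) ht.2).trans_lt hx
  set γ : ℝ → X := (extChartAt (𝓡 n) w).symm ∘ η
  have hγ0 : γ 0 = w := by simp [γ, η, hz]
  have hγ1 : γ 1 = x := by
    simp only [γ, η, Function.comp_apply, one_smul, ha, add_sub_cancel]
    exact (extChartAt (𝓡 n) w).left_inv hxs
  have hsm : ContMDiffOn 𝓘(ℝ, ℝ) (𝓡 n) 1 γ (Set.Icc 0 1) := by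
    refine (contMDiffOn_extChartAt_symm w).comp (ContMDiff.contMDiffOn ?_)
      (fun t ht => Set.mem_preimage.2 (mem_of_mem_nhds (hball _ (hηball t ht)).2))
    rw [contMDiff_iff_contDiff]
    exact contDiff_const.add (contDiff_id.smul contDiff_const)
  have hlen : Manifold.pathELength (𝓡 n) γ 0 1 ≤ ENNReal.ofReal (r * ‖frameAt n w a‖) := by
    rw [Manifold.pathELength_eq_lintegral_mfderiv_Icc]
    have : ∀ t ∈ Set.Icc (0 : ℝ) 1, ‖(mfderiv 𝓘(ℝ, ℝ) (𝓡 n) γ t 1 : TangentSpace (𝓡 n) (γ t))‖ₑ ≤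
        ENNReal.ofReal (r * ‖frameAt n w a‖) := by
      intro t ht
      have h1 : MDifferentiableAt 𝓘(ℝ, EuclideanSpace ℝ (Fin n)) (𝓡 n)
          (extChartAt (𝓡 n) w).symm (η t) :=
        ((contMDiffOn_extChartAt_symm (n := 1) w).contMDiffAt
          (hball _ (hηball t ht)).2).mdifferentiableAt one_ne_zero
      have h2 := h1.hasMFDerivAt.comp t (hη t).hasMFDerivAt
      rw [h2.mfderiv]
      have h3 := (hball _ (hηball t ht)).1 a
      rw [← ofReal_norm]
      refine ENNReal.ofReal_le_ofReal ?_
      refine le_trans (le_of_eq ?_) h3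
      change ‖(mfderiv 𝓘(ℝ, EuclideanSpace ℝ (Fin n)) (𝓡 n) (extChartAt (𝓡 n) w).symm (η t)
        ((1 : ℝ) • a) : TangentSpace (𝓡 n) ((extChartAt (𝓡 n) w).symm (η t)))‖ = _
      rw [one_smul]
    refine (setLIntegral_mono' measurableSet_Icc this).trans ?_
    simp
  have h := (edist_le_pathELength zero_le_one hsm).trans hlen
  rw [hγ0, hγ1, edist_dist] at h
  exact (ENNReal.ofReal_le_ofReal_iff (by positivity)).1 h

/-- Integrate the derivative of the chart, read in the tangent space at `w`, along an almost
shortest path. -/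
lemma exists_norm_frameAt_sub_le (w : X) {r : ℝ} (hr : 1 < r) :
    ∃ ρ > 0, ∀ x ∈ Metric.ball w ρ, ∀ y ∈ Metric.ball w ρ,
      ‖frameAt n w (extChartAt (𝓡 n) w y - extChartAt (𝓡 n) w x)‖ ≤ r * dist x y := by
  have hr0 : 0 < r := zero_lt_one.trans hr
  obtain ⟨s, hs, hball⟩ := Metric.eventually_nhds_iff_ball.1
    ((eventually_norm_frameAt_mfderiv_le (n := n) w hr).and
      (chart_source_mem_nhds (EuclideanSpace ℝ (Fin n)) w))
  -- With both ends in the ball of radius `s / 3`, a path shorter than `2s / 3` stays in the ball of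
  -- radius `s` where the derivative bound holds.
  refine ⟨s / 3, by positivity, fun x hx y hy => ?_⟩
  have hxy : dist x y < 2 * (s / 3) := by
    have := dist_triangle_right x y w
    rw [Metric.mem_ball] at hx hy
    linarith
  have key : ∀ l, dist x y < l → l < 2 * (s / 3) →
      ‖frameAt n w (extChartAt (𝓡 n) w y - extChartAt (𝓡 n) w x)‖ ≤ r * l := by
    intro l hl hls
    have hl0 : 0 < l := dist_nonneg.trans_lt hl
    obtain ⟨γ, h0, h1, hγ, hlen⟩ := exists_pathELength_lt (n := n) (x := x) (y := y)
      (l := ENNReal.ofReal l) (by rw [edist_dist]; exact (ENNReal.ofReal_lt_ofReal_iff hl0).2 hl)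
    have hmem : ∀ t ∈ Set.Icc (0 : ℝ) 1, γ t ∈ Metric.ball w s := by
      intro t ht
      have h2 := (edist_le_pathELength ht.1 (hγ.contMDiffOn (s := Set.Icc 0 t))).trans_lt
        ((Manifold.pathELength_mono le_rfl ht.2).trans_lt hlen)
      rw [h0, edist_dist, ENNReal.ofReal_lt_ofReal_iff hl0] at h2
      have := dist_triangle_left (γ t) w x
      rw [Metric.mem_ball] at hx ⊢
      linarith
    let f : ℝ → TangentSpace (𝓡 n) w := fun t => frameAt n w (extChartAt (𝓡 n) w (γ t))
    have hsm : ContDiffOn ℝ 1 f (Set.Icc 0 1) := by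
      have : ContMDiffOn 𝓘(ℝ, ℝ) 𝓘(ℝ, EuclideanSpace ℝ (Fin n)) 1 (extChartAt (𝓡 n) w ∘ γ)
          (Set.Icc 0 1) :=
        (contMDiffOn_extChartAt (n := 1)).comp hγ.contMDiffOn
          (fun t ht => (hball _ (hmem t ht)).2)
      exact (frameAt n w).contDiff.comp_contDiffOn (contMDiffOn_iff_contDiffOn.1 this)
    have h3 := enorm_sub_le_lintegral_derivWithin_Icc_of_contDiffOn_Icc hsm zero_le_one
    have h4 : ∀ t ∈ Set.Icc (0 : ℝ) 1, ‖derivWithin f (Set.Icc 0 1) t‖ₑ ≤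
        ENNReal.ofReal r * ‖(mfderiv 𝓘(ℝ, ℝ) (𝓡 n) γ t 1 : TangentSpace (𝓡 n) (γ t))‖ₑ := by
      intro t ht
      obtain ⟨hb1, hb2⟩ := hball _ (hmem t ht)
      have h5 := (mdifferentiableAt_extChartAt (I := 𝓡 n) hb2).hasMFDerivAt.comp t
        ((hγ.mdifferentiable one_ne_zero) t).hasMFDerivAt
      have h6 := ((frameAt n w).hasFDerivAt.comp t h5.hasFDerivAt).hasDerivAt
      have h8 : derivWithin f (Set.Icc 0 1) t = _ :=
        h6.hasDerivWithinAt.derivWithin (uniqueDiffOn_Icc zero_lt_one t ht)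
      rw [h8, ← ofReal_norm, ← ofReal_norm, ← ENNReal.ofReal_mul hr0.le]
      exact ENNReal.ofReal_le_ofReal (hb1 _)
    have h7 : ‖f 1 - f 0‖ₑ ≤ ENNReal.ofReal (r * l) := by
      refine h3.trans ((setLIntegral_mono' measurableSet_Icc h4).trans ?_)
      rw [lintegral_const_mul' _ _ ENNReal.ofReal_ne_top,
        ← Manifold.pathELength_eq_lintegral_mfderiv_Icc, ENNReal.ofReal_mul hr0.le]
      gcongr
    rw [← ofReal_norm, ENNReal.ofReal_le_ofReal_iff (by positivity)] at h7
    rw [map_sub, ← h0, ← h1]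
    exact h7
  refine le_of_forall_gt_imp_ge_of_dense fun c hc => ?_
  have hc' : dist x y < c / r := by rwa [lt_div_iff₀' hr0]
  obtain ⟨l, hl1, hl2⟩ := exists_between (lt_min hc' hxy)
  have := key l hl1 (hl2.trans_le (min_le_right _ _))
  refine this.trans ?_
  rw [← le_div_iff₀' hr0]
  exact (hl2.trans_le (min_le_left _ _)).le

/-- Riemannian manifolds are infinitesimally Euclidean: almost opposite points exist. -/
theorem hasOppositePoints (n : ℕ) (X : Type*) [MetricSpace X]
    [ChartedSpace (EuclideanSpace ℝ (Fin n)) X]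
    [IsManifold (𝓡 n) 1 X] [RiemannianBundle (fun x : X => TangentSpace (𝓡 n) x)]
    [IsContinuousRiemannianBundle (EuclideanSpace ℝ (Fin n)) (fun x : X => TangentSpace (𝓡 n) x)]
    [IsRiemannianManifold (𝓡 n) X] : HasOppositePoints X := by
  intro w ε hε
  -- With distortion `q`, the reflected point `v` has `dist v w ≤ q² r` and `dist v m ≥ 2r / q²`;
  -- the last condition on `q` compares these as required.
  obtain ⟨q, hq1, hq2, hq3⟩ : ∃ q : ℝ, 1 < q ∧ q ^ 2 ≤ 2 ∧ 1 + q ^ 2 - ε ≤ 2 / q ^ 2 := by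
    have h1 : Tendsto (fun q : ℝ => q ^ 2) (𝓝[>] 1) (𝓝 (1 ^ 2)) :=
      ((continuous_pow 2).tendsto 1).mono_left nhdsWithin_le_nhds
    have h2 : Tendsto (fun q : ℝ => 2 / q ^ 2 - q ^ 2) (𝓝[>] 1) (𝓝 (2 / 1 ^ 2 - 1 ^ 2)) :=
      (tendsto_const_nhds.div h1 (by norm_num)).sub h1
    have h3 : ∀ᶠ q in 𝓝[>] (1 : ℝ), 1 < q := self_mem_nhdsWithin
    obtain ⟨q, ⟨hq1, hq2⟩, hq3⟩ := ((h3.and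
      (h1.eventually (eventually_le_nhds (show (1 : ℝ) ^ 2 < 2 by norm_num)))).and
      (h2.eventually (eventually_ge_nhds (show 1 - ε < (2 : ℝ) / 1 ^ 2 - 1 ^ 2 by linarith)))).exists
    exact ⟨q, hq1, hq2, by linarith⟩
  have hq0 : 0 < q := zero_lt_one.trans hq1
  obtain ⟨ρ, hρ, hlow⟩ := exists_norm_frameAt_sub_le (n := n) w hq1
  set φ := extChartAt (𝓡 n) w with hφ
  -- the point opposite to `m` in the chart
  let opp : X → X := fun m => φ.symm (φ w - (φ m - φ w))
  have hcont : Tendsto (fun m => φ w - (φ m - φ w)) (𝓝 w) (𝓝 (φ w)) := by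
    have h := (continuousAt_extChartAt (I := 𝓡 n) w).tendsto
    have h2 := (tendsto_const_nhds (x := φ w)).sub (h.sub (tendsto_const_nhds (x := φ w)))
    rwa [sub_self, sub_zero] at h2
  have hopp : Tendsto opp (𝓝 w) (𝓝 w) := by
    have h := (continuousAt_extChartAt_symm (I := 𝓡 n) w).tendsto
    rw [extChartAt_to_inv] at h
    exact h.comp hcont
  have hup := eventually_dist_le_norm_frameAt (n := n) w hq1
  have hev : ∀ᶠ m in 𝓝 w, (dist w (opp m) ≤ q * ‖frameAt n w (φ (opp m) - φ w)‖ ∧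
      dist w m ≤ q * ‖frameAt n w (φ m - φ w)‖) ∧ (opp m ∈ Metric.ball w ρ ∧ m ∈ Metric.ball w ρ) ∧
      φ w - (φ m - φ w) ∈ φ.target :=
    ((hopp.eventually hup).and hup).and (((hopp.eventually (Metric.ball_mem_nhds w hρ)).and
      (Metric.ball_mem_nhds w hρ)).and (hcont.eventually (extChartAt_target_mem_nhds w)))
  obtain ⟨s, hs, hball⟩ := Metric.eventually_nhds_iff_ball.1 hev
  filter_upwards [Ioo_mem_nhdsGT hs] with r hr m hm
  obtain ⟨⟨h1, h2⟩, ⟨h3, h4⟩, h5⟩ := hball m (by rw [Metric.mem_ball, hm]; exact hr.2)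
  have e : φ (opp m) = φ w - (φ m - φ w) := φ.right_inv h5
  have l1 := hlow w (Metric.mem_ball_self hρ) (opp m) h3
  have l2 := hlow w (Metric.mem_ball_self hρ) m h4
  have l3 := hlow (opp m) h3 m h4
  have e1 : φ (opp m) - φ w = -(φ m - φ w) := by rw [e]; abel
  have e2 : φ m - φ (opp m) = (2 : ℝ) • (φ m - φ w) := by rw [e, two_smul]; abel
  rw [e1, map_neg, norm_neg] at h1 l1
  rw [e2, map_smul, norm_smul, Real.norm_ofNat] at l3
  set N := ‖frameAt n w (φ m - φ w)‖
  have hwm : dist w m = r := by rw [dist_comm, hm]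
  rw [hwm] at h2 l2
  have hr0 := hr.1
  have u1 : dist w (opp m) ≤ q ^ 2 * r := by
    calc _ ≤ q * N := h1
      _ ≤ q * (q * r) := by gcongr
      _ = _ := by ring
  have u2 : r ≤ q ^ 2 * dist w (opp m) := by
    calc _ ≤ q * N := h2
      _ ≤ q * (q * dist w (opp m)) := by gcongr
      _ = _ := by ring
  have u3 : 2 * r ≤ q ^ 2 * dist (opp m) m := by
    calc 2 * r ≤ q * (2 * N) := by linarith
      _ ≤ q * (q * dist (opp m) m) := by gcongr
      _ = _ := by ring
  have hd := dist_nonneg (x := w) (y := opp m)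
  refine ⟨opp m, ?_, ?_, ?_⟩
  · rw [dist_comm]; nlinarith
  · rw [dist_comm]; nlinarith
  · rw [dist_comm (opp m) w]
    have h6 : 2 / q ^ 2 * r ≤ dist (opp m) m := by
      rw [div_mul_eq_mul_div, div_le_iff₀ (by positivity)]
      linarith
    have h7 : (1 + q ^ 2 - ε) * r ≤ 2 / q ^ 2 * r := by gcongr
    linarith

end NearEuclidean

/-! ### Connected punctured neighbourhoods -/

section PuncturedNhds

/-- In dimension at least two, points have arbitrarily small connected punctured neighborhoods. -/
theorem hasConnectedPuncturedNhds (n : ℕ) (X : Type*) [MetricSpace X]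
    [ChartedSpace (EuclideanSpace ℝ (Fin n)) X] (hn : 2 ≤ n) : HasConnectedPuncturedNhds X := by
  intro y U hU
  set φ := chartAt (EuclideanSpace ℝ (Fin n)) y with hφ
  have hy : y ∈ φ.source := mem_chart_source _ y
  have hV : φ.target ∩ φ.symm ⁻¹' U ∈ 𝓝 (φ y) := by
    refine inter_mem (φ.open_target.mem_nhds (φ.map_source hy)) ?_
    refine (φ.continuousAt_symm (φ.map_source hy)).preimage_mem_nhds ?_
    rwa [φ.left_inv hy]
  obtain ⟨s, hs, hball⟩ := Metric.mem_nhds_iff.1 hV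
  have hconn : IsPreconnected (Metric.ball (φ y) s \ {φ y}) := by
    have hrank : 1 < Module.rank ℝ (EuclideanSpace ℝ (Fin n)) := by
      rw [← Module.finrank_eq_rank, finrank_euclideanSpace_fin]
      exact_mod_cast hn
    -- The punctured ball is homeomorphic to the punctured Euclidean space, which is connected in
    -- dimension at least two.
    set ψ := OpenPartialHomeomorph.univBall (φ y) s
    have h0 : ψ 0 = φ y := OpenPartialHomeomorph.univBall_apply_zero _ _
    have h1 : ψ.target = Metric.ball (φ y) s := OpenPartialHomeomorph.univBall_target _ hs
    have h2 : ψ.source = Set.univ := OpenPartialHomeomorph.univBall_source _ _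
    have h3 : Metric.ball (φ y) s \ {φ y} = ψ '' {0}ᶜ := by
      have h4 := ψ.image_source_eq_target
      have h5 := ψ.injOn
      rw [h2] at h4 h5
      rw [Set.compl_eq_univ_sdiff, Set.image_sdiff (Set.injOn_univ.1 h5), h4, h1, Set.image_singleton,
        h0]
    rw [h3]
    exact (isConnected_compl_singleton_of_one_lt_rank hrank 0).isPreconnected.image _
      (ψ.continuousOn.mono (by rw [h2]; exact Set.subset_univ _))
  refine ⟨φ.symm '' (Metric.ball (φ y) s \ {φ y}), ?_, ?_, ?_, ?_⟩
  · rintro _ ⟨z, hz, rfl⟩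
    exact (hball hz.1).2
  · exact hconn.image _ (φ.continuousOn_symm.mono fun z hz => (hball hz.1).1)
  · rw [mem_nhdsWithin_iff_eventually]
    have h1 := (φ.continuousAt hy).eventually (Metric.ball_mem_nhds _ hs)
    filter_upwards [h1, φ.open_source.mem_nhds hy] with x hx hxs hne
    exact ⟨φ x, ⟨hx, fun h => hne (φ.injOn hxs hy h)⟩, φ.left_inv hxs⟩
  · rintro ⟨z, hz, hzy⟩
    refine hz.2 ?_
    rw [Set.mem_singleton_iff, ← hzy, φ.right_inv (hball hz.1).1]

end PuncturedNhds
end BoundaryRep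

/-! ### Deck transformations: transitivity, isometry, properness and cocompactness -/

namespace BoundaryRep

lemma deckGroup_apply {M X : Type*} [TopologicalSpace X] {pr : X → M} {γ : X ≃ₜ X}
    (hγ : γ ∈ deckGroup pr) (x : X) : pr (γ x) = pr x := hγ x

/-- The deck group of a simply connected covering acts transitively on the fibers. -/
lemma exists_mem_deckGroup_apply_eq {M X : Type*} [TopologicalSpace M] [TopologicalSpace X]
    [SimplyConnectedSpace X] [LocallyPathConnectedSpace X] {pr : X → M} (hpr : IsCoveringMap pr)
    {x y : X} (h : pr x = pr y) : ∃ γ ∈ deckGroup pr, γ x = y := by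
  -- Lifting `pr` through itself in both directions gives maps that are mutually inverse by
  -- uniqueness of lifts.
  obtain ⟨F, ⟨hF, hFp⟩, -⟩ :=
    hpr.existsUnique_continuousMap_lifts ⟨pr, hpr.continuous⟩ x y h.symm
  obtain ⟨G, ⟨hG, hGp⟩, -⟩ :=
    hpr.existsUnique_continuousMap_lifts ⟨pr, hpr.continuous⟩ y x h
  have hF' : ∀ z, pr (F z) = pr z := fun z => congrFun hFp z
  have hG' : ∀ z, pr (G z) = pr z := fun z => congrFun hGp z
  have h1 : G ∘ F = id := hpr.eq_of_comp_eq (G.continuous.comp F.continuous) continuous_id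
    (funext fun z => (hG' _).trans (hF' z)) x (by simp [hF, hG])
  have h2 : F ∘ G = id := hpr.eq_of_comp_eq (F.continuous.comp G.continuous) continuous_id
    (funext fun z => (hF' _).trans (hG' z)) y (by simp [hF, hG])
  exact ⟨⟨⟨F, G, congrFun h1, congrFun h2⟩, F.continuous, G.continuous⟩, hF', hF⟩

/-- A geodesic space in which all balls of a given radius are compact is proper. -/
lemma IsGeodesic.properSpace {X : Type*} [MetricSpace X] (hX : IsGeodesic X) {ε : ℝ} (hε : 0 < ε)
    (h : ∀ x : X, IsCompact (Metric.closedBall x ε)) : ProperSpace X := by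
  -- Steps of `ε / 2` let a finite `ε / 2`-net of one ball cover the next one by compact balls of
  -- radius `ε`.
  have key : ∀ (x : X) (k : ℕ), IsCompact (Metric.closedBall x (k * (ε / 2))) := by
    intro x k
    induction k with
    | zero => simp
    | succ k ih =>
      obtain ⟨t, -, ht⟩ := ih.elim_nhds_subcover (fun y => Metric.ball y (ε / 2))
        (fun y _ => Metric.ball_mem_nhds y (by positivity))
      refine (t.isCompact_biUnion fun y _ => h y).of_isClosed_subset Metric.isClosed_closedBall ?_
      intro z hz
      obtain ⟨u, hu1, hu2⟩ : ∃ u, dist x u ≤ k * (ε / 2) ∧ dist u z ≤ ε / 2 := by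
        rw [Metric.mem_closedBall, dist_comm] at hz
        push_cast at hz
        rcases le_total (dist x z) (k * (ε / 2)) with hle | hle
        · exact ⟨z, hle, by rw [dist_self]; positivity⟩
        · obtain ⟨u, hu, hxu⟩ := hX.exists_between x z (s := k * (ε / 2)) (by positivity) hle
          refine ⟨u, hxu.le, ?_⟩
          unfold Between at hu
          linarith
      obtain ⟨y, hy, huy⟩ := Set.mem_iUnion₂.1 (ht (Metric.mem_closedBall'.2 hu1))
      refine Set.mem_iUnion₂.2 ⟨y, hy, ?_⟩
      rw [Metric.mem_closedBall, dist_comm]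
      rw [Metric.mem_ball, dist_comm] at huy
      linarith [dist_triangle y u z]
  refine ⟨fun x r => ?_⟩
  obtain ⟨k, hk⟩ := exists_nat_ge (r / (ε / 2))
  refine (key x k).of_isClosed_subset Metric.isClosed_closedBall
    (Metric.closedBall_subset_closedBall ?_)
  rwa [div_le_iff₀ (by positivity)] at hk

namespace IsRiemannianUniversalCover

variable {n : ℕ} {M X : Type*}
    [MetricSpace M] [ChartedSpace (EuclideanSpace ℝ (Fin n)) M]
    [RiemannianBundle (fun x : M => TangentSpace (𝓡 n) x)]
    [MetricSpace X] [ChartedSpace (EuclideanSpace ℝ (Fin n)) X]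
    [RiemannianBundle (fun x : X => TangentSpace (𝓡 n) x)] {pr : X → M}

lemma contMDiffOn_of_comp (hpr : IsRiemannianUniversalCover n pr) {c : ℝ → X} {s : Set ℝ}
    (hc : ContinuousOn c s) (hpc : ContMDiffOn 𝓘(ℝ, ℝ) (𝓡 n) 1 (pr ∘ c) s) :
    ContMDiffOn 𝓘(ℝ, ℝ) (𝓡 n) 1 c s := by
  intro t ht
  have hloc := hpr.isLocalDiffeomorph (c t)
  have h1 : ContMDiffAt (𝓡 n) (𝓡 n) 1 hloc.localInverse ((pr ∘ c) t) :=
    hloc.localInverse_contMDiffAt.of_le (by norm_num)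
  refine (h1.comp_contMDiffWithinAt t (hpc t ht)).congr_of_eventuallyEq ?_
    (hloc.localInverse_left_inv hloc.localInverse_mem_target).symm
  filter_upwards [(hc t ht).eventually
    (hloc.localInverse.open_target.mem_nhds hloc.localInverse_mem_target)] with u hu
  exact (hloc.localInverse_left_inv hu).symm

lemma pathELength_comp (hpr : IsRiemannianUniversalCover n pr) {c : ℝ → X} {a b : ℝ} (hab : a < b)
    (hc : ContMDiffOn 𝓘(ℝ, ℝ) (𝓡 n) 1 c (Set.Icc a b)) :
    Manifold.pathELength (𝓡 n) (pr ∘ c) a b = Manifold.pathELength (𝓡 n) c a b := by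
  rw [Manifold.pathELength_eq_lintegral_mfderivWithin_Icc,
    Manifold.pathELength_eq_lintegral_mfderivWithin_Icc]
  refine setLIntegral_congr_fun measurableSet_Icc fun t ht => ?_
  have h1 := (hpr.isLocalDiffeomorph.mdifferentiable (by simp) (c t)).hasMFDerivAt
  have h2 := (hc.mdifferentiableOn one_ne_zero t ht).hasMFDerivWithinAt
  have h3 := (h1.comp_hasMFDerivWithinAt t h2).mfderivWithin
    (uniqueMDiffWithinAt_iff_uniqueDiffWithinAt.2 (uniqueDiffOn_Icc hab t ht))
  have h4 := hpr.norm_mfderiv (c t) (mfderivWithin 𝓘(ℝ, ℝ) (𝓡 n) c (Set.Icc a b) t 1)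
  rw [h3, ← ofReal_norm, ← ofReal_norm]
  exact congrArg ENNReal.ofReal h4

lemma exists_deck (hpr : IsRiemannianUniversalCover n pr) {x y : X} (h : pr x = pr y) :
    ∃ γ ∈ deckGroup pr, γ x = y := by
  have := hpr.simplyConnected
  have : LocallyPathConnectedSpace X :=
    ChartedSpace.locallyPathConnectedSpace (EuclideanSpace ℝ (Fin n)) X
  exact exists_mem_deckGroup_apply_eq hpr.isCoveringMap h

/-- The fiber of `pr p` is closed and discrete, so it meets a compact ball in a finite set; a deck
transformation is determined by the image of one point. -/
lemma finite_deck [ProperSpace X] (hpr : IsRiemannianUniversalCover n pr) (p x : X) (r : ℝ) :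
    {γ : deckGroup pr | dist (γ.1 p) x ≤ r}.Finite := by
  have := hpr.simplyConnected
  have hfib : (pr ⁻¹' {pr p} ∩ Metric.closedBall x r).Finite := by
    refine IsCompact.finite (((isCompact_closedBall x r).inter_left
      (isClosed_singleton.preimage hpr.isCoveringMap.continuous))) ?_
    have : IsDiscrete (pr ⁻¹' {pr p}) := ⟨(hpr.isCoveringMap (pr p)).discreteTopology_fiber⟩
    exact this.mono Set.inter_subset_left
  refine Set.Finite.of_finite_image (f := fun γ : deckGroup pr => γ.1 p)
    (hfib.subset ?_) ?_
  · rintro _ ⟨γ, hγ, rfl⟩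
    exact ⟨deckGroup_apply γ.2 p, hγ⟩
  · intro γ _ γ' _ h
    refine Subtype.ext (Homeomorph.ext fun z => congrFun ?_ z)
    refine hpr.isCoveringMap.eq_of_comp_eq γ.1.continuous γ'.1.continuous ?_ p h
    exact funext fun z => (deckGroup_apply γ.2 z).trans (deckGroup_apply γ'.2 z).symm

variable [IsRiemannianManifold (𝓡 n) X]

/-- `pr` preserves lengths and `pr ∘ γ = pr`, so `γ` preserves lengths of paths. -/
lemma edist_deck_le (hpr : IsRiemannianUniversalCover n pr) {γ : X ≃ₜ X} (hγ : γ ∈ deckGroup pr)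
    (x y : X) : edist (γ x) (γ y) ≤ edist x y := by
  refine le_of_forall_gt fun l hl => ?_
  obtain ⟨c, h0, h1, hc, hlen⟩ := exists_pathELength_lt (n := n) hl
  have hcomp : pr ∘ (γ ∘ c) = pr ∘ c := funext fun t => deckGroup_apply hγ (c t)
  have hsm : ContMDiffOn 𝓘(ℝ, ℝ) (𝓡 n) 1 (γ ∘ c) (Set.Icc 0 1) := by
    refine hpr.contMDiffOn_of_comp (γ.continuous.comp hc.continuous).continuousOn ?_
    rw [hcomp]
    exact ((hpr.isLocalDiffeomorph.contMDiff.of_le (by norm_num)).comp hc).contMDiffOn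
  have h2 := edist_le_pathELength zero_le_one hsm
  rw [← hpr.pathELength_comp zero_lt_one hsm, hcomp,
    hpr.pathELength_comp zero_lt_one hc.contMDiffOn] at h2
  rw [← h0, ← h1]
  exact h2.trans_lt hlen

lemma isometry_deck (hpr : IsRiemannianUniversalCover n pr) {γ : X ≃ₜ X}
    (hγ : γ ∈ deckGroup pr) : Isometry γ := by
  refine fun x y => le_antisymm (hpr.edist_deck_le hγ x y) ?_
  have h := hpr.edist_deck_le ((deckGroup pr).inv_mem hγ) (γ x) (γ y)
  have e : ∀ z, γ⁻¹ (γ z) = z := γ.symm_apply_apply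
  rwa [e, e] at h

/-- Paths of the base lift, so that points of the base are covered nearby. -/
lemma exists_dist_lt (hpr : IsRiemannianUniversalCover n pr) [IsRiemannianManifold (𝓡 n) M]
    (x : X) (m : M) {l : ℝ} (hl : dist (pr x) m < l) : ∃ y, pr y = m ∧ dist x y < l := by
  have hl0 : 0 < l := dist_nonneg.trans_lt hl
  obtain ⟨c, h0, h1, hc, hlen⟩ := exists_pathELength_lt (n := n) (x := pr x) (y := m)
    (l := ENNReal.ofReal l) (by rw [edist_dist]; exact (ENNReal.ofReal_lt_ofReal_iff hl0).2 hl)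
  obtain ⟨Γ, hΓ, hΓ0⟩ := hpr.isCoveringMap.exists_path_lifts
    ⟨fun t => c t, hc.continuous.comp continuous_subtype_val⟩ x (by simpa using h0)
  set c' : ℝ → X := Γ ∘ Set.projIcc 0 1 zero_le_one
  have hcc : Set.EqOn (pr ∘ c') c (Set.Icc 0 1) := by
    intro t ht
    have := congrFun hΓ (Set.projIcc 0 1 zero_le_one t)
    simpa [c', Set.projIcc_of_mem zero_le_one ht] using this
  have hsm : ContMDiffOn 𝓘(ℝ, ℝ) (𝓡 n) 1 c' (Set.Icc 0 1) :=
    hpr.contMDiffOn_of_comp (Γ.continuous.comp continuous_projIcc).continuousOn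
      (hc.contMDiffOn.congr hcc)
  have h2 := edist_le_pathELength zero_le_one hsm
  rw [← hpr.pathELength_comp zero_lt_one hsm, Manifold.pathELength_congr hcc] at h2
  have e0 : c' 0 = x := by simp [c', hΓ0]
  refine ⟨c' 1, (hcc ⟨zero_le_one, le_rfl⟩).trans h1, ?_⟩
  rw [e0] at h2
  have h3 := h2.trans_lt hlen
  rwa [edist_dist, ENNReal.ofReal_lt_ofReal_iff hl0] at h3

variable [IsRiemannianManifold (𝓡 n) M]

lemma surjective [Nonempty X] (hpr : IsRiemannianUniversalCover n pr) :
    Function.Surjective pr := fun m => by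
  obtain ⟨y, hy, -⟩ := hpr.exists_dist_lt (Classical.arbitrary X) m (lt_add_one _)
  exact ⟨y, hy⟩

/-- Compactness of `M` gives one radius for which balls about points of finitely many patches are
compact. Deck isometries carry this to all of `X`, and geodesics then give properness. -/
lemma properSpace (hpr : IsRiemannianUniversalCover n pr) [CompactSpace M] (hX : IsGeodesic X) :
    ProperSpace X := by
  have := hpr.simplyConnected
  have : LocallyCompactSpace X := ChartedSpace.locallyCompactSpace (EuclideanSpace ℝ (Fin n)) X
  have hr : ∀ y : X, ∃ r > 0, IsCompact (Metric.closedBall y (2 * r)) := by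
    intro y
    obtain ⟨K, hK, hKy⟩ := exists_compact_mem_nhds y
    obtain ⟨r, hr, hrK⟩ := Metric.nhds_basis_closedBall.mem_iff.1 hKy
    refine ⟨r / 2, by positivity, hK.of_isClosed_subset Metric.isClosed_closedBall ?_⟩
    rwa [mul_div_cancel₀ _ two_ne_zero]
  choose r hr0 hr using hr
  have hsec := hpr.surjective
  choose s hs using hsec
  obtain ⟨t, ht⟩ := isCompact_univ.elim_nhds_subcover
    (fun m : M => pr '' Metric.ball (s m) (r (s m))) (fun m _ => by
      have := hpr.isLocalDiffeomorph.isOpenMap.image_mem_nhds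
        (Metric.ball_mem_nhds (s m) (hr0 (s m)))
      rwa [hs] at this)
  obtain ⟨ε, hε, hεt⟩ : ∃ ε > 0, ∀ m ∈ t, ε ≤ r (s m) := by
    have : ∀ᶠ ε in 𝓝[>] (0 : ℝ), ∀ m ∈ t, ε ≤ r (s m) := by
      rw [Filter.eventually_all_finset]
      exact fun m _ => nhdsWithin_le_nhds (eventually_le_nhds (hr0 _))
    obtain ⟨ε, h1, h2⟩ := (this.and self_mem_nhdsWithin).exists
    exact ⟨ε, h2, h1⟩
  refine hX.properSpace hε fun x => ?_
  obtain ⟨m, hm, z, hz, hzx⟩ := Set.mem_iUnion₂.1 (ht.2 (Set.mem_univ (pr x)))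
  obtain ⟨γ, hγ, hγz⟩ := hpr.exists_deck hzx
  have hcomp : IsCompact (Metric.closedBall z ε) := by
    refine (hr (s m)).of_isClosed_subset Metric.isClosed_closedBall
      (Metric.closedBall_subset_closedBall' ?_)
    have := hεt m hm
    rw [Metric.mem_ball] at hz
    linarith
  have h2 := (hcomp.image γ.continuous)
  convert h2 using 1
  rw [← hγz]
  exact ((IsometryEquiv.mk γ.toEquiv (hpr.isometry_deck hγ)).image_closedBall z ε).symm

lemma exists_deck_dist_le (hpr : IsRiemannianUniversalCover n pr) [CompactSpace M]
    [ProperSpace X] (p x : X) :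
    ∃ γ : deckGroup pr, dist x (γ.1 p) ≤ Metric.diam (Set.univ : Set M) := by
  set R := Metric.diam (Set.univ : Set M)
  have hR : dist (pr x) (pr p) ≤ R :=
    Metric.dist_le_diam_of_mem isCompact_univ.isBounded (Set.mem_univ _) (Set.mem_univ _)
  -- Lifting almost shortest paths gives orbit points at distance below any `l > R`; finiteness of
  -- the orbit in balls then attains `R` itself.
  have hnear : ∀ l, R < l → ∃ γ : deckGroup pr, dist x (γ.1 p) < l := by
    intro l hl
    obtain ⟨y, hy, hxy⟩ := hpr.exists_dist_lt x (pr p) (hR.trans_lt hl)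
    obtain ⟨γ, hγ, rfl⟩ := hpr.exists_deck hy.symm
    exact ⟨⟨γ, hγ⟩, hxy⟩
  obtain ⟨γ₀, hγ₀⟩ := hnear (R + 1) (lt_add_one R)
  obtain ⟨γ, hγ, hmin⟩ := Set.exists_min_image _ (fun γ : deckGroup pr => dist (γ.1 p) x)
    (hpr.finite_deck p x (R + 1)) ⟨γ₀, by rw [dist_comm] at hγ₀; exact hγ₀.le⟩
  refine ⟨γ, ?_⟩
  by_contra! hlt
  obtain ⟨γ', hγ'⟩ := hnear (min (dist x (γ.1 p)) (R + 1)) (lt_min hlt (lt_add_one R))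
  have h1 := hmin γ' (by
    rw [dist_comm] at hγ'
    exact (hγ'.trans_le (min_le_right _ _)).le)
  rw [dist_comm _ x, dist_comm _ x] at h1
  exact absurd (hγ'.trans_le (min_le_left _ _)) h1.not_gt

end IsRiemannianUniversalCover

/-- The fundamental group of a compact negatively curved manifold acts cocompactly on the universal
cover. -/
theorem IsRiemannianUniversalCover.isCocompactAction {n : ℕ} (hn : 2 ≤ n) {M : Type*}
    [MetricSpace M] [ChartedSpace (EuclideanSpace ℝ (Fin n)) M]
    [RiemannianBundle (fun x : M => TangentSpace (𝓡 n) x)]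
    [IsRiemannianManifold (𝓡 n) M] [CompactSpace M]
    {X : Type*} [MetricSpace X] [ChartedSpace (EuclideanSpace ℝ (Fin n)) X]
    [IsManifold (𝓡 n) 1 X] [RiemannianBundle (fun x : X => TangentSpace (𝓡 n) x)]
    [IsContinuousRiemannianBundle (EuclideanSpace ℝ (Fin n)) (fun x : X => TangentSpace (𝓡 n) x)]
    [IsRiemannianManifold (𝓡 n) X] [ProperSpace X]
    {pr : X → M} (hpr : IsRiemannianUniversalCover n pr)
    (hX : IsCATNegOne X) {δ : ℝ} (hδ : 0 ≤ δ) (hyp : IsHyperbolic X δ) (p : X) :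
    IsCocompactAction (deckGroup pr) p (Metric.diam (Set.univ : Set M)) δ where
  cat := hX
  nonneg := hδ
  hyp := hyp
  isometry γ hγ := hpr.isometry_deck hγ
  radius_nonneg := Metric.diam_nonneg
  dense := hpr.exists_deck_dist_le p
  finite := hpr.finite_deck p p
  annulus x hx := by
    obtain ⟨_, ⟨γ, rfl⟩, h⟩ := hX.exists_mem_abs_dist_sub_lt (hasOppositePoints n X)
      (hasConnectedPuncturedNhds n X hn) (Z := Set.range fun γ : deckGroup pr => γ.1 p)
      (R := Metric.diam (Set.univ : Set M))
      (fun y => by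
        obtain ⟨γ, hγ⟩ := hpr.exists_deck_dist_le p y
        exact ⟨_, ⟨γ, rfl⟩, hγ⟩)
      (fun y r => by
        refine ((hpr.finite_deck p y r).image fun γ : deckGroup pr => γ.1 p).subset ?_
        rintro _ ⟨⟨γ, rfl⟩, hγ⟩
        exact ⟨γ, hγ, rfl⟩) hx.symm
    exact ⟨γ, h⟩

end BoundaryRep

theorem proposition3p7 (n : ℕ) (hn : 2 ≤ n)
    {M : Type*} [MetricSpace M] [ChartedSpace (EuclideanSpace ℝ (Fin n)) M]
    [IsManifold (𝓡 n) ∞ M]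
    [RiemannianBundle (fun x : M => TangentSpace (𝓡 n) x)]
    [IsContMDiffRiemannianBundle (𝓡 n) ∞ (EuclideanSpace ℝ (Fin n))
      (fun x : M => TangentSpace (𝓡 n) x)]
    [IsRiemannianManifold (𝓡 n) M] [CompactSpace M] [ConnectedSpace M]
    {X : Type*} [MetricSpace X] [ChartedSpace (EuclideanSpace ℝ (Fin n)) X]
    [IsManifold (𝓡 n) ∞ X]
    [RiemannianBundle (fun x : X => TangentSpace (𝓡 n) x)]
    [IsContMDiffRiemannianBundle (𝓡 n) ∞ (EuclideanSpace ℝ (Fin n))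
      (fun x : X => TangentSpace (𝓡 n) x)]
    [IsRiemannianManifold (𝓡 n) X]
    (pr : X → M) (hpr : BoundaryRep.IsRiemannianUniversalCover n pr)
    (hX : BoundaryRep.IsCATNegOne X)
    (δ : ℝ) (hδ : 0 ≤ δ) (hyp : BoundaryRep.IsHyperbolic X δ) (p : X) :
    ∃ C : ℝ≥0, ∀ t : ℝ, Metric.diam (Set.univ : Set M) + 2 * δ < t →
      MemLp (BoundaryRep.avg n pr p t) ∞ (BoundaryRep.nu n p) ∧
      eLpNorm (BoundaryRep.avg n pr p t) ∞ (BoundaryRep.nu n p) ≤ C := by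
  have := BoundaryRep.isContinuousRiemannianBundle_of_isContMDiffRiemannianBundle (n := n) (X := X)
  have := hpr.properSpace hX.geodesic
  obtain ⟨C, hC⟩ := BoundaryRep.exists_memLp_avg n pr (hpr.isCocompactAction hn hX hδ hyp p)
  refine ⟨C, fun t ht => hC t ?_⟩
  have := Metric.diam_nonneg (s := (Set.univ : Set M))
  linarith
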